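/- **Setting.** Let $K$ be a field of characteristic $0$, $N\ge 1$, and let $q\in K$ be nonzero and not a root of unity. Put $k:=q-q^{-1}$ and $[y]_q:=\frac{q^y-q^{-y}}{q-q^{-1}}$. Write $e_i^j$ for the $N\times N$ matrix unit with $1$ in column $i$ and row $j$, and write $A^{ij}_{hk}$ for the entry of an $N^2\times N^2$ matrix $A$ in row $(i,j)$ and column $(h,k)$. For such an $A$, $A_{m(m+1)}$ is the $N^l\times N^l$ matrix acting as $A$ on the $m$-th and $(m+1)$-th tensor factors of $(K^N)^{\otimes l}$ and as the identity on the others. *Case $H=U_qgl(N)$.* The indices are $1,\dots,N$ and $$\hat R=q\sum_i e_i^i\otimes e_i^i+\sum_{i\neq j}e_i^j\otimes e_j^i+k\sum_{i<j}e_i^i\otimes e_j^j,\qquad \mathcal P^\pm=\frac{q^{\mp1}\mathbf 1_{N^2}\pm\hat R}{q+q^{-1}}.$$ Put $d^{-,l}=\binom Nl$ and $d^{+,l}=\binom{N-1+l}{N-1}$. *Case $H=U_qso(N)$.* Here fix moreover a square root $q^{1/2}\in K$ of $q$. The indices are $-n,\dots,-1,0,1,\dots,n$ if $N=2n+1$,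 and $-n,\dots,-1,1,\dots,n$ if $N=2n$. In this order of the indices, $(2\rho_i)=(N-2,N-4,\dots,1,0,-1,\dots,2-N)$ for $N$ odd and $(2\rho_i)=(N-2,N-4,\dots,0,0,\dots,2-N)$ for $N$ even. Put $g_{ij}=g^{ij}=q^{\rho_j}\delta_{-i,j}$, $Q_N=\sum_{l,m}g^{lm}g_{lm}$, $\mathcal P^{t\,ij}_{\ \ hk}=\frac1{Q_N}g^{ij}g_{hk}$, $$\hat R=q\sum_{i\ne0}e_i^i\otimes e_i^i+\sum_{\substack{i\neq j,-j\\ \text{or }i=-j=0}}e_i^j\otimes e_j^i+q^{-1}\sum_{i\neq0}e_i^{-i}\otimes e_{-i}^i+k\Big(\sum_{i<j}e_i^i\otimes e_j^j-\sum_{i<j}q^{-\rho_i+\rho_j}e_i^{-j}\otimes e_{-i}^j\Big),$$ $$\mathcal P^\pm=\frac{q^{\mp1}\mathbf 1_{N^2}\pm\hat R-(q^{\mp1}\pm q^{1-N})\mathcal P^t}{q+q^{-1}}.$$ Put $d^{-,l}=\binom Nl$, and let $d^{+,l}=\binom{N-1+l}{N-1}-\binom{N-3+l}{N-1}$ for $l\ge2$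 and $d^{+,1}=N$. **Definition.** In either case and for $l\ge1$, the completely symmetric/antisymmetric projector $\mathcal P^{\pm,l}$ is the $N^l\times N^l$ matrix characterized by $$\mathcal P^{\pm,l}\mathcal P^\pi_{m(m+1)}=\delta^\pm_\pi\,\mathcal P^{\pm,l}=\mathcal P^\pi_{m(m+1)}\mathcal P^{\pm,l},\qquad(\mathcal P^{\pm,l})^2=\mathcal P^{\pm,l},\qquad \operatorname{tr}\mathcal P^{\pm,l}=d^{\pm,l},$$ for all $m=1,\dots,l-1$ and all $\pi\in\{-,+\}$ (for $U_qgl(N)$), respectively $\pi\in\{-,+,t\}$ (for $U_qso(N)$). **Proposition 1.** In both cases and for both signs, for every $l\ge1$ there is exactly one matrix $\mathcal P^{\pm,l}$ with these properties; $\mathcal P^{\pm,1}=\mathbf 1_N$; and for every $l\ge 1$ both recursive relations $$\mathcal P^{\pm,l+1}=\mathcal P^{\pm,l}_{1\dots l}\,M^{\pm,l+1}_{l(l+1)}\,\mathcal P^{\pm,l}_{1\dots l},\qquad \mathcal P^{\pm,l+1}=\mathcal P^{\pm,l}_{2\dots(l+1)}\,M^{\pm,l+1}_{12}\,\mathcal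 P^{\pm,l}_{2\dots(l+1)}$$ hold, where $\mathcal P^{\pm,l}_{1\dots l}=\mathcal P^{\pm,l}\otimes\mathbf 1_N$, $\mathcal P^{\pm,l}_{2\dots(l+1)}=\mathbf 1_N\otimes\mathcal P^{\pm,l}$ and $$M^{\pm,l+1}=\frac1{[l+1]_q}\Big[q^{\mp l}\mathbf 1_{N^2}\pm[l]_q\hat R\Big]\quad\text{if }H=U_qgl(N),$$ $$M^{\pm,l+1}=\frac1{[l+1]_q}\Big[q^{\mp l}\mathbf 1_{N^2}\pm[l]_q\hat R+\frac{Q_N(q^{\pm2}-1)[l]_q}{q^{\pm1}\mp q^{N-1\pm2l}}\mathcal P^t\Big]\quad\text{if }H=U_qso(N).$$ Moreover, for every $l\ge1$, $\mathcal P^{\pm,l}$ is a polynomial in $\hat R_{12},\dots,\hat R_{(l-1)l}$ and is symmetric, $(\mathcal P^{\pm,l})^T=\mathcal P^{\pm,l}$; and if $H=U_qso(N)$ then, for all indices $i_1,\dots,i_l,k_1,\dots,k_l$ and with summation over the $j$'s, $$\mathcal P^{\pm,l\,i_1\dots i_l}_{\ \ \ \ j_1\dots j_l}\,g^{j_1k_1}\cdots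 g^{j_lk_l}=g^{i_1j_1}\cdots g^{i_lj_l}\,\mathcal P^{\pm,l\,j_l\dots j_1}_{\ \ \ \ k_l\dots k_1},$$ and the same holds with the matrix $g^{ij}$ replaced by its transpose $g^{ji}$. -/

import Mathlib

open scoped Kronecker

namespace QProj

/-- The two signs `±`: `plus` labels symmetric, `minus` antisymmetric objects. -/
inductive PM where
  | plus
  | minus
  deriving DecidableEq

/-- The sign as the integer `+1` or `-1`. -/
def PM.sgn : PM → ℤ
  | .plus => 1
  | .minus => -1

/-- `N² × N²` matrices; the entry `A (i, j) (h, k)` is `A^{ij}_{hk}`. -/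
abbrev Mat2 (K : Type*) (N : ℕ) := Matrix (Fin N × Fin N) (Fin N × Fin N) K

/-- `N^l × N^l` matrices; the entry `P i j` is `P^{i_1 … i_l}_{j_1 … j_l}`. -/
abbrev TMat (K : Type*) (N l : ℕ) := Matrix (Fin l → Fin N) (Fin l → Fin N) K

section
variable {K : Type*} [Field K] {N : ℕ}

/-- `A_{m(m+1)}`: the matrix on `l`-tensors acting as `A` on two adjacent tensor factors and as the
identity on the others. The factors are numbered from `0` here. -/
def atSite {l : ℕ} (A : Mat2 K N) (m : ℕ) (h : m + 1 < l) : TMat K N l :=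
  Matrix.of fun i j =>
    if ∀ r : Fin l, (r : ℕ) ≠ m → (r : ℕ) ≠ m + 1 → i r = j r then
      A (i ⟨m, Nat.lt_of_succ_lt h⟩, i ⟨m + 1, h⟩) (j ⟨m, Nat.lt_of_succ_lt h⟩, j ⟨m + 1, h⟩)
    else 0

/-- `P_{1…l} = P ⊗ 1_N`. -/
def tensorOne {l : ℕ} (P : TMat K N l) : TMat K N (l + 1) :=
  Matrix.of fun i j =>
    if i (Fin.last l) = j (Fin.last l) then P (Fin.init i) (Fin.init j) else 0

/-- `P_{2…(l+1)} = 1_N ⊗ P`. -/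
def oneTensor {l : ℕ} (P : TMat K N l) : TMat K N (l + 1) :=
  Matrix.of fun i j => if i 0 = j 0 then P (Fin.tail i) (Fin.tail j) else 0

/-- The `q`-number `[y]_q = (q^y - q^{-y}) / (q - q^{-1})`. -/
def qnum (q : K) (y : ℤ) : K := (q ^ y - q ^ (-y)) / (q - q⁻¹)

/-- `e_i^j`, the matrix unit with a `1` in column `i` and row `j`. -/
def e (i j : Fin N) : Matrix (Fin N) (Fin N) K := Matrix.single j i 1

/-- The defining properties of a completely (anti)symmetric projector on `l`-tensors, relative to
the family `p` of projectors of 2-tensors, the member `p ε` of this family and the dimension `d`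
of the target. -/
structure IsCompleteProjector {ι : Type*} [DecidableEq ι] (p : ι → Mat2 K N) (ε : ι) (d : ℕ)
    (l : ℕ) (P : TMat K N l) : Prop where
  mul_right : ∀ (π : ι) (m : ℕ) (h : m + 1 < l),
    P * atSite (p π) m h = if π = ε then P else 0
  mul_left : ∀ (π : ι) (m : ℕ) (h : m + 1 < l),
    atSite (p π) m h * P = if π = ε then P else 0
  idem : P ^ 2 = P
  trace : P.trace = (d : K)

/-- The unital algebra of polynomials in the (noncommuting) matrices
`R_{12}, R_{23}, …, R_{(l-1)l}`. -/
def braidPolynomials (R : Mat2 K N) (l : ℕ) : Subalgebra K (TMat K N l) :=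
  Algebra.adjoin K {A | ∃ (m : ℕ) (h : m + 1 < l), A = atSite R m h}

/-! ### The series `U_q gl(N)`; the indices `1, …, N` are the elements of `Fin N`. -/

/-- The braid matrix of `U_q gl(N)`. -/
def glR (q : K) : Mat2 K N :=
  q • (∑ i : Fin N, e i i ⊗ₖ e i i)
    + (∑ i : Fin N, ∑ j : Fin N with i ≠ j, e i j ⊗ₖ e j i)
    + (q - q⁻¹) • (∑ i : Fin N, ∑ j : Fin N with i < j, e i i ⊗ₖ e j j)

/-- The projectors `P^±` of 2-tensors for `U_q gl(N)`. -/
def glP (q : K) (ε : PM) : Mat2 K N :=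
  (q + q⁻¹)⁻¹ • (q ^ (-ε.sgn) • (1 : Mat2 K N) + (ε.sgn : K) • glR q)

/-- The dimension of the `l`-fold completely (anti)symmetric representation of `U_q gl(N)`. -/
def glDim (N : ℕ) : PM → ℕ → ℕ
  | .plus, l => (N - 1 + l).choose (N - 1)
  | .minus, l => N.choose l

/-- `P` is the projector `P^{±,l}` of `U_q gl(N)`. -/
def IsGlProjector (q : K) (ε : PM) (l : ℕ) (P : TMat K N l) : Prop :=
  IsCompleteProjector (glP q) ε (glDim N ε l) l P

/-- The matrix `M^{±,l+1}` for `U_q gl(N)`. -/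
def glM (q : K) (ε : PM) (l : ℕ) : Mat2 K N :=
  (qnum q (l + 1))⁻¹ •
    (q ^ (-(ε.sgn * l)) • (1 : Mat2 K N) + ((ε.sgn : K) * qnum q l) • glR q)

/-! ### The series `U_q so(N)`

The parameter is `s = q^{1/2}`. The indices `-n, …, n` (with `0` omitted if `N = 2n`) are, in this
order, the elements of `Fin N`, so that `-i` is `i.rev`, and `i = 0` means `i.rev = i`. -/

/-- The integers `2ρ_i`: `(N-2, N-4, …, 1, 0, -1, …, 2-N)` for odd `N`,
`(N-2, N-4, …, 0, 0, …, 2-N)` for even `N`. -/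
def twoRho (i : Fin N) : ℤ :=
  if i < i.rev then (N : ℤ) - 2 - 2 * (i : ℕ)
  else if i = i.rev then 0
  else (N : ℤ) - 2 * (i : ℕ)

/-- The metric `g_{ij} = g^{ij} = q^{ρ_j} δ_{-i,j}`. -/
def soG (s : K) : Matrix (Fin N) (Fin N) K :=
  Matrix.of fun i j => if i.rev = j then s ^ twoRho j else 0

/-- `Q_N = g^{lm} g_{lm}`. -/
def soQ (N : ℕ) (s : K) : K := ∑ l : Fin N, ∑ m : Fin N, soG s l m * soG s l m

/-- The trace projector `P^t`. -/
def soPt (s : K) : Mat2 K N :=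
  Matrix.of fun a b => (soQ N s)⁻¹ * (soG s a.1 a.2 * soG s b.1 b.2)

/-- The braid matrix of `U_q so(N)`, `q = s²`. -/
def soR (s : K) : Mat2 K N :=
  s ^ 2 • (∑ i : Fin N with i ≠ i.rev, e i i ⊗ₖ e i i)
    + (∑ i : Fin N, ∑ j : Fin N with (i ≠ j ∧ i ≠ j.rev) ∨ (i = j.rev ∧ i = i.rev),
        e i j ⊗ₖ e j i)
    + (s ^ 2)⁻¹ • (∑ i : Fin N with i ≠ i.rev, e i i.rev ⊗ₖ e i.rev i)
    + (s ^ 2 - (s ^ 2)⁻¹) •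
      ((∑ i : Fin N, ∑ j : Fin N with i < j, e i i ⊗ₖ e j j)
        - ∑ i : Fin N, ∑ j : Fin N with i < j,
            s ^ (-twoRho i + twoRho j) • (e i j.rev ⊗ₖ e i.rev j))

/-- The projectors of 2-tensors for `U_q so(N)`, `q = s²`: `some ε` labels `P^±` and `none`
labels `P^t`. -/
def soP (s : K) : Option PM → Mat2 K N
  | some ε => (s ^ 2 + (s ^ 2)⁻¹)⁻¹ •
      ((s ^ 2) ^ (-ε.sgn) • (1 : Mat2 K N) + (ε.sgn : K) • soR s
        - ((s ^ 2) ^ (-ε.sgn) + (ε.sgn : K) * (s ^ 2) ^ (1 - (N : ℤ))) • soPt s)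
  | none => soPt s

/-- The dimension of the `l`-fold completely (anti)symmetric (and, for `+`, trace-free)
representation of `U_q so(N)`. -/
def soDim (N : ℕ) : PM → ℕ → ℕ
  | .plus, l => (N - 1 + l).choose (N - 1) - if 2 ≤ l then (N + l - 3).choose (N - 1) else 0
  | .minus, l => N.choose l

/-- `P` is the projector `P^{±,l}` of `U_q so(N)`, `q = s²`. -/
def IsSoProjector (s : K) (ε : PM) (l : ℕ) (P : TMat K N l) : Prop :=
  IsCompleteProjector (soP s) (some ε) (soDim N ε l) l P

/-- The matrix `M^{±,l+1}` for `U_q so(N)`, `q = s²`. -/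
def soM (s : K) (ε : PM) (l : ℕ) : Mat2 K N :=
  (qnum (s ^ 2) (l + 1))⁻¹ •
    ((s ^ 2) ^ (-(ε.sgn * l)) • (1 : Mat2 K N) + ((ε.sgn : K) * qnum (s ^ 2) l) • soR s
      + (soQ N s * ((s ^ 2) ^ (2 * ε.sgn) - 1) * qnum (s ^ 2) l
          / ((s ^ 2) ^ ε.sgn - (ε.sgn : K) * (s ^ 2) ^ ((N : ℤ) - 1 + 2 * ε.sgn * l))) • soPt s)

/-- Compatibility of `P` with a metric `g`:
`P^{i_1…i_l}_{j_1…j_l} g^{j_1k_1} ⋯ g^{j_lk_l} = g^{i_1j_1} ⋯ g^{i_lj_l} P^{j_l…j_1}_{k_l…k_1}`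
(sums over the `j`'s). -/
def MetricCompatible (g : Matrix (Fin N) (Fin N) K) {l : ℕ} (P : TMat K N l) : Prop :=
  ∀ i k : Fin l → Fin N,
    ∑ j : Fin l → Fin N, P i j * ∏ r, g (j r) (k r)
      = ∑ j : Fin l → Fin N, (∏ r, g (i r) (j r)) * P (j ∘ Fin.rev) (k ∘ Fin.rev)

end

end QProj

/-!
On two neighbouring tensor factors the matrices `R̂` and `Q_N P^t` satisfy the relations of the
Birman–Murakami–Wenzl algebra (the Hecke algebra, with `P^t` replaced by `0`, for `U_q gl(N)`).
These relations alone imply that the recursion, started at `1`, produces symmetric idempotents onto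
the common eigenspace of the `R̂_{m(m+1)}` for the eigenvalue `± q^{±1}`. Any projector with the
defining properties is an idempotent of the same trace that is absorbed by this one from both sides,
hence equal to it; and `g ⊗ g` intertwines `R̂` with its flip, so `g ⊗ ⋯ ⊗ g` intertwines `P^{±,l}`
with its reversal.

The trace of an idempotent is a natural number, so it can be computed with `q` an indeterminate and
is unchanged by specialization both to the given `q` and to `q = 1`, where `R̂` is the flip and the
partial trace of the recursion gives the dimension.

The braid relation for `U_q so(N)` is not checked entry by entry. By the other relations, the defect
`D = R̂₁ R̂₂ R̂₁ - R̂₂ R̂₁ R̂₂`, with `R̂₁ = R̂₁₂` and `R̂₂ = R̂₂₃`, satisfies `D R̂₁ = k D - R̂₂ D`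
and annihilates all `g ⊗ v` and `v ⊗ g`. This reduces `D = 0` to `D v = 0` for the vectors
`v = e_y ⊗ e_y ⊗ e_{-y}` with `y ≠ -y`, where `D v` is a multiple of `D u` for
`u = e_{-y} ⊗ e_y ⊗ e_y`. These are eigenvectors, `R̂₁ v = q v` and `R̂₂ u = q u`, so that pairing
any such `u` with any such `v` gives `q ⟨u, D v⟩ = k ⟨u, D v⟩ - q ⟨u, D v⟩`, that is,
`(q + q⁻¹) ⟨u, D v⟩ = 0`; as `D` is symmetric, this means `D u = 0`.
-/

namespace QProj

/-! ### Tensor factors -/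

section TensorFactors

variable {N l : ℕ}

theorem sum_tuple_snoc {M : Type*} [AddCommMonoid M] (f : (Fin (l + 1) → Fin N) → M) :
    ∑ i, f i = ∑ x : Fin N, ∑ i : Fin l → Fin N, f (Fin.snoc i x) := by
  rw [← (Fin.snocEquiv fun _ : Fin (l + 1) => Fin N).sum_comp, Fintype.sum_prod_type]
  rfl

theorem sum_tuple_cons {M : Type*} [AddCommMonoid M] (f : (Fin (l + 1) → Fin N) → M) :
    ∑ i, f i = ∑ x : Fin N, ∑ i : Fin l → Fin N, f (Fin.cons x i) := by
  rw [← (Fin.consEquiv fun _ : Fin (l + 1) => Fin N).sum_comp, Fintype.sum_prod_type]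
  rfl

theorem matrix_ext_snoc {M : Type*} {A B : TMat M N (l + 1)}
    (h : ∀ i x j y, A (Fin.snoc i x) (Fin.snoc j y) = B (Fin.snoc i x) (Fin.snoc j y)) :
    A = B := by
  ext i j
  simpa using h (Fin.init i) (i (Fin.last l)) (Fin.init j) (j (Fin.last l))

theorem matrix_ext_cons {M : Type*} {A B : TMat M N (l + 1)}
    (h : ∀ x i y j, A (Fin.cons x i) (Fin.cons y j) = B (Fin.cons x i) (Fin.cons y j)) :
    A = B := by
  ext i j
  simpa using h (i 0) (Fin.tail i) (j 0) (Fin.tail j)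

variable {K : Type*} [Field K]

theorem tensorOne_snoc (P : TMat K N l) (i j : Fin l → Fin N) (x y : Fin N) :
    tensorOne P (Fin.snoc i x) (Fin.snoc j y) = if x = y then P i j else 0 := by
  simp [tensorOne]

theorem oneTensor_cons (P : TMat K N l) (i j : Fin l → Fin N) (x y : Fin N) :
    oneTensor P (Fin.cons x i) (Fin.cons y j) = if x = y then P i j else 0 := by
  simp [oneTensor]

/-- `P ↦ P ⊗ 1` as a homomorphism of algebras. -/
def tensorOneHom (K : Type*) [Field K] (N l : ℕ) : TMat K N l →ₐ[K] TMat K N (l + 1) :=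
  AlgHom.ofLinearMap
    { toFun := tensorOne
      map_add' := fun P Q => matrix_ext_snoc fun i x j y => by
        simp only [tensorOne_snoc, Matrix.add_apply, ite_add_ite, add_zero]
      map_smul' := fun r P => matrix_ext_snoc fun i x j y => by
        simp only [tensorOne_snoc, Matrix.smul_apply, smul_ite, smul_zero, RingHom.id_apply] }
    (matrix_ext_snoc fun i x j y => by
      simp only [LinearMap.coe_mk, AddHom.coe_mk, tensorOne_snoc, Matrix.one_apply,
        Fin.snoc_inj, ← ite_and, and_comm])
    (fun P Q => matrix_ext_snoc fun i x j y => by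
      simp only [LinearMap.coe_mk, AddHom.coe_mk, tensorOne_snoc, Matrix.mul_apply, sum_tuple_snoc]
      simp)

/-- `P ↦ 1 ⊗ P` as a homomorphism of algebras. -/
def oneTensorHom (K : Type*) [Field K] (N l : ℕ) : TMat K N l →ₐ[K] TMat K N (l + 1) :=
  AlgHom.ofLinearMap
    { toFun := oneTensor
      map_add' := fun P Q => matrix_ext_cons fun x i y j => by
        simp only [oneTensor_cons, Matrix.add_apply, ite_add_ite, add_zero]
      map_smul' := fun r P => matrix_ext_cons fun x i y j => by
        simp only [oneTensor_cons, Matrix.smul_apply, smul_ite, smul_zero, RingHom.id_apply] }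
    (matrix_ext_cons fun x i y j => by
      simp only [LinearMap.coe_mk, AddHom.coe_mk, oneTensor_cons, Matrix.one_apply,
        Fin.cons_inj, ← ite_and])
    (fun P Q => matrix_ext_cons fun x i y j => by
      simp only [LinearMap.coe_mk, AddHom.coe_mk, oneTensor_cons, Matrix.mul_apply, sum_tuple_cons]
      simp)

theorem tensorOneHom_apply (P : TMat K N l) : tensorOneHom K N l P = tensorOne P := rfl

theorem oneTensorHom_apply (P : TMat K N l) : oneTensorHom K N l P = oneTensor P := rfl

theorem tensorOneHom_atSite (A : Mat2 K N) {m : ℕ} (h : m + 1 < l) :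
    tensorOneHom K N l (atSite A m h) = atSite A m (Nat.lt_succ_of_lt h) := by
  ext i j
  have agree : (i (Fin.last l) = j (Fin.last l) ∧ ∀ r : Fin l, (r : ℕ) ≠ m → (r : ℕ) ≠ m + 1 →
      Fin.init i r = Fin.init j r) ↔
      ∀ r : Fin (l + 1), (r : ℕ) ≠ m → (r : ℕ) ≠ m + 1 → i r = j r := by
    rw [Fin.forall_fin_succ', and_comm]
    simp only [Fin.init, Fin.val_castSucc, Fin.val_last]
    exact and_congr_right fun _ => ⟨fun h _ _ => h, fun h => h (by omega) (by omega)⟩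
  simp only [tensorOneHom_apply, tensorOne, atSite, Matrix.of_apply]
  rw [← ite_and]
  exact if_congr agree rfl rfl

theorem oneTensorHom_atSite (A : Mat2 K N) {m : ℕ} (h : m + 1 < l) :
    oneTensorHom K N l (atSite A m h) = atSite A (m + 1) (Nat.succ_lt_succ h) := by
  ext i j
  have agree : (i 0 = j 0 ∧ ∀ r : Fin l, (r : ℕ) ≠ m → (r : ℕ) ≠ m + 1 →
      Fin.tail i r = Fin.tail j r) ↔
      ∀ r : Fin (l + 1), (r : ℕ) ≠ m + 1 → (r : ℕ) ≠ m + 1 + 1 → i r = j r := by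
    simp [Fin.forall_fin_succ, Fin.tail]
  simp only [oneTensorHom_apply, oneTensor, atSite, Matrix.of_apply]
  rw [← ite_and]
  exact if_congr agree rfl rfl

theorem atSite_zero_cons (A : Mat2 K N) (h : 0 + 1 < l + 2) (a b a' b' : Fin N)
    (i j : Fin l → Fin N) :
    atSite A 0 h (Fin.cons a (Fin.cons b i)) (Fin.cons a' (Fin.cons b' j)) =
      if i = j then A (a, b) (a', b') else 0 := by
  simp [atSite, Fin.forall_fin_succ, funext_iff, ← Fin.succ_zero_eq_one, -Fin.succ_zero_eq_one']

theorem atSite_last_snoc (A : Mat2 K N) (h : l + 1 < l + 2) (i j : Fin l → Fin N)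
    (a b a' b' : Fin N) :
    atSite A l h (Fin.snoc (Fin.snoc i a) b) (Fin.snoc (Fin.snoc j a') b') =
      if i = j then A (a, b) (a', b') else 0 := by
  have agree : (∀ r : Fin (l + 2), (r : ℕ) ≠ l → (r : ℕ) ≠ l + 1 →
      (Fin.snoc (Fin.snoc i a : Fin (l + 1) → Fin N) b : Fin (l + 2) → Fin N) r =
        (Fin.snoc (Fin.snoc j a' : Fin (l + 1) → Fin N) b' : Fin (l + 2) → Fin N) r) ↔ i = j := by
    simp only [Fin.forall_fin_succ', Fin.snoc_castSucc, funext_iff, Fin.val_castSucc, Fin.val_last]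
    exact ⟨fun h r => h.1.1 r (by omega) (by omega),
      fun h => ⟨⟨fun r _ _ => h r, by omega⟩, by omega⟩⟩
  have hl : (⟨l, Nat.lt_of_succ_lt h⟩ : Fin (l + 2)) = (Fin.last l).castSucc := rfl
  have hl' : (⟨l + 1, h⟩ : Fin (l + 2)) = Fin.last (l + 1) := rfl
  simp only [atSite, Matrix.of_apply, hl, hl', Fin.snoc_castSucc, Fin.snoc_last]
  exact if_congr agree rfl rfl

theorem matrix_ext_cons_cons {M : Type*} {A B : TMat M N (l + 2)}
    (h : ∀ a b i a' b' j, A (Fin.cons a (Fin.cons b i)) (Fin.cons a' (Fin.cons b' j)) =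
      B (Fin.cons a (Fin.cons b i)) (Fin.cons a' (Fin.cons b' j))) : A = B := by
  ext i j
  simpa using h (i 0) (Fin.tail i 0) (Fin.tail (Fin.tail i)) (j 0) (Fin.tail j 0)
    (Fin.tail (Fin.tail j))

theorem sum_tuple_cons_cons {M : Type*} [AddCommMonoid M] (f : (Fin (l + 2) → Fin N) → M) :
    ∑ i, f i = ∑ a : Fin N, ∑ b : Fin N, ∑ i : Fin l → Fin N, f (Fin.cons a (Fin.cons b i)) := by
  simp only [sum_tuple_cons]

theorem atSite_one {m : ℕ} (h : m + 1 < l) : atSite (1 : Mat2 K N) m h = 1 := by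
  induction m generalizing l with
  | zero =>
    obtain ⟨l, rfl⟩ := Nat.exists_eq_add_of_le' h
    refine matrix_ext_cons_cons fun a b i a' b' j => ?_
    simp only [atSite_zero_cons, Matrix.one_apply, Fin.cons_inj, Prod.mk.injEq, ← ite_and, and_comm,
      and_assoc]
  | succ m ih =>
    obtain ⟨l, rfl⟩ := Nat.exists_eq_succ_of_ne_zero (Nat.ne_zero_of_lt h)
    rw [← oneTensorHom_atSite _ (Nat.lt_of_succ_lt_succ h), ih, map_one]

theorem atSite_mul (A B : Mat2 K N) {m : ℕ} (h : m + 1 < l) :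
    atSite (A * B) m h = atSite A m h * atSite B m h := by
  induction m generalizing l with
  | zero =>
    obtain ⟨l, rfl⟩ := Nat.exists_eq_add_of_le' h
    refine matrix_ext_cons_cons fun a b i a' b' j => ?_
    simp [Matrix.mul_apply, sum_tuple_cons_cons, atSite_zero_cons, Fintype.sum_prod_type]
  | succ m ih =>
    obtain ⟨l, rfl⟩ := Nat.exists_eq_succ_of_ne_zero (Nat.ne_zero_of_lt h)
    have h' := Nat.lt_of_succ_lt_succ h
    simp only [← oneTensorHom_atSite _ h', ih, map_mul]

/-- `A ↦ A_{m(m+1)}` as a homomorphism of algebras. -/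
def atSiteHom (K : Type*) [Field K] (N : ℕ) {m : ℕ} (h : m + 1 < l) : Mat2 K N →ₐ[K] TMat K N l :=
  AlgHom.ofLinearMap
    { toFun := fun A => atSite A m h
      map_add' := fun A B => by
        ext i j
        simp only [atSite, Matrix.of_apply, Matrix.add_apply, ite_add_ite, add_zero]
      map_smul' := fun a A => by
        ext i j
        simp only [atSite, Matrix.of_apply, Matrix.smul_apply, smul_ite, smul_zero,
          RingHom.id_apply] }
    (atSite_one h) (fun A B => atSite_mul A B h)

theorem atSiteHom_apply (A : Mat2 K N) {m : ℕ} (h : m + 1 < l) :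
    atSiteHom K N h A = atSite A m h := rfl

theorem atSite_transpose (A : Mat2 K N) {m : ℕ} (h : m + 1 < l) :
    (atSite A m h).transpose = atSite A.transpose m h := by
  ext i j
  simp only [atSite, Matrix.of_apply, Matrix.transpose_apply, eq_comm]

theorem atSite_zero_commute_oneTensor (A : Mat2 K N) (h : 0 + 1 < l + 2) (P : TMat K N l) :
    Commute (atSite A 0 h) (oneTensor (oneTensor P)) := by
  refine matrix_ext_cons_cons fun a b i a' b' j => ?_
  simp [Matrix.mul_apply, sum_tuple_cons_cons, atSite_zero_cons, oneTensor_cons, mul_comm]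

theorem atSite_commute (A B : Mat2 K N) {m m' : ℕ} (h : m + 1 < l) (h' : m' + 1 < l)
    (hm : m + 2 ≤ m') : Commute (atSite A m h) (atSite B m' h') := by
  induction m generalizing l m' with
  | zero =>
    obtain ⟨m', rfl⟩ := Nat.exists_eq_add_of_le' hm
    obtain ⟨l, rfl⟩ := Nat.exists_eq_add_of_le' h
    have h0 : m' + 1 < l := by omega
    simpa only [← oneTensorHom_apply, oneTensorHom_atSite] using
      atSite_zero_commute_oneTensor A h (atSite B m' h0)
  | succ m ih =>
    obtain ⟨m', rfl⟩ := Nat.exists_eq_succ_of_ne_zero (Nat.ne_zero_of_lt (by omega : 0 < m'))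
    obtain ⟨l, rfl⟩ := Nat.exists_eq_succ_of_ne_zero (Nat.ne_zero_of_lt h)
    simpa only [oneTensorHom_atSite] using
      (ih (Nat.lt_of_succ_lt_succ h) (Nat.lt_of_succ_lt_succ h') (by omega)).map
        (oneTensorHom K N l)

end TensorFactors

/-! ### Fusion in Birman–Murakami–Wenzl algebras -/

section Fusion

variable {K : Type*} [Field K] {𝒜 ℬ : Type*} [Ring 𝒜] [Algebra K 𝒜] [Ring ℬ] [Algebra K ℬ]

/-- The relations between the generators `σ` and `e` of the Birman–Murakami–Wenzl algebra with
parameters `k` and `t` on a single site. The field `skein` is `σ - σ⁻¹ = k (1 - e)`, multiplied by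
`σ` to avoid the inverse. -/
structure BMWCrossing (k t : K) (σ e : 𝒜) : Prop where
  skein : σ * σ = 1 + k • σ - (k * t) • e
  twist : σ * e = t • e

/-- The relations between the generators `σ`, `e` and `σ'`, `e'` of the Birman–Murakami–Wenzl
algebra on two neighbouring sites. -/
structure BMWTriple (σ e σ' e' : 𝒜) : Prop where
  braid : σ' * σ * σ' = σ * σ' * σ
  slide_left : σ' * σ * e' = e * e'
  slide_left' : σ * σ' * e = e' * e
  slide_right : e * σ' * σ = e * e'
  slide_right' : e' * σ * σ' = e' * e
  zigzag : e' * e * e' = e'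
  zigzag' : e * e' * e = e

/-- The elements `σ 0, …, σ (n - 1)` and `e 0, …, e (n - 1)` satisfy relations of the
Birman–Murakami–Wenzl algebra on `n + 1` strands with parameters `k` and `t`. -/
structure BMWChain (k t : K) (n : ℕ) (σ e : ℕ → 𝒜) : Prop where
  crossing : ∀ i < n, BMWCrossing k t (σ i) (e i)
  triple : ∀ i, i + 1 < n → BMWTriple (σ i) (e i) (σ (i + 1)) (e (i + 1))
  commute : ∀ i j, i + 2 ≤ j → j < n → Commute (σ i) (σ j)

/-- Coefficients of the factors `α l + β l σ + γ l e` of a fusion recursion. -/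
structure Coeffs (K : Type*) where
  α : ℕ → K
  β : ℕ → K
  γ : ℕ → K

/-- The identities between coefficients and parameters that make the fusion recursion produce the
projector onto the common eigenspace of the `σ i` for the eigenvalue `c`. -/
structure Coeffs.IsFusion (C : Coeffs K) (k t c : K) : Prop where
  k_ne : k ≠ 0
  t_ne : t ≠ 0
  quad : c ^ 2 = 1 + k * c
  α_zero : C.α 0 = 1
  unit : ∀ l, C.α l + c * C.β l = 1
  αβ : ∀ a, c * C.α (a + 1) = C.β (a + 1) * C.α a
  γβ : ∀ a, C.γ a * (C.β (a + 1) + c * C.γ (a + 1)) = c ^ 2 * (C.γ (a + 1) * C.β a)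
  γα : ∀ a, C.γ (a + 1) * C.α a * (t - c) =
    k * t * (C.β (a + 1) * C.α a) + k * c * (C.γ (a + 1) * C.β a)

/-- The factor `α l + β l σ + γ l e` of a fusion recursion. -/
def Coeffs.factor (C : Coeffs K) (l : ℕ) (σ e : 𝒜) : 𝒜 :=
  C.α l • (1 : 𝒜) + C.β l • σ + C.γ l • e

/-- The elements defined by the fusion recursion; `chainProj C σ e j` lives on `j + 1` strands. -/
def chainProj (C : Coeffs K) (σ e : ℕ → 𝒜) : ℕ → 𝒜
  | 0 => 1
  | j + 1 => chainProj C σ e j * C.factor (j + 1) (σ j) (e j) * chainProj C σ e j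

variable {k t c : K} {n : ℕ} {C : Coeffs K}

namespace BMWCrossing

variable {s e s' e' y : 𝒜}

theorem map (f : 𝒜 →ₐ[K] ℬ) (h : BMWCrossing k t s e) : BMWCrossing k t (f s) (f e) where
  skein := by rw [← map_mul, h.skein, map_sub, map_add, map_one, map_smul, map_smul]
  twist := by rw [← map_mul, h.twist, map_smul]

theorem eq_smul (h : BMWCrossing k t s e) (hkt : k * t ≠ 0) :
    e = (k * t)⁻¹ • (1 + k • s - s * s) := by
  rw [h.skein, sub_sub_cancel, inv_smul_smul₀ hkt]

theorem semiconjBy (h : BMWCrossing k t s e) (h' : BMWCrossing k t s' e') (hkt : k * t ≠ 0)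
    (hy : SemiconjBy y s s') : SemiconjBy y e e' := by
  rw [h.eq_smul hkt, h'.eq_smul hkt]
  have hsmul : SemiconjBy y (k • s) (k • s') := by
    rw [SemiconjBy, mul_smul_comm, smul_mul_assoc, hy.eq]
  rw [SemiconjBy, mul_smul_comm, smul_mul_assoc,
    (((SemiconjBy.one_right y).add_right hsmul).sub_right (hy.mul_right hy)).eq]

theorem commute (h : BMWCrossing k t s e) (hkt : k * t ≠ 0) (hy : Commute y s) : Commute y e :=
  h.semiconjBy h hkt hy

theorem twist_right (h : BMWCrossing k t s e) (hkt : k * t ≠ 0) : e * s = t • e := by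
  rw [← (h.commute hkt (Commute.refl s)).eq, h.twist]

theorem mul_eq_zero (h : BMWCrossing k t s e) (hkt : k * t ≠ 0) (hc : c ^ 2 = 1 + k * c)
    (hs : s * y = c • y) : e * y = 0 := by
  have hss : s * s * y = c ^ 2 • y := by rw [mul_assoc, hs, mul_smul_comm, hs, smul_smul, sq]
  rw [h.eq_smul hkt, smul_mul_assoc, sub_mul, add_mul, one_mul, smul_mul_assoc, hs, hss, hc,
    smul_smul, add_smul, one_smul, sub_self, smul_zero]

theorem op (h : BMWCrossing k t s e) (hkt : k * t ≠ 0) :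
    BMWCrossing k t (MulOpposite.op s) (MulOpposite.op e) where
  skein := by
    simp only [← MulOpposite.op_mul, h.skein, MulOpposite.op_sub, MulOpposite.op_add,
      MulOpposite.op_smul, MulOpposite.op_one]
  twist := by rw [← MulOpposite.op_mul, h.twist_right hkt, MulOpposite.op_smul]

end BMWCrossing

namespace BMWTriple

variable {σ e σ' e' x : 𝒜}

omit [Algebra K 𝒜] [Algebra K ℬ] in
theorem map (f : 𝒜 →+* ℬ) (h : BMWTriple σ e σ' e') :
    BMWTriple (f σ) (f e) (f σ') (f e') := by
  constructor <;> simp only [← map_mul]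
  exacts [congrArg f h.braid, congrArg f h.slide_left, congrArg f h.slide_left',
    congrArg f h.slide_right, congrArg f h.slide_right', congrArg f h.zigzag, congrArg f h.zigzag']

theorem symm (h : BMWTriple σ e σ' e') : BMWTriple σ' e' σ e :=
  ⟨h.braid.symm, h.slide_left', h.slide_left, h.slide_right', h.slide_right, h.zigzag', h.zigzag⟩

theorem op (h : BMWTriple σ e σ' e') : BMWTriple (MulOpposite.op σ) (MulOpposite.op e)
    (MulOpposite.op σ') (MulOpposite.op e') := by
  constructor <;> simp only [← MulOpposite.op_mul, ← mul_assoc]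
  exacts [congrArg _ h.braid, congrArg _ h.slide_right', congrArg _ h.slide_right,
    congrArg _ h.slide_left', congrArg _ h.slide_left, congrArg _ h.zigzag, congrArg _ h.zigzag']

theorem e_mul_σ'_mul (h : BMWTriple σ e σ' e') (hc : c ≠ 0) (hx : σ * x = c • x) :
    e * (σ' * x) = c⁻¹ • (e * (e' * x)) := by
  rw [eq_inv_smul_iff₀ hc, ← mul_assoc e e', ← h.slide_right, mul_assoc, hx, mul_smul_comm,
    mul_assoc]

theorem smul_e'_mul_σ_mul_e' (h : BMWTriple σ e σ' e') (h' : BMWCrossing k t σ' e')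
    (hkt : k * t ≠ 0) : t • (e' * (σ * e')) = e' := by
  rw [← smul_mul_assoc, ← h'.twist_right hkt, mul_assoc, ← mul_assoc σ', h.slide_left,
    ← mul_assoc, h.zigzag]

theorem σ'_mul_e_mul_e' (h : BMWTriple σ e σ' e') (h' : BMWCrossing k t σ' e')
    (hkt : k * t ≠ 0) : σ' * (e * e') = σ * e' + k • (e * e') - k • e' := by
  rw [← h.slide_left, mul_assoc, ← mul_assoc σ' σ', h'.skein, sub_mul, add_mul, one_mul,
    smul_mul_assoc, smul_mul_assoc, mul_smul, h.smul_e'_mul_σ_mul_e' h' hkt]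

end BMWTriple

namespace Coeffs

theorem factor_map (f : 𝒜 →ₐ[K] ℬ) (C : Coeffs K) (l : ℕ) (σ e : 𝒜) :
    f (C.factor l σ e) = C.factor l (f σ) (f e) := by
  simp only [factor, map_add, map_smul, map_one]

theorem factor_semiconjBy (C : Coeffs K) (l : ℕ) {σ e σ' e' y : 𝒜} (hσ : SemiconjBy y σ σ')
    (he : SemiconjBy y e e') : SemiconjBy y (C.factor l σ e) (C.factor l σ' e') := by
  simp only [SemiconjBy, factor, mul_add, add_mul, mul_smul_comm, smul_mul_assoc, mul_one,
    one_mul, hσ.eq, he.eq]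

namespace IsFusion

theorem c_ne (hC : C.IsFusion k t c) : c ≠ 0 := by
  rintro rfl
  simpa using hC.quad

theorem kt_ne (hC : C.IsFusion k t c) : k * t ≠ 0 := mul_ne_zero hC.k_ne hC.t_ne

theorem k_eq (hC : C.IsFusion k t c) : k = c - c⁻¹ := by
  have := hC.c_ne
  field_simp
  linear_combination -hC.quad

theorem β_zero (hC : C.IsFusion k t c) : C.β 0 = 0 := by
  have h := hC.unit 0
  rw [hC.α_zero, add_eq_left] at h
  exact (mul_eq_zero.mp h).resolve_left hC.c_ne

theorem α_succ (hC : C.IsFusion k t c) (a : ℕ) :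
    C.α (a + 1) = c⁻¹ * (C.β (a + 1) * C.α a) := by
  rw [← hC.αβ, inv_mul_cancel_left₀ hC.c_ne]

theorem γ_mul (hC : C.IsFusion k t c) (a : ℕ) :
    C.γ a * (c⁻¹ * C.β (a + 1) + C.γ (a + 1)) = c * (C.γ (a + 1) * C.β a) := by
  have := hC.c_ne
  field_simp
  linear_combination hC.γβ a

theorem factor_mul (hC : C.IsFusion k t c) (l : ℕ) {σ e y : 𝒜} (h : BMWCrossing k t σ e)
    (hy : σ * y = c • y) : C.factor l σ e * y = y := by
  rw [factor, add_mul, add_mul, smul_mul_assoc, smul_mul_assoc, smul_mul_assoc, hy,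
    h.mul_eq_zero hC.kt_ne hC.quad hy, one_mul, smul_zero, add_zero, smul_smul, ← add_smul,
    mul_comm, hC.unit, one_smul]

theorem mul_factor_one (hC : C.IsFusion k t c) {σ e : 𝒜} (h : BMWCrossing k t σ e) :
    σ * C.factor 1 σ e = c • C.factor 1 σ e := by
  have hα := hC.α_succ 0
  have hγ := hC.γα 0
  rw [hC.α_zero, zero_add] at hα hγ
  rw [hC.β_zero] at hγ
  simp only [factor, mul_add, mul_one, mul_smul_comm, smul_add, h.skein, h.twist, smul_sub,
    smul_smul]
  match_scalars
  · linear_combination hα + C.β 1 * hC.k_eq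
  · linear_combination -c * hα - C.β 1 * mul_inv_cancel₀ hC.c_ne
  · linear_combination hγ

theorem mul_factor_mul_factor (hC : C.IsFusion k t c) {σ e σ' e' x : 𝒜} (h : BMWTriple σ e σ' e')
    (hσ : BMWCrossing k t σ e) (hσ' : BMWCrossing k t σ' e') (a : ℕ) (hx : σ * x = c • x) :
    σ' * (C.factor a σ e * (C.factor (a + 1) σ' e' * x)) =
      c • (C.factor a σ e * (C.factor (a + 1) σ' e' * x)) := by
  have skein : σ' * (σ' * x) = x + k • (σ' * x) - (k * t) • (e' * x) := by
    rw [← mul_assoc, hσ'.skein, sub_mul, add_mul, one_mul, smul_mul_assoc, smul_mul_assoc]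
  have twist : σ' * (e' * x) = t • (e' * x) := by rw [← mul_assoc, hσ'.twist, smul_mul_assoc]
  have braid : σ' * (σ * (σ' * x)) = c • (σ * (σ' * x)) := by
    rw [← mul_assoc, ← mul_assoc, h.braid, mul_assoc, hx, mul_smul_comm, mul_assoc]
  have slide : σ' * (σ * (e' * x)) = e * (e' * x) := by
    rw [← mul_assoc, ← mul_assoc, h.slide_left, mul_assoc]
  have slide_twice : σ' * (e * (e' * x)) = σ * (e' * x) + k • (e * (e' * x)) - k • (e' * x) := by
    simpa only [sub_mul, add_mul, smul_mul_assoc, mul_assoc] using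
      congrArg (· * x) (h.σ'_mul_e_mul_e' hσ' hC.kt_ne)
  simp only [factor, add_mul, mul_add, smul_mul_assoc, mul_smul_comm, one_mul, hx,
    hσ.mul_eq_zero hC.kt_ne hC.quad hx, h.e_mul_σ'_mul hC.c_ne hx, skein, twist, braid, slide,
    slide_twice, mul_zero, smul_zero, smul_add, smul_sub, smul_smul]
  match_scalars
  · linear_combination C.α (a + 1) * hC.unit a + hC.α_succ a + C.β (a + 1) * C.α a * hC.k_eq
  · linear_combination -(c * C.α (a + 1)) * hC.unit a - hC.αβ a
  · linear_combination hC.γα a - k * hC.γ_mul a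
  · ring
  · linear_combination hC.γ_mul a
  · linear_combination (k - c) * hC.γ_mul a - C.γ (a + 1) * C.β a * hC.quad

end IsFusion

end Coeffs

theorem chainProj_map (f : 𝒜 →ₐ[K] ℬ) (C : Coeffs K) {σ e : ℕ → 𝒜} {σ' e' : ℕ → ℬ} (j : ℕ)
    (hσ : ∀ i < j, f (σ i) = σ' i) (he : ∀ i < j, f (e i) = e' i) :
    f (chainProj C σ e j) = chainProj C σ' e' j := by
  induction j with
  | zero => exact map_one f
  | succ j ih =>
    rw [chainProj, chainProj, map_mul, map_mul, C.factor_map, hσ j (by omega), he j (by omega),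
      ih (fun i hi => hσ i (by omega)) (fun i hi => he i (by omega))]

variable {σ e σ' e' : ℕ → 𝒜}

theorem chainProj_op (C : Coeffs K) (σ e : ℕ → 𝒜) (j : ℕ) :
    chainProj C (fun i => MulOpposite.op (σ i)) (fun i => MulOpposite.op (e i)) j =
      MulOpposite.op (chainProj C σ e j) := by
  induction j with
  | zero => rfl
  | succ j ih =>
    simp only [chainProj, ih, Coeffs.factor, MulOpposite.op_mul, MulOpposite.op_add,
      MulOpposite.op_smul, MulOpposite.op_one, mul_assoc]

theorem chainProj_semiconjBy (C : Coeffs K) {y : 𝒜} (j : ℕ)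
    (hσ : ∀ i < j, SemiconjBy y (σ i) (σ' i)) (he : ∀ i < j, SemiconjBy y (e i) (e' i)) :
    SemiconjBy y (chainProj C σ e j) (chainProj C σ' e' j) := by
  induction j with
  | zero => exact SemiconjBy.one_right y
  | succ j ih =>
    have h := ih (fun i hi => hσ i (by omega)) (fun i hi => he i (by omega))
    exact (h.mul_right (C.factor_semiconjBy _ (hσ j (by omega)) (he j (by omega)))).mul_right h

namespace BMWChain

theorem op (h : BMWChain k t n σ e) (hkt : k * t ≠ 0) :
    BMWChain k t n (fun i => MulOpposite.op (σ i)) (fun i => MulOpposite.op (e i)) where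
  crossing i hi := (h.crossing i hi).op hkt
  triple i hi := (h.triple i hi).op
  commute i j hij hj := (h.commute i j hij hj).op

theorem reverse (h : BMWChain k t n σ e) :
    BMWChain k t n (fun i => σ (n - 1 - i)) (fun i => e (n - 1 - i)) where
  crossing i hi := h.crossing _ (by omega)
  triple i hi := by
    rw [show n - 1 - i = n - 1 - (i + 1) + 1 by omega]
    exact (h.triple _ (by omega)).symm
  commute i j hij hj := (h.commute _ _ (by omega) (by omega)).symm

theorem chainProj_mem (h : BMWChain k t n σ e) (hkt : k * t ≠ 0) (C : Coeffs K)
    (S : Subalgebra K 𝒜) (hσ : ∀ i < n, σ i ∈ S) {j : ℕ} (hj : j ≤ n) :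
    chainProj C σ e j ∈ S := by
  induction j with
  | zero => exact S.one_mem
  | succ j ih =>
    have hσj := hσ j (by omega)
    have hej : e j ∈ S := by
      rw [(h.crossing j (by omega)).eq_smul hkt]
      exact S.smul_mem (S.sub_mem (S.add_mem S.one_mem (S.smul_mem hσj _)) (S.mul_mem hσj hσj)) _
    have hP := ih (by omega)
    exact S.mul_mem (S.mul_mem hP (S.add_mem (S.add_mem (S.smul_mem S.one_mem _)
      (S.smul_mem hσj _)) (S.smul_mem hej _))) hP

theorem chainProj_mul (h : BMWChain k t n σ e) (hC : C.IsFusion k t c) {y : 𝒜} {j : ℕ}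
    (hj : j ≤ n) (hy : ∀ i < j, σ i * y = c • y) : chainProj C σ e j * y = y := by
  induction j with
  | zero => exact one_mul y
  | succ j ih =>
    have hP := ih (by omega) fun i hi => hy i (by omega)
    rw [chainProj, mul_assoc, hP, mul_assoc,
      hC.factor_mul _ (h.crossing j (by omega)) (hy j (by omega)), hP]

theorem chainProj_commute (h : BMWChain k t n σ e) (hkt : k * t ≠ 0) (C : Coeffs K) {i j : ℕ}
    (hij : i + 1 ≤ j) (hj : j < n) : Commute (σ j) (chainProj C σ e i) := by
  have hσ : ∀ m < i, Commute (σ j) (σ m) := fun m hm => (h.commute m j (by omega) hj).symm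
  exact chainProj_semiconjBy C i hσ fun m hm =>
    (h.crossing m (by omega)).commute hkt (hσ m hm)

theorem chainProj_succ_succ (h : BMWChain k t n σ e) (hC : C.IsFusion k t c) {j : ℕ}
    (hj : j + 2 ≤ n)
    (eigen : ∀ i < j, σ i * chainProj C σ e (j + 1) = c • chainProj C σ e (j + 1)) :
    chainProj C σ e (j + 2) = chainProj C σ e j * (C.factor (j + 1) (σ j) (e j) *
      (C.factor (j + 2) (σ (j + 1)) (e (j + 1)) * chainProj C σ e (j + 1))) := by
  have hσ := (h.chainProj_commute hC.kt_ne C le_rfl (by omega : j + 1 < n)).symm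
  have hcomm : Commute (chainProj C σ e j) (C.factor (j + 2) (σ (j + 1)) (e (j + 1))) :=
    C.factor_semiconjBy _ hσ ((h.crossing _ (by omega)).commute hC.kt_ne hσ)
  have habs : chainProj C σ e j * chainProj C σ e (j + 1) = chainProj C σ e (j + 1) :=
    h.chainProj_mul hC (by omega) eigen
  calc chainProj C σ e (j + 2)
      = chainProj C σ e j * (C.factor (j + 1) (σ j) (e j) * (chainProj C σ e j *
          C.factor (j + 2) (σ (j + 1)) (e (j + 1)) * chainProj C σ e (j + 1))) := by
        rw [chainProj.eq_2 C σ e (j + 1)]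
        nth_rw 1 [chainProj]
        simp only [mul_assoc]
    _ = _ := by rw [hcomm.eq, mul_assoc _ _ (chainProj C σ e (j + 1)), habs]

theorem mul_chainProj_succ (h : BMWChain k t n σ e) (hC : C.IsFusion k t c) {j : ℕ} (hj : j < n)
    (eigen : ∀ i < j, σ i * chainProj C σ e j = c • chainProj C σ e j) :
    σ j * chainProj C σ e (j + 1) = c • chainProj C σ e (j + 1) := by
  cases j with
  | zero => simpa only [chainProj, one_mul, mul_one] using hC.mul_factor_one (h.crossing 0 hj)
  | succ j =>
    rw [h.chainProj_succ_succ hC hj fun i hi => eigen i (by omega), ← mul_assoc,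
      (h.chainProj_commute hC.kt_ne C le_rfl hj).eq, mul_assoc,
      hC.mul_factor_mul_factor (h.triple j hj) (h.crossing j (by omega)) (h.crossing (j + 1) hj)
        (j + 1) (eigen j (by omega)), mul_smul_comm]

theorem mul_chainProj (h : BMWChain k t n σ e) (hC : C.IsFusion k t c) {i j : ℕ} (hj : j ≤ n)
    (hi : i < j) : σ i * chainProj C σ e j = c • chainProj C σ e j := by
  induction j generalizing i with
  | zero => omega
  | succ j ih =>
    rcases Nat.lt_succ_iff_lt_or_eq.mp hi with hi | rfl
    · simp only [chainProj, ← mul_assoc, ih (by omega) hi, smul_mul_assoc]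
    · exact h.mul_chainProj_succ hC hj fun m hm => ih (by omega) hm

theorem chainProj_mul_self (h : BMWChain k t n σ e) (hC : C.IsFusion k t c) {j : ℕ}
    (hj : j ≤ n) : chainProj C σ e j * chainProj C σ e j = chainProj C σ e j :=
  h.chainProj_mul hC hj fun _ hi => h.mul_chainProj hC hj hi

theorem chainProj_mul_σ (h : BMWChain k t n σ e) (hC : C.IsFusion k t c) {i j : ℕ} (hj : j ≤ n)
    (hi : i < j) : chainProj C σ e j * σ i = c • chainProj C σ e j := by
  apply MulOpposite.op_injective
  simpa only [chainProj_op, ← MulOpposite.op_mul, ← MulOpposite.op_smul] using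
    (h.op hC.kt_ne).mul_chainProj hC hj hi

theorem mul_chainProj_of_mul (h : BMWChain k t n σ e) (hC : C.IsFusion k t c) {y : 𝒜} {j : ℕ}
    (hj : j ≤ n) (hy : ∀ i < j, y * σ i = c • y) : y * chainProj C σ e j = y := by
  apply MulOpposite.op_injective
  simpa only [chainProj_op, ← MulOpposite.op_mul] using (h.op hC.kt_ne).chainProj_mul hC hj
    (y := MulOpposite.op y) fun i hi => congrArg MulOpposite.op (hy i hi)

theorem chainProj_reverse (h : BMWChain k t n σ e) (hC : C.IsFusion k t c) :
    chainProj C (fun i => σ (n - 1 - i)) (fun i => e (n - 1 - i)) n = chainProj C σ e n := by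
  set P := chainProj C σ e n
  set P' := chainProj C (fun i => σ (n - 1 - i)) (fun i => e (n - 1 - i)) n
  have left : P' * P = P :=
    h.reverse.chainProj_mul hC le_rfl fun i hi => h.mul_chainProj hC le_rfl (by omega)
  have right : P' * P = P' :=
    h.mul_chainProj_of_mul hC le_rfl fun i hi => by
      simpa only [show n - 1 - (n - 1 - i) = i by omega] using
        h.reverse.chainProj_mul_σ hC le_rfl (by omega : n - 1 - i < n)
  rw [← right, left]

end BMWChain

end Fusion

/-! ### Representations on tensor powers -/

section TensorPowers

variable {K : Type*} [Field K] {N l : ℕ}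

/-- The matrices `R` and `E` of 2-tensors generate representations of the Birman–Murakami–Wenzl
algebras with parameters `k` and `t` on tensor powers. -/
structure BMWPair (k t : K) (R E : Mat2 K N) : Prop where
  crossing : BMWCrossing k t R E
  symm : R.transpose = R
  triple : BMWTriple (atSite R 0 (by omega : 0 + 1 < 3)) (atSite E 0 (by omega : 0 + 1 < 3))
    (atSite R 1 (by omega : 1 + 1 < 3)) (atSite E 1 (by omega : 1 + 1 < 3))

/-- `A_{m(m+1)}` as a function of the natural number `m`, zero if there is no such site. -/
def site (l : ℕ) (A : Mat2 K N) (m : ℕ) : TMat K N l := if h : m + 1 < l then atSite A m h else 0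

theorem site_eq (A : Mat2 K N) {m : ℕ} (h : m + 1 < l) : site l A m = atSite A m h :=
  dif_pos h

theorem tensorOneHom_site (A : Mat2 K N) {m : ℕ} (h : m + 1 < l) :
    tensorOneHom K N l (site l A m) = site (l + 1) A m := by
  rw [site_eq A h, site_eq A (Nat.lt_succ_of_lt h), tensorOneHom_atSite]

theorem oneTensorHom_site (A : Mat2 K N) {m : ℕ} (h : m + 1 < l) :
    oneTensorHom K N l (site l A m) = site (l + 1) A (m + 1) := by
  rw [site_eq A h, site_eq A (Nat.succ_lt_succ h), oneTensorHom_atSite]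

theorem factor_site (C : Coeffs K) (j : ℕ) (R E : Mat2 K N) {m : ℕ} (h : m + 1 < l) :
    C.factor j (site l R m) (site l E m) = atSite (C.factor j R E) m h := by
  rw [site_eq R h, site_eq E h]
  exact (C.factor_map (atSiteHom K N h) j R E).symm

/-- The matrix of `l`-tensors defined by the fusion recursion. -/
def tensorProj (C : Coeffs K) (R E : Mat2 K N) (l : ℕ) : TMat K N l :=
  chainProj C (site l R) (site l E) (l - 1)

theorem tensorProj_one (C : Coeffs K) (R E : Mat2 K N) : tensorProj C R E 1 = 1 := rfl

theorem tensorProj_succ (C : Coeffs K) (R E : Mat2 K N) (l : ℕ) :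
    tensorProj C R E (l + 2) = tensorOne (tensorProj C R E (l + 1)) *
      atSite (C.factor (l + 1) R E) l (Nat.lt_succ_self _) *
        tensorOne (tensorProj C R E (l + 1)) := by
  have hP : tensorOneHom K N (l + 1) (tensorProj C R E (l + 1)) =
      chainProj C (site (l + 2) R) (site (l + 2) E) l :=
    chainProj_map _ C l (fun i hi => tensorOneHom_site _ (by omega))
      (fun i hi => tensorOneHom_site _ (by omega))
  rw [← tensorOneHom_apply, hP, ← factor_site]
  rfl

namespace BMWPair

variable {k t c : K} {R E : Mat2 K N} {C : Coeffs K}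

theorem triple_atSite (h : BMWPair k t R E) {m : ℕ} (hm : m + 2 < l) :
    BMWTriple (atSite R m (by omega : m + 1 < l)) (atSite E m (by omega : m + 1 < l))
      (atSite R (m + 1) hm) (atSite E (m + 1) hm) := by
  induction m generalizing l with
  | zero =>
    induction l, (show 3 ≤ l from hm) using Nat.le_induction with
    | base => exact h.triple
    | succ l hl ih =>
      simpa only [RingHom.coe_coe, tensorOneHom_atSite] using
        (ih hl).map (tensorOneHom K N l : TMat K N l →+* TMat K N (l + 1))
  | succ m ih =>
    obtain ⟨l, rfl⟩ := Nat.exists_eq_succ_of_ne_zero (Nat.ne_zero_of_lt hm)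
    simpa only [RingHom.coe_coe, oneTensorHom_atSite] using
      (ih (Nat.lt_of_succ_lt_succ hm)).map (oneTensorHom K N l : TMat K N l →+* TMat K N (l + 1))

theorem chain (h : BMWPair k t R E) (l : ℕ) :
    BMWChain k t (l - 1) (site l R) (site l E) where
  crossing i hi := by
    have hi' : i + 1 < l := by omega
    rw [site_eq R hi', site_eq E hi']
    exact h.crossing.map (atSiteHom K N hi')
  triple i hi := by
    have hi' : i + 2 < l := by omega
    rw [site_eq R (by omega : i + 1 < l), site_eq E (by omega : i + 1 < l), site_eq R hi',
      site_eq E hi']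
    exact h.triple_atSite hi'
  commute i j hij hj := by
    rw [site_eq R (by omega : i + 1 < l), site_eq R (by omega : j + 1 < l)]
    exact atSite_commute R R _ _ hij

theorem R_mul_tensorProj (h : BMWPair k t R E) (hC : C.IsFusion k t c) {m : ℕ} (hm : m + 1 < l) :
    atSite R m hm * tensorProj C R E l = c • tensorProj C R E l := by
  rw [← site_eq R hm]
  exact (h.chain l).mul_chainProj hC le_rfl (by omega)

theorem tensorProj_mul_R (h : BMWPair k t R E) (hC : C.IsFusion k t c) {m : ℕ} (hm : m + 1 < l) :
    tensorProj C R E l * atSite R m hm = c • tensorProj C R E l := by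
  rw [← site_eq R hm]
  exact (h.chain l).chainProj_mul_σ hC le_rfl (by omega)

theorem isIdempotentElem_tensorProj (h : BMWPair k t R E) (hC : C.IsFusion k t c) (l : ℕ) :
    IsIdempotentElem (tensorProj C R E l) :=
  (h.chain l).chainProj_mul_self hC le_rfl

theorem tensorProj_mul (h : BMWPair k t R E) (hC : C.IsFusion k t c) {Y : TMat K N l}
    (hY : ∀ m (hm : m + 1 < l), atSite R m hm * Y = c • Y) : tensorProj C R E l * Y = Y :=
  (h.chain l).chainProj_mul hC le_rfl fun i hi => by
    rw [site_eq R (by omega : i + 1 < l), hY]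

theorem mul_tensorProj (h : BMWPair k t R E) (hC : C.IsFusion k t c) {Y : TMat K N l}
    (hY : ∀ m (hm : m + 1 < l), Y * atSite R m hm = c • Y) : Y * tensorProj C R E l = Y :=
  (h.chain l).mul_chainProj_of_mul hC le_rfl fun i hi => by
    rw [site_eq R (by omega : i + 1 < l), hY]

theorem tensorProj_mem (h : BMWPair k t R E) (hkt : k * t ≠ 0) (C : Coeffs K) (l : ℕ) :
    tensorProj C R E l ∈ braidPolynomials R l :=
  (h.chain l).chainProj_mem hkt C _ (fun i hi => by
    rw [site_eq R (by omega : i + 1 < l)]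
    exact Algebra.subset_adjoin ⟨i, _, rfl⟩) le_rfl

theorem symm_E (h : BMWPair k t R E) (hkt : k * t ≠ 0) : E.transpose = E := by
  rw [h.crossing.eq_smul hkt]
  simp only [Matrix.transpose_smul, Matrix.transpose_sub, Matrix.transpose_add,
    Matrix.transpose_one, Matrix.transpose_mul, h.symm]

theorem transpose_tensorProj (h : BMWPair k t R E) (hkt : k * t ≠ 0) (C : Coeffs K) (l : ℕ) :
    (tensorProj C R E l).transpose = tensorProj C R E l := by
  have hsite : ∀ A : Mat2 K N, A.transpose = A → ∀ i < l - 1,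
      Matrix.transposeAlgEquiv (Fin l → Fin N) K K (site l A i) = MulOpposite.op (site l A i) := by
    intro A hA i hi
    rw [site_eq A (by omega : i + 1 < l), Matrix.transposeAlgEquiv_apply, atSite_transpose, hA]
  apply MulOpposite.op_injective
  rw [tensorProj, ← chainProj_op]
  exact chainProj_map (Matrix.transposeAlgEquiv (Fin l → Fin N) K K).toAlgHom C (l - 1)
    (hsite R h.symm) (hsite E (h.symm_E hkt))

theorem tensorProj_eq_reverse (h : BMWPair k t R E) (hC : C.IsFusion k t c) (l : ℕ) :
    tensorProj C R E l =
      chainProj C (fun i => site l R (l - 1 - 1 - i)) (fun i => site l E (l - 1 - 1 - i)) (l - 1) :=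
  ((h.chain l).chainProj_reverse hC).symm

theorem tensorProj_succ' (h : BMWPair k t R E) (hC : C.IsFusion k t c) (l : ℕ) :
    tensorProj C R E (l + 2) = oneTensor (tensorProj C R E (l + 1)) *
      atSite (C.factor (l + 1) R E) 0 (by omega) * oneTensor (tensorProj C R E (l + 1)) := by
  have hsite : ∀ A : Mat2 K N, ∀ i < l,
      oneTensorHom K N (l + 1) (site (l + 1) A (l + 1 - 1 - 1 - i)) =
        site (l + 2) A (l + 2 - 1 - 1 - i) := fun A i hi => by
    rw [oneTensorHom_site _ (by omega), show l + 1 - 1 - 1 - i + 1 = l + 2 - 1 - 1 - i by omega]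
  have hP : oneTensorHom K N (l + 1) (tensorProj C R E (l + 1)) =
      chainProj C (fun i => site (l + 2) R (l + 2 - 1 - 1 - i))
        (fun i => site (l + 2) E (l + 2 - 1 - 1 - i)) l := by
    rw [h.tensorProj_eq_reverse hC]
    exact chainProj_map _ C l (hsite R) (hsite E)
  rw [h.tensorProj_eq_reverse hC (l + 2), ← oneTensorHom_apply, hP, ← factor_site]
  change chainProj C _ _ (l + 1) = _
  rw [chainProj]
  simp only [show l + 2 - 1 - 1 - l = 0 by omega]

end BMWPair

end TensorPowers

/-! ### Compatibility with metrics -/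

section Metric

variable {K : Type*} [Field K] {N l : ℕ}

/-- `g ⊗ ⋯ ⊗ g`. -/
def metricPower (g : Matrix (Fin N) (Fin N) K) (l : ℕ) : TMat K N l :=
  Matrix.of fun i j => ∏ r, g (i r) (j r)

/-- Reversal of the order of the tensor factors. -/
def reverse (K : Type*) [Field K] (N l : ℕ) : TMat K N l ≃ₐ[K] TMat K N l :=
  Matrix.reindexAlgEquiv K K (Equiv.arrowCongr Fin.revPerm (Equiv.refl (Fin N)))

/-- Interchange of the two factors of 2-tensors. -/
def flip (K : Type*) [Field K] (N : ℕ) : Mat2 K N ≃ₐ[K] Mat2 K N :=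
  Matrix.reindexAlgEquiv K K (Equiv.prodComm (Fin N) (Fin N))

theorem reverse_atSite (A : Mat2 K N) {m m' : ℕ} (hm : m + m' + 2 = l) :
    reverse K N l (atSite A m (by omega)) = atSite (flip K N A) m' (by omega) := by
  ext i j
  have rev_fst : Fin.rev (⟨m, by omega⟩ : Fin l) = ⟨m' + 1, by omega⟩ := by
    ext; simp only [Fin.val_rev]; omega
  have rev_snd : Fin.rev (⟨m + 1, by omega⟩ : Fin l) = ⟨m', by omega⟩ := by
    ext; simp only [Fin.val_rev]; omega
  have agree : (∀ r : Fin l, (r : ℕ) ≠ m → (r : ℕ) ≠ m + 1 → i r.rev = j r.rev) ↔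
      ∀ r : Fin l, (r : ℕ) ≠ m' → (r : ℕ) ≠ m' + 1 → i r = j r :=
    ⟨fun H r h₁ h₂ => by
      simpa only [Fin.rev_rev] using
        H r.rev (by rw [Fin.val_rev]; omega) (by rw [Fin.val_rev]; omega),
    fun H r h₁ h₂ => H r.rev (by rw [Fin.val_rev]; omega) (by rw [Fin.val_rev]; omega)⟩
  change (if _ then A (i (Fin.rev _), i (Fin.rev _)) (j (Fin.rev _), j (Fin.rev _)) else 0) = _
  rw [rev_fst, rev_snd]
  exact if_congr agree rfl rfl

theorem metricPower_cons (g : Matrix (Fin N) (Fin N) K) (a b : Fin N) (i j : Fin l → Fin N) :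
    metricPower g (l + 1) (Fin.cons a i) (Fin.cons b j) = g a b * metricPower g l i j := by
  simp [metricPower, Fin.prod_univ_succ]

theorem semiconjBy_oneTensor (g : Matrix (Fin N) (Fin N) K) {A B : TMat K N l}
    (h : SemiconjBy (metricPower g l) B A) :
    SemiconjBy (metricPower g (l + 1)) (oneTensor B) (oneTensor A) := by
  refine matrix_ext_cons fun a i b j => ?_
  have entry := congrFun₂ h.eq i j
  simp only [Matrix.mul_apply] at entry
  simp [Matrix.mul_apply, sum_tuple_cons, oneTensor_cons, metricPower_cons, mul_assoc,
    mul_left_comm, ← Finset.mul_sum, entry]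

theorem semiconjBy_atSite (g : Matrix (Fin N) (Fin N) K) {A B : Mat2 K N}
    (h : SemiconjBy (g ⊗ₖ g) B A) {m : ℕ} (hm : m + 1 < l) :
    SemiconjBy (metricPower g l) (atSite B m hm) (atSite A m hm) := by
  induction m generalizing l with
  | zero =>
    obtain ⟨l, rfl⟩ := Nat.exists_eq_add_of_le' hm
    refine matrix_ext_cons_cons fun a b i a' b' j => ?_
    have entry := congrFun₂ h.eq (a, b) (a', b')
    simp only [Matrix.mul_apply, Fintype.sum_prod_type, Matrix.kroneckerMap_apply] at entry
    simpa [Matrix.mul_apply, sum_tuple_cons_cons, atSite_zero_cons, metricPower_cons,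
      ← mul_assoc, mul_right_comm _ (metricPower g l i j), ← Finset.sum_mul] using
      congrArg (· * metricPower g l i j) entry
  | succ m ih =>
    obtain ⟨l, rfl⟩ := Nat.exists_eq_succ_of_ne_zero (Nat.ne_zero_of_lt hm)
    simpa only [← oneTensorHom_apply, oneTensorHom_atSite] using
      semiconjBy_oneTensor g (ih (Nat.lt_of_succ_lt_succ hm))

theorem metricCompatible_iff (g : Matrix (Fin N) (Fin N) K) {P : TMat K N l} :
    MetricCompatible g P ↔ SemiconjBy (metricPower g l) (reverse K N l P) P := by
  rw [SemiconjBy, eq_comm, ← Matrix.ext_iff]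
  rfl

theorem BMWPair.tensorProj_metricCompatible {k t c : K} {R E : Mat2 K N} {C : Coeffs K}
    (h : BMWPair k t R E) (hC : C.IsFusion k t c) {g : Matrix (Fin N) (Fin N) K}
    (hR : SemiconjBy (g ⊗ₖ g) (flip K N R) R) (l : ℕ) :
    MetricCompatible g (tensorProj C R E l) := by
  have hE : SemiconjBy (g ⊗ₖ g) (flip K N E) E :=
    (h.crossing.map (flip K N).toAlgHom).semiconjBy h.crossing hC.kt_ne hR
  have hsite : ∀ A : Mat2 K N, SemiconjBy (g ⊗ₖ g) (flip K N A) A → ∀ i < l - 1,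
      SemiconjBy (metricPower g l) (reverse K N l (site l A (l - 1 - 1 - i))) (site l A i) := by
    intro A hA i hi
    rw [site_eq A (by omega : i + 1 < l), site_eq A (by omega : l - 1 - 1 - i + 1 < l),
      reverse_atSite A (by omega : l - 1 - 1 - i + i + 2 = l)]
    exact semiconjBy_atSite g hA _
  rw [metricCompatible_iff]
  nth_rw 1 [h.tensorProj_eq_reverse hC]
  have hrev := chainProj_map (reverse K N l).toAlgHom C (σ := fun i => site l R (l - 1 - 1 - i))
    (e := fun i => site l E (l - 1 - 1 - i)) (l - 1) (fun _ _ => rfl) (fun _ _ => rfl)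
  exact (congrArg (SemiconjBy _ · _) hrev).mpr (chainProj_semiconjBy C _ (hsite R hR) (hsite E hE))

end Metric

/-! ### Uniqueness -/

section Idempotents

variable {K : Type*} [Field K] {n : Type*} [Fintype n] {P Q : Matrix n n K}

theorem exists_trace_eq_natCast (h : IsIdempotentElem P) : ∃ d : ℕ, P.trace = d := by
  classical
  rw [← Matrix.trace_toLin'_eq]
  exact ⟨_, (LinearMap.IsIdempotentElem.isProj_range _ (h.map Matrix.toLinAlgEquiv')).trace⟩

theorem eq_zero_of_trace_eq_zero [CharZero K] (h : IsIdempotentElem P) (ht : P.trace = 0) :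
    P = 0 := by
  classical
  rw [← Matrix.trace_toLin'_eq] at ht
  exact Matrix.toLin'.map_eq_zero_iff.mp (LinearMap.IsIdempotentElem.eq_zero_of_trace_eq_zero
    (h.map Matrix.toLinAlgEquiv') ht)

theorem eq_of_trace_eq [CharZero K] (hP : IsIdempotentElem P) (hQ : IsIdempotentElem Q)
    (hPQ : P * Q = Q) (hQP : Q * P = Q) (ht : P.trace = Q.trace) : P = Q := by
  refine sub_eq_zero.mp (eq_zero_of_trace_eq_zero (hQ.sub hP hQP hPQ) ?_)
  rw [Matrix.trace_sub, ht, sub_self]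

end Idempotents

section Characterization

variable {K : Type*} [Field K] {N d l : ℕ} {ι : Type*} [Fintype ι] [DecidableEq ι]
  {k t c : K} {R E : Mat2 K N} {C : Coeffs K} {p : ι → Mat2 K N} {ε : ι}

/-- The members of the family `p` are linear combinations of `1`, `R` and `E`, of value `1` (for
`p ε`) or `0` (for the others) at `R = c`, `E = 0`, and conversely `R` is a linear combination of
the `p π`, with coefficient `c` at `p ε`. This makes `p ε` play the role of the projector onto the
eigenspace of `R` for the eigenvalue `c`. -/
structure SpectralFamily (c : K) (R E : Mat2 K N) (p : ι → Mat2 K N) (ε : ι) : Prop where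
  value : ∀ π, ∃ x y z : K, p π = x • (1 : Mat2 K N) + y • R + z • E ∧
    x + y * c = if π = ε then 1 else 0
  expand : ∃ r : ι → K, R = ∑ π, r π • p π ∧ r ε = c

theorem SpectralFamily.atSite_mul (hp : SpectralFamily c R E p ε) {m : ℕ} {hm : m + 1 < l}
    {Y : TMat K N l} (hR : atSite R m hm * Y = c • Y) (hE : atSite E m hm * Y = 0) (π : ι) :
    atSite (p π) m hm * Y = if π = ε then Y else 0 := by
  obtain ⟨x, y, z, hπ, hv⟩ := hp.value π
  simp only [← atSiteHom_apply] at hR hE ⊢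
  rw [hπ, map_add, map_add, map_smul, map_smul, map_smul, map_one, add_mul, add_mul,
    smul_mul_assoc, smul_mul_assoc, smul_mul_assoc, one_mul, hR, hE, smul_zero, add_zero,
    smul_smul, ← add_smul, hv, ite_smul, one_smul, zero_smul]

theorem SpectralFamily.mul_atSite (hp : SpectralFamily c R E p ε) {m : ℕ} {hm : m + 1 < l}
    {Y : TMat K N l} (hR : Y * atSite R m hm = c • Y) (hE : Y * atSite E m hm = 0) (π : ι) :
    Y * atSite (p π) m hm = if π = ε then Y else 0 := by
  obtain ⟨x, y, z, hπ, hv⟩ := hp.value π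
  simp only [← atSiteHom_apply] at hR hE ⊢
  rw [hπ, map_add, map_add, map_smul, map_smul, map_smul, map_one, mul_add, mul_add,
    mul_smul_comm, mul_smul_comm, mul_smul_comm, mul_one, hR, hE, smul_zero, add_zero,
    smul_smul, ← add_smul, hv, ite_smul, one_smul, zero_smul]

theorem SpectralFamily.R_mul (hp : SpectralFamily c R E p ε) {P : TMat K N l}
    (hP : IsCompleteProjector p ε d l P) {m : ℕ} (hm : m + 1 < l) :
    atSite R m hm * P = c • P := by
  obtain ⟨r, hr, rfl⟩ := hp.expand
  rw [← atSiteHom_apply, hr, map_sum, Finset.sum_mul]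
  simp only [map_smul, atSiteHom_apply, smul_mul_assoc, hP.mul_left, smul_ite, smul_zero,
    Finset.sum_ite_eq', Finset.mem_univ, if_true]

theorem SpectralFamily.mul_R (hp : SpectralFamily c R E p ε) {P : TMat K N l}
    (hP : IsCompleteProjector p ε d l P) {m : ℕ} (hm : m + 1 < l) :
    P * atSite R m hm = c • P := by
  obtain ⟨r, hr, rfl⟩ := hp.expand
  rw [← atSiteHom_apply, hr, map_sum, Finset.mul_sum]
  simp only [map_smul, atSiteHom_apply, mul_smul_comm, hP.mul_right, smul_ite, smul_zero,
    Finset.sum_ite_eq', Finset.mem_univ, if_true]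

namespace BMWPair

theorem E_mul_tensorProj (h : BMWPair k t R E) (hC : C.IsFusion k t c) {m : ℕ} (hm : m + 1 < l) :
    atSite E m hm * tensorProj C R E l = 0 :=
  (h.crossing.map (atSiteHom K N hm)).mul_eq_zero hC.kt_ne hC.quad (h.R_mul_tensorProj hC hm)

theorem tensorProj_mul_E (h : BMWPair k t R E) (hC : C.IsFusion k t c) {m : ℕ} (hm : m + 1 < l) :
    tensorProj C R E l * atSite E m hm = 0 :=
  MulOpposite.op_injective <|
    ((h.crossing.map (atSiteHom K N hm)).op hC.kt_ne).mul_eq_zero hC.kt_ne hC.quad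
      (congrArg MulOpposite.op (h.tensorProj_mul_R hC hm))

theorem isCompleteProjector_iff [CharZero K] (h : BMWPair k t R E) (hC : C.IsFusion k t c)
    (hp : SpectralFamily c R E p ε) (hd : (tensorProj C R E l).trace = d) {P : TMat K N l} :
    IsCompleteProjector p ε d l P ↔ P = tensorProj C R E l where
  mp hP := (eq_of_trace_eq (h.isIdempotentElem_tensorProj hC l) ((sq P).symm.trans hP.idem)
    (h.tensorProj_mul hC fun _ => hp.R_mul hP) (h.mul_tensorProj hC fun _ => hp.mul_R hP)
    (hd.trans hP.trace.symm)).symm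
  mpr := by
    rintro rfl
    exact {
      mul_right := fun π _ hm =>
        hp.mul_atSite (h.tensorProj_mul_R hC hm) (h.tensorProj_mul_E hC hm) π
      mul_left := fun π _ hm =>
        hp.atSite_mul (h.R_mul_tensorProj hC hm) (h.E_mul_tensorProj hC hm) π
      idem := (sq _).trans (h.isIdempotentElem_tensorProj hC l)
      trace := hd }

end BMWPair

end Characterization

/-! ### Traces -/

section PartialTrace

variable {K : Type*} [Field K] {N l : ℕ} {κ : K}

theorem trace_tensorOne_mul_atSite (P : TMat K N (l + 1)) {M : Mat2 K N}
    (hM : ∀ a b, ∑ x, M (a, x) (b, x) = if a = b then κ else 0) :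
    (tensorOne P * atSite M l (Nat.lt_succ_self _)).trace = κ * P.trace := by
  have entry : ∀ i (a : Fin N), ∑ x, (tensorOne P * atSite M l (Nat.lt_succ_self _) : TMat K N _)
      (Fin.snoc (Fin.snoc i a) x) (Fin.snoc (Fin.snoc i a) x) =
        κ * P (Fin.snoc i a) (Fin.snoc i a) := by
    intro i a
    have expand : ∀ x, (tensorOne P * atSite M l (Nat.lt_succ_self _) : TMat K N _)
        (Fin.snoc (Fin.snoc i a) x) (Fin.snoc (Fin.snoc i a) x) =
          ∑ b, P (Fin.snoc i a) (Fin.snoc i b) * M (b, x) (a, x) := fun x => by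
      simp [Matrix.mul_apply, sum_tuple_snoc, tensorOne_snoc, atSite_last_snoc]
    simp only [expand]
    rw [Finset.sum_comm]
    simp only [← Finset.mul_sum, hM]
    simp [mul_comm]
  simp only [Matrix.trace, Matrix.diag_apply, Finset.mul_sum]
  rw [sum_tuple_snoc, Finset.sum_comm]
  simp only [sum_tuple_snoc (l := l), entry]

theorem trace_tensorProj_succ {C : Coeffs K} {R E : Mat2 K N}
    (hP : IsIdempotentElem (tensorProj C R E (l + 1)))
    (hM : ∀ a b, ∑ x, C.factor (l + 1) R E (a, x) (b, x) = if a = b then κ else 0) :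
    (tensorProj C R E (l + 2)).trace = κ * (tensorProj C R E (l + 1)).trace := by
  rw [tensorProj_succ, Matrix.trace_mul_comm, ← mul_assoc, ← tensorOneHom_apply,
    (hP.map (tensorOneHom K N (l + 1))).eq]
  exact trace_tensorOne_mul_atSite _ hM

end PartialTrace

/-! ### Specialization -/

section Specialization

/-- A subring of a product of fields is the graph of a partial function, the specialization of
elements of `F` to elements of `K`, which is defined at `x⁻¹` whenever it is defined at `x` and
nonzero there. -/
structure IsSpecialization {F K : Type*} [Field F] [Field K] (S : Subring (F × K)) : Prop where
  zero : ∀ v : K, (0, v) ∈ S → v = 0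
  inv : ∀ (x : F) (v : K), (x, v) ∈ S → v ≠ 0 → (x⁻¹, v⁻¹) ∈ S

variable {F K : Type*} [Field F] [Field K] {S : Subring (F × K)}

namespace IsSpecialization

variable {x y : F} {v w : K}

theorem eq (hS : IsSpecialization S) (hv : (x, v) ∈ S) (hw : (x, w) ∈ S) : v = w := by
  have := S.sub_mem hv hw
  rw [Prod.mk_sub_mk, sub_self] at this
  exact sub_eq_zero.mp (hS.zero _ this)

theorem div (hS : IsSpecialization S) (hx : (x, v) ∈ S) (hy : (y, w) ∈ S) (hw : w ≠ 0) :
    (x / y, v / w) ∈ S := by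
  rw [div_eq_mul_inv, div_eq_mul_inv]
  exact S.mul_mem hx (hS.inv _ _ hy hw)

theorem zpow (hS : IsSpecialization S) (hx : (x, v) ∈ S) (hv : v ≠ 0) (n : ℤ) :
    (x ^ n, v ^ n) ∈ S := by
  cases n with
  | ofNat n =>
    rw [Int.ofNat_eq_natCast, zpow_natCast, zpow_natCast]
    exact S.pow_mem hx n
  | negSucc n =>
    rw [zpow_negSucc, zpow_negSucc]
    exact hS.inv _ _ (S.pow_mem hx (n + 1)) (pow_ne_zero _ hv)

end IsSpecialization

theorem prod_sum_mem {ι : Type*} (s : Finset ι) {f : ι → F} {g : ι → K}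
    (h : ∀ i ∈ s, (f i, g i) ∈ S) : (∑ i ∈ s, f i, ∑ i ∈ s, g i) ∈ S := by
  rw [prod_mk_sum]
  exact S.sum_mem h

theorem algebraMap_ne_zero {A : Type*} [CommRing A] [Algebra A F] [FaithfulSMul A F]
    (φ : A →+* K) {d : A} (hd : φ d ≠ 0) : algebraMap A F d ≠ 0 := by
  rw [Ne, FaithfulSMul.algebraMap_eq_zero_iff]
  exact fun h => hd (by rw [h, map_zero])

/-- Pairs of a fraction of elements of `A` defined at the homomorphism `φ` and its value there. -/
def evalRing (F : Type*) [Field F] {A : Type*} [CommRing A] [Algebra A F] [FaithfulSMul A F]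
    (φ : A →+* K) : Subring (F × K) where
  carrier := {z | ∃ p d : A, φ d ≠ 0 ∧ z = (algebraMap A F p / algebraMap A F d, φ p / φ d)}
  mul_mem' := by
    rintro _ _ ⟨p, d, hd, rfl⟩ ⟨p', d', hd', rfl⟩
    exact ⟨p * p', d * d', by simp [hd, hd'], by simp [div_mul_div_comm]⟩
  one_mem' := ⟨1, 1, by simp, by simp; rfl⟩
  add_mem' := by
    rintro _ _ ⟨p, d, hd, rfl⟩ ⟨p', d', hd', rfl⟩
    refine ⟨p * d' + d * p', d * d', by simp [hd, hd'], ?_⟩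
    rw [Prod.mk_add_mk, div_add_div _ _ (algebraMap_ne_zero φ hd) (algebraMap_ne_zero φ hd'),
      div_add_div _ _ hd hd']
    simp only [map_add, map_mul]
  zero_mem' := ⟨0, 1, by simp, by simp; rfl⟩
  neg_mem' := by
    rintro _ ⟨p, d, hd, rfl⟩
    exact ⟨-p, d, hd, by simp [neg_div]⟩

section

variable {A : Type*} [CommRing A] [Algebra A F] [FaithfulSMul A F] (φ : A →+* K)

theorem isSpecialization_evalRing : IsSpecialization (evalRing F φ) where
  zero := by
    rintro v ⟨p, d, hd, h⟩
    obtain ⟨hp, rfl⟩ := Prod.mk.inj h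
    have := (div_eq_zero_iff.mp hp.symm).resolve_right (algebraMap_ne_zero φ hd)
    rw [(FaithfulSMul.algebraMap_eq_zero_iff A F).mp this, map_zero, zero_div]
  inv := by
    rintro x v ⟨p, d, _, h⟩ hv
    obtain ⟨rfl, rfl⟩ := Prod.mk.inj h
    exact ⟨d, p, (div_ne_zero_iff.mp hv).1, by rw [inv_div, inv_div]⟩

theorem algebraMap_mem_evalRing (a : A) : (algebraMap A F a, φ a) ∈ evalRing F φ :=
  ⟨a, 1, by simp, by simp⟩

end

theorem ratFunc_X_mem_evalRing (a : K) :
    (RatFunc.X, a) ∈ evalRing (RatFunc K) (Polynomial.evalRingHom a) := by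
  simpa using algebraMap_mem_evalRing (F := RatFunc K) (Polynomial.evalRingHom a) Polynomial.X

theorem ratFunc_X_pow_ne_one {n : ℕ} (hn : 0 < n) : (RatFunc.X : RatFunc K) ^ n ≠ 1 := by
  rw [← RatFunc.algebraMap_X, ← map_pow, ← map_one (algebraMap (Polynomial K) (RatFunc K)),
    (RatFunc.algebraMap_injective K).ne_iff]
  exact fun h => hn.ne' (by simpa using congrArg Polynomial.natDegree h)

/-- The matrix `B` is the specialization of the matrix `A`. -/
def SpecMat {n : Type*} (S : Subring (F × K)) (A : Matrix n n F) (B : Matrix n n K) : Prop :=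
  ∀ i j, (A i j, B i j) ∈ S

namespace SpecMat

variable {n : Type*} {A A' : Matrix n n F} {B B' : Matrix n n K}

theorem add (h : SpecMat S A B) (h' : SpecMat S A' B') : SpecMat S (A + A') (B + B') :=
  fun i j => S.add_mem (h i j) (h' i j)

theorem smul (h : SpecMat S A B) {x : F} {v : K} (hx : (x, v) ∈ S) :
    SpecMat S (x • A) (v • B) :=
  fun i j => S.mul_mem hx (h i j)

theorem zero : SpecMat S (0 : Matrix n n F) (0 : Matrix n n K) :=
  fun _ _ => S.zero_mem

theorem one [DecidableEq n] : SpecMat S (1 : Matrix n n F) (1 : Matrix n n K) := fun i j => by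
  rw [Matrix.one_apply, Matrix.one_apply]
  split_ifs
  exacts [S.one_mem, S.zero_mem]

theorem eq (hS : IsSpecialization S) (h : SpecMat S A B) (h' : SpecMat S A B') : B = B' :=
  Matrix.ext fun i j => hS.eq (h i j) (h' i j)

variable [Fintype n]

theorem mul (h : SpecMat S A B) (h' : SpecMat S A' B') : SpecMat S (A * A') (B * B') :=
  fun i j => prod_sum_mem _ fun x _ => S.mul_mem (h i x) (h' x j)

theorem trace (h : SpecMat S A B) : (A.trace, B.trace) ∈ S :=
  prod_sum_mem _ fun x _ => h x x

theorem isIdempotentElem (hS : IsSpecialization S) (h : SpecMat S A B) (hA : IsIdempotentElem A) :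
    IsIdempotentElem B :=
  SpecMat.eq hS (h.mul h) (hA.eq.symm ▸ h)

theorem trace_eq_natCast_iff [CharZero F] [CharZero K] (hS : IsSpecialization S)
    (h : SpecMat S A B) (hA : IsIdempotentElem A) (d : ℕ) : A.trace = d ↔ B.trace = d := by
  obtain ⟨d', hd'⟩ := exists_trace_eq_natCast hA
  have hB : B.trace = d' := hS.eq (hd' ▸ h.trace) (natCast_mem S d')
  rw [hd', hB, Nat.cast_inj, Nat.cast_inj]

end SpecMat

/-- Specialization of coefficients, where `l = 0` does not matter as it does not occur in the
fusion recursion. -/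
def SpecCoeffs (S : Subring (F × K)) (C : Coeffs F) (C' : Coeffs K) : Prop :=
  ∀ l, 1 ≤ l → (C.α l, C'.α l) ∈ S ∧ (C.β l, C'.β l) ∈ S ∧ (C.γ l, C'.γ l) ∈ S

variable {N : ℕ} {R E : Mat2 F N} {R' E' : Mat2 K N} {C : Coeffs F} {C' : Coeffs K}

theorem SpecMat.atSite (h : SpecMat S R R') {l m : ℕ} (hm : m + 1 < l) :
    SpecMat S (atSite R m hm) (atSite R' m hm) := fun i j => by
  rw [QProj.atSite, QProj.atSite, Matrix.of_apply, Matrix.of_apply]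
  split_ifs
  exacts [h _ _, S.zero_mem]

theorem SpecMat.factor (hC : SpecCoeffs S C C') (hR : SpecMat S R R') (hE : SpecMat S E E')
    (l : ℕ) : SpecMat S (C.factor (l + 1) R E) (C'.factor (l + 1) R' E') :=
  have ⟨hα, hβ, hγ⟩ := hC (l + 1) l.succ_pos
  ((SpecMat.one.smul hα).add (hR.smul hβ)).add (hE.smul hγ)

theorem SpecMat.tensorOne {l : ℕ} {P : TMat F N l} {P' : TMat K N l} (h : SpecMat S P P') :
    SpecMat S (tensorOne P) (tensorOne P') := fun i j => by
  rw [QProj.tensorOne, QProj.tensorOne, Matrix.of_apply, Matrix.of_apply]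
  split_ifs
  exacts [h _ _, S.zero_mem]

theorem SpecMat.tensorProj (hC : SpecCoeffs S C C') (hR : SpecMat S R R') (hE : SpecMat S E E')
    (l : ℕ) : SpecMat S (tensorProj C R E (l + 1)) (tensorProj C' R' E' (l + 1)) := by
  induction l with
  | zero => exact SpecMat.one
  | succ l ih =>
    rw [tensorProj_succ, tensorProj_succ]
    exact (ih.tensorOne.mul ((SpecMat.factor hC hR hE l).atSite _)).mul ih.tensorOne

end Specialization

/-! ### Coefficients of the recursion -/

section FusionCoeffs

variable {K : Type*} [Field K]

/-- Coefficients of a fusion recursion for the parameters `k = c - c⁻¹` and `t` and the eigenvalue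
`c`. In terms of `[y] = (c ^ y - c ^ (-y)) / (c - c⁻¹)`, they are `c ^ (-l) / [l + 1]`,
`[l] / [l + 1]` and `[l] (c ^ 2 - 1) / ([l + 1] (c - t⁻¹ c ^ (2 l)))`. -/
def fusionCoeffs (c t : K) : Coeffs K where
  α l := (∑ i ∈ Finset.range (l + 1), (c ^ 2) ^ i)⁻¹
  β l := c * (∑ i ∈ Finset.range l, (c ^ 2) ^ i) / ∑ i ∈ Finset.range (l + 1), (c ^ 2) ^ i
  γ l := c * t * (c ^ 2 - 1) * (∑ i ∈ Finset.range l, (c ^ 2) ^ i) /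
    ((∑ i ∈ Finset.range (l + 1), (c ^ 2) ^ i) * (c * t - (c ^ 2) ^ l))

theorem geom_sum_ne_zero_of_pow_ne_one {x : K} {l : ℕ} (h : x ^ l ≠ 1) :
    ∑ i ∈ Finset.range l, x ^ i ≠ 0 := fun h0 => h <| by
  rw [← sub_eq_zero, ← geom_sum_mul, h0, zero_mul]

theorem fusionCoeffs_γ_succ {c : K} (hc : c ≠ 0) (t : K) (l : ℕ) : (fusionCoeffs c t).γ (l + 1) =
    t * (c ^ 2 - 1) * (∑ i ∈ Finset.range (l + 1), (c ^ 2) ^ i) /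
      ((∑ i ∈ Finset.range (l + 2), (c ^ 2) ^ i) * (t - c * (c ^ 2) ^ l)) := by
  rw [fusionCoeffs, ← mul_div_mul_left _ _ hc]
  ring_nf

theorem fusionCoeffs_isFusion {c t : K} (hc0 : c ≠ 0) (ht : t ≠ 0)
    (hc : ∀ l, (c ^ 2) ^ (l + 1) ≠ 1) (hct : ∀ l, t ≠ c * (c ^ 2) ^ l) :
    (fusionCoeffs c t).IsFusion (c - c⁻¹) t c := by
  have hg : ∀ l, ∑ i ∈ Finset.range (l + 1), (c ^ 2) ^ i ≠ 0 := fun l =>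
    geom_sum_ne_zero_of_pow_ne_one (hc l)
  have hd : ∀ l, t - c * (c ^ 2) ^ l ≠ 0 := fun l => sub_ne_zero.mpr (hct l)
  refine ⟨fun hk => hc 0 ?_, ht, ?_, ?_, fun l => ?_, fun a => ?_, fun a => ?_, fun a => ?_⟩
  · field_simp at hk
    linear_combination hk
  · field_simp
    ring
  · simp [fusionCoeffs]
  · have := hg l
    simp only [fusionCoeffs]
    field_simp
    rw [geom_sum_succ]
    ring
  · have := hg a
    have := hg (a + 1)
    simp only [fusionCoeffs]
    field_simp
  · cases a with
    | zero => simp [fusionCoeffs]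
    | succ a =>
      have := hg a
      have := hg (a + 1)
      have := hg (a + 2)
      have := hd a
      have := hd (a + 1)
      rw [fusionCoeffs_γ_succ hc0, fusionCoeffs_γ_succ hc0]
      simp only [fusionCoeffs]
      field_simp
      ring
  · have := hg a
    have := hg (a + 1)
    have := hd a
    rw [fusionCoeffs_γ_succ hc0]
    simp only [fusionCoeffs]
    field_simp
    linear_combination -(c ^ 2 - 1) * c * geom_sum_mul (c ^ 2) a

/-- The eigenvalue `ε q ^ ε` of a braid matrix on the range of a completely (anti)symmetric
projector. -/
def eigenvalue (q : K) (ε : PM) : K := ε.sgn * q ^ ε.sgn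

theorem PM.sgn_cast_sq (R : Type*) [Ring R] (ε : PM) : (ε.sgn : R) ^ 2 = 1 := by
  cases ε <;> simp [PM.sgn]

theorem eigenvalue_sq (q : K) (ε : PM) : eigenvalue q ε ^ 2 = (q ^ ε.sgn) ^ 2 := by
  rw [eigenvalue, mul_pow, PM.sgn_cast_sq, one_mul]

theorem eigenvalue_sub_inv (q : K) (ε : PM) : eigenvalue q ε - (eigenvalue q ε)⁻¹ = q - q⁻¹ := by
  cases ε
  · simp [eigenvalue, PM.sgn]
  · simp [eigenvalue, PM.sgn]
    ring

theorem zpow_ne_one {q : K} (hq : ∀ n : ℕ, 0 < n → q ^ n ≠ 1) {n : ℤ} (hn : n ≠ 0) :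
    q ^ n ≠ 1 := by
  obtain ⟨m, rfl | rfl⟩ := n.eq_nat_or_neg
  · simpa using hq m (by lia)
  · simpa using hq m (by lia)

theorem zpow_ne_neg_one [NeZero (2 : K)] {q : K} (hq : ∀ n : ℕ, 0 < n → q ^ n ≠ 1) (n : ℤ) :
    q ^ n ≠ -1 := by
  intro h
  rcases eq_or_ne n 0 with rfl | hn
  · rw [zpow_zero, eq_neg_iff_add_eq_zero, one_add_one_eq_two] at h
    exact two_ne_zero h
  · apply zpow_ne_one hq (mul_ne_zero hn two_ne_zero)
    rw [zpow_mul, h]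
    norm_num

theorem eigenvalue_sq_pow_ne_one {q : K} (hq : ∀ n : ℕ, 0 < n → q ^ n ≠ 1) (ε : PM) (l : ℕ) :
    (eigenvalue q ε ^ 2) ^ (l + 1) ≠ 1 := by
  rw [eigenvalue_sq, ← pow_mul, ← zpow_natCast, ← zpow_mul]
  apply zpow_ne_one hq
  cases ε <;> simp [PM.sgn] <;> lia

theorem eigenvalue_ne_zero {q : K} (hq0 : q ≠ 0) (ε : PM) : eigenvalue q ε ≠ 0 := by
  cases ε <;> simp [eigenvalue, PM.sgn, hq0]

theorem eigenvalue_mul_sq_pow {q : K} (hq0 : q ≠ 0) (ε : PM) (l : ℕ) :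
    eigenvalue q ε * (eigenvalue q ε ^ 2) ^ l = ε.sgn * q ^ (ε.sgn * (2 * l + 1)) := by
  rw [eigenvalue_sq, eigenvalue, zpow_mul, zpow_add₀ (zpow_ne_zero _ hq0), zpow_one,
    zpow_mul _ 2, zpow_natCast, zpow_ofNat]
  ring

theorem zpow_one_sub_ne_eigenvalue_mul_sq_pow [NeZero (2 : K)] {q : K} (hq0 : q ≠ 0)
    (hq : ∀ n : ℕ, 0 < n → q ^ n ≠ 1) {N : ℕ} (hN : 0 < N) (ε : PM) (l : ℕ) :
    q ^ (1 - (N : ℤ)) ≠ eigenvalue q ε * (eigenvalue q ε ^ 2) ^ l := by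
  rw [eigenvalue_mul_sq_pow hq0]
  intro h
  have h' : q ^ (ε.sgn * (2 * l + 1 : ℤ) - (1 - N)) = ε.sgn := by
    rw [zpow_sub₀ hq0, h, div_eq_iff (by rw [← h]; exact zpow_ne_zero _ hq0)]
    linear_combination -q ^ (ε.sgn * (2 * l + 1 : ℤ)) * PM.sgn_cast_sq K ε
  cases ε
  · exact zpow_ne_one hq (by simp [PM.sgn]; lia) (h'.trans (by simp [PM.sgn]))
  · exact zpow_ne_neg_one hq _ (h'.trans (by simp [PM.sgn]))

/-- The coefficients of the fusion recursion of the completely (anti)symmetric projectors. -/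
def qCoeffs (N : ℕ) (q : K) (ε : PM) : Coeffs K :=
  fusionCoeffs (eigenvalue q ε) (q ^ (1 - (N : ℤ)))

theorem qCoeffs_isFusion [NeZero (2 : K)] {q : K} (hq0 : q ≠ 0)
    (hq : ∀ n : ℕ, 0 < n → q ^ n ≠ 1) {N : ℕ} (hN : 0 < N) (ε : PM) :
    (qCoeffs N q ε).IsFusion (q - q⁻¹) (q ^ (1 - (N : ℤ))) (eigenvalue q ε) := by
  rw [← eigenvalue_sub_inv q ε]
  exact fusionCoeffs_isFusion (eigenvalue_ne_zero hq0 ε) (zpow_ne_zero _ hq0)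
    (eigenvalue_sq_pow_ne_one hq ε) (zpow_one_sub_ne_eigenvalue_mul_sq_pow hq0 hq hN ε)

theorem qnum_zpow_sgn (q : K) (ε : PM) (y : ℤ) : qnum (q ^ ε.sgn) y = qnum q y := by
  cases ε
  · simp [PM.sgn]
  · simp only [qnum, PM.sgn, zpow_neg_one, inv_zpow', inv_inv, neg_neg]
    rw [← neg_sub, ← neg_sub q, neg_div_neg_eq]

theorem qnum_natCast {u : K} (hu0 : u ≠ 0) (hu : u ^ 2 ≠ 1) (l : ℕ) :
    qnum u l = u * (u ^ l)⁻¹ * ∑ i ∈ Finset.range l, (u ^ 2) ^ i := by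
  have hk : u - u⁻¹ ≠ 0 := fun h => hu (by field_simp at h; linear_combination h)
  rw [qnum, div_eq_iff hk, zpow_neg, zpow_natCast]
  have := geom_sum_mul (u ^ 2) l
  field_simp
  linear_combination -this

section Qnum

variable {q : K} (hq0 : q ≠ 0) (hq : ∀ n : ℕ, 0 < n → q ^ n ≠ 1) (N : ℕ) (ε : PM) (l : ℕ)
include hq0 hq

theorem qnum_eq_geom_sum : qnum q l =
    q ^ ε.sgn * ((q ^ ε.sgn) ^ l)⁻¹ * ∑ i ∈ Finset.range l, (eigenvalue q ε ^ 2) ^ i := by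
  rw [← qnum_zpow_sgn q ε, eigenvalue_sq]
  refine qnum_natCast (zpow_ne_zero _ hq0) ?_ l
  simpa [eigenvalue_sq] using eigenvalue_sq_pow_ne_one hq ε 0

theorem qCoeffs_α :
    (qCoeffs N q ε).α l = (qnum q (l + 1))⁻¹ * q ^ (-(ε.sgn * l)) := by
  have hu : q ^ ε.sgn ≠ 0 := zpow_ne_zero _ hq0
  rw [← Nat.cast_succ, qnum_eq_geom_sum hq0 hq ε, zpow_neg, zpow_mul, zpow_natCast]
  simp only [qCoeffs, fusionCoeffs, pow_succ]
  field_simp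

theorem qCoeffs_β :
    (qCoeffs N q ε).β l = (qnum q (l + 1))⁻¹ * (ε.sgn * qnum q l) := by
  have hu : q ^ ε.sgn ≠ 0 := zpow_ne_zero _ hq0
  rw [← Nat.cast_succ, qnum_eq_geom_sum hq0 hq ε, qnum_eq_geom_sum hq0 hq ε l]
  simp only [qCoeffs, fusionCoeffs, pow_succ]
  rw [eigenvalue]
  field_simp

omit hq in
theorem qCoeffs_γ_denominator :
    eigenvalue q ε * q ^ (1 - (N : ℤ)) - (eigenvalue q ε ^ 2) ^ l = ε.sgn * q ^ (1 - (N : ℤ)) *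
      (q ^ ε.sgn - ε.sgn * q ^ ((N : ℤ) - 1 + 2 * ε.sgn * l)) := by
  have : q ^ ((N : ℤ) - 1 + 2 * ε.sgn * l) * q ^ (1 - (N : ℤ)) = ((q ^ ε.sgn) ^ 2) ^ l := by
    rw [← zpow_add₀ hq0, ← zpow_natCast, ← zpow_natCast, ← zpow_mul, ← zpow_mul]
    congr 1
    push_cast
    ring
  rw [eigenvalue_sq, eigenvalue]
  linear_combination (ε.sgn : K) ^ 2 * this + ((q ^ ε.sgn) ^ 2) ^ l * PM.sgn_cast_sq K ε

theorem qCoeffs_γ :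
    (qCoeffs N q ε).γ l = (qnum q (l + 1))⁻¹ * ((q ^ (2 * ε.sgn) - 1) * qnum q l /
      (q ^ ε.sgn - ε.sgn * q ^ ((N : ℤ) - 1 + 2 * ε.sgn * l))) := by
  have hu : q ^ ε.sgn ≠ 0 := zpow_ne_zero _ hq0
  have ht : (ε.sgn : K) * q ^ (1 - (N : ℤ)) ≠ 0 :=
    mul_ne_zero (left_ne_zero_of_mul (eigenvalue_ne_zero hq0 ε)) (zpow_ne_zero _ hq0)
  rw [← Nat.cast_succ, qnum_eq_geom_sum hq0 hq ε, qnum_eq_geom_sum hq0 hq ε l]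
  simp only [qCoeffs, fusionCoeffs, qCoeffs_γ_denominator hq0, pow_succ _ l]
  generalize q ^ ε.sgn - ε.sgn * q ^ ((N : ℤ) - 1 + 2 * ε.sgn * l) = D
  rw [mul_comm 2, zpow_mul, zpow_ofNat, eigenvalue_sq, mul_left_comm, eigenvalue, mul_assoc,
    mul_right_comm _ _ (q ^ (1 - (N : ℤ))), mul_assoc (_ * _), mul_div_mul_left _ _ ht]
  field_simp

end Qnum

section SpecCoeffs

variable {F : Type*} [Field F] {S : Subring (F × K)}

theorem geom_sum_mem {x : F} {v : K} (h : (x, v) ∈ S) (l : ℕ) :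
    (∑ i ∈ Finset.range l, x ^ i, ∑ i ∈ Finset.range l, v ^ i) ∈ S :=
  prod_sum_mem _ fun i _ => S.pow_mem h i

theorem specCoeffs_fusionCoeffs (hS : IsSpecialization S) {c t : F} {c' t' : K}
    (hc : (c, c') ∈ S) (ht : (t, t') ∈ S) (hc0 : c' ≠ 0)
    (hg : ∀ l, ∑ i ∈ Finset.range (l + 1), (c' ^ 2) ^ i ≠ 0)
    (hct : ∀ l, t' ≠ c' * (c' ^ 2) ^ l) :
    SpecCoeffs S (fusionCoeffs c t) (fusionCoeffs c' t') := by
  have hx : (c ^ 2, c' ^ 2) ∈ S := S.pow_mem hc 2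
  have hG := geom_sum_mem hx
  refine fun l hl => ⟨hS.inv _ _ (hG _) (hg l), hS.div (S.mul_mem hc (hG _)) (hG _) (hg l), ?_⟩
  have hd : c' * t' - (c' ^ 2) ^ l ≠ 0 := by
    obtain ⟨l, rfl⟩ := Nat.exists_eq_succ_of_ne_zero (Nat.one_le_iff_ne_zero.mp hl)
    have := mul_ne_zero hc0 (sub_ne_zero.mpr (hct l))
    rwa [mul_sub, ← mul_assoc, ← sq, ← pow_succ'] at this
  exact hS.div (S.mul_mem (S.mul_mem (S.mul_mem hc ht) (S.sub_mem hx S.one_mem)) (hG _))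
    (S.mul_mem (hG _) (S.sub_mem (S.mul_mem hc ht) (S.pow_mem hx _)))
    (mul_ne_zero (hg l) hd)

/-- The specialization of `qCoeffs` at `q = 1`. -/
def classicalCoeffs (K : Type*) [Field K] (N : ℕ) (ε : PM) : Coeffs K where
  α l := ((l + 1 : ℕ) : K)⁻¹
  β l := ε.sgn * l / (l + 1 : ℕ)
  γ l := match ε with
    | .plus => -(2 * l) / ((l + 1 : ℕ) * (2 * l + N - 2))
    | .minus => 0

theorem fusionCoeffs_zpow_γ_succ {q : K} (hq0 : q ≠ 0) (hq : q ≠ 1) (N l : ℕ) :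
    (fusionCoeffs q (q ^ (1 - (N : ℤ)))).γ (l + 1) =
      -((q + 1) * ∑ i ∈ Finset.range (l + 1), (q ^ 2) ^ i) /
        ((∑ i ∈ Finset.range (l + 2), (q ^ 2) ^ i) * ∑ i ∈ Finset.range (2 * l + N), q ^ i) := by
  set t := q ^ (1 - (N : ℤ)) with ht
  have htN : t * q ^ N = q := by rw [ht, ← zpow_natCast, ← zpow_add₀ hq0]; simp
  have ht0 : t ≠ 0 := zpow_ne_zero _ hq0
  have hd : t - q * (q ^ 2) ^ l = -t * (q - 1) * ∑ i ∈ Finset.range (2 * l + N), q ^ i := by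
    rw [mul_assoc, mul_comm (q - 1), geom_sum_mul, pow_add, pow_mul]
    linear_combination (q ^ 2) ^ l * htN
  have ha : -t * (q - 1) ≠ 0 := mul_ne_zero (neg_ne_zero.mpr ht0) (sub_ne_zero.mpr hq)
  rw [fusionCoeffs_γ_succ hq0, hd, ← mul_div_mul_left (-(_ * _)) _ ha]
  congr 1 <;> ring

theorem specCoeffs_qCoeffs_plus [CharZero K] (hS : IsSpecialization S) {q : F} (hq0 : q ≠ 0)
    (hq : q ≠ 1) (h : (q, 1) ∈ S) {N : ℕ} (hN : 0 < N) :
    SpecCoeffs S (fusionCoeffs q (q ^ (1 - (N : ℤ)))) (classicalCoeffs K N .plus) := by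
  have hH : ∀ l, (∑ i ∈ Finset.range l, q ^ i, (l : K)) ∈ S := fun l => by
    simpa using geom_sum_mem h l
  have hG : ∀ l, (∑ i ∈ Finset.range l, (q ^ 2) ^ i, (l : K)) ∈ S := fun l => by
    simpa using geom_sum_mem (S.pow_mem h 2) l
  have hne : ∀ l : ℕ, ((l + 1 : ℕ) : K) ≠ 0 := fun l => Nat.cast_ne_zero.mpr l.succ_ne_zero
  intro l hl
  refine ⟨hS.inv _ _ (hG _) (hne l), ?_, ?_⟩
  · simpa [PM.sgn, fusionCoeffs, classicalCoeffs] using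
      hS.div (S.mul_mem h (hG l)) (hG (l + 1)) (hne l)
  · obtain ⟨l, rfl⟩ := Nat.exists_eq_succ_of_ne_zero (Nat.one_le_iff_ne_zero.mp hl)
    rw [Nat.succ_eq_add_one, fusionCoeffs_zpow_γ_succ hq0 hq]
    have hne' : ((2 * l + N : ℕ) : K) ≠ 0 := Nat.cast_ne_zero.mpr (by lia)
    have h₂ : (q + 1, (2 : K)) ∈ S :=
      one_add_one_eq_two (R := K) ▸ S.add_mem h S.one_mem
    have hγ : (classicalCoeffs K N .plus).γ (l + 1) =
        -(2 * (l + 1 : ℕ)) / ((l + 2 : ℕ) * (2 * l + N : ℕ)) := by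
      simp only [classicalCoeffs]
      push_cast
      ring_nf
    rw [hγ]
    exact hS.div (S.neg_mem (S.mul_mem h₂ (hG _))) (S.mul_mem (hG _) (hH _))
      (mul_ne_zero (hne _) hne')

theorem fusionCoeffs_neg_one (t : K) (N : ℕ) :
    fusionCoeffs (-1) t = classicalCoeffs K N .minus := by
  simp [fusionCoeffs, classicalCoeffs, PM.sgn]

theorem specCoeffs_qCoeffs_one [CharZero K] (hS : IsSpecialization S) {q : F} (hq0 : q ≠ 0)
    (hq : q ≠ 1) (h : (q, 1) ∈ S) {N : ℕ} (hN : 0 < N) (ε : PM) :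
    SpecCoeffs S (qCoeffs N q ε) (classicalCoeffs K N ε) := by
  cases ε
  · simpa [qCoeffs, eigenvalue, PM.sgn] using specCoeffs_qCoeffs_plus hS hq0 hq h hN
  · rw [← fusionCoeffs_neg_one 1]
    refine specCoeffs_fusionCoeffs hS ?_ ?_ (by simp) (fun l => ?_) (fun l => ?_)
    · simpa [eigenvalue, PM.sgn] using S.neg_mem (hS.inv _ _ h one_ne_zero)
    · simpa using hS.zpow h one_ne_zero (1 - (N : ℤ))
    · simpa using Nat.cast_add_one_ne_zero l
    · norm_num

theorem specCoeffs_qCoeffs [CharZero K] (hS : IsSpecialization S) {x : F} {q : K}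
    (h : (x, q) ∈ S) (hq0 : q ≠ 0) (hq : ∀ n : ℕ, 0 < n → q ^ n ≠ 1) {N : ℕ} (hN : 0 < N)
    (ε : PM) : SpecCoeffs S (qCoeffs N x ε) (qCoeffs N q ε) :=
  specCoeffs_fusionCoeffs hS (S.mul_mem (intCast_mem S ε.sgn) (hS.zpow h hq0 _))
    (hS.zpow h hq0 _) (eigenvalue_ne_zero hq0 ε)
    (fun l => geom_sum_ne_zero_of_pow_ne_one (eigenvalue_sq_pow_ne_one hq ε l))
    (zpow_one_sub_ne_eigenvalue_mul_sq_pow hq0 hq hN ε)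

end SpecCoeffs

end FusionCoeffs

section ClassicalTrace

variable {F K : Type*} [Field F] [Field K] {N : ℕ}

theorem trace_tensorProj {C : Coeffs K} {R E : Mat2 K N} {κ : ℕ → K} {d : ℕ → ℕ}
    (hP : ∀ l, IsIdempotentElem (tensorProj C R E (l + 1)))
    (hκ : ∀ l a b, ∑ x, C.factor (l + 1) R E (a, x) (b, x) = if a = b then κ l else 0)
    (hd₁ : d 1 = N) (hd : ∀ l, (d (l + 2) : K) = κ l * d (l + 1)) (l : ℕ) :
    (tensorProj C R E (l + 1)).trace = d (l + 1) := by
  induction l with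
  | zero => simp [tensorProj_one, hd₁]
  | succ l ih => rw [trace_tensorProj_succ (hP l) (hκ l), ih, hd]

/-- The interchange of two tensor factors, which is the braid matrix at `q = 1`. -/
def flipMat (K : Type*) [Field K] (N : ℕ) : Mat2 K N :=
  Matrix.of fun a b => if a.1 = b.2 ∧ a.2 = b.1 then 1 else 0

theorem sum_flipMat (a b : Fin N) :
    ∑ x, flipMat K N (a, x) (b, x) = if a = b then 1 else 0 := by
  simp only [flipMat, Matrix.of_apply, ite_and, Finset.sum_ite_eq, Finset.mem_univ, if_true,
    eq_comm]

theorem sum_factor_flipMat (C : Coeffs K) {E : Mat2 K N} {η : K}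
    (hE : ∀ a b, ∑ x, E (a, x) (b, x) = if a = b then η else 0) (l : ℕ) (a b : Fin N) :
    ∑ x, C.factor l (flipMat K N) E (a, x) (b, x) =
      if a = b then C.α l * N + C.β l + C.γ l * η else 0 := by
  have hone : ∑ x : Fin N, (1 : Mat2 K N) (a, x) (b, x) = if a = b then (N : K) else 0 := by
    simp [Matrix.one_apply]
  simp only [Coeffs.factor, Matrix.add_apply, Matrix.smul_apply, smul_eq_mul,
    Finset.sum_add_distrib, ← Finset.mul_sum, hone, sum_flipMat, hE]
  split_ifs <;> ring

/-- The trace does not change from `S₁` (specialization at `q = 1`) to `S₂` (specialization at a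
given `q`) since over `F`, where `q` is generic, it is the trace of an idempotent, hence a natural
number. -/
theorem trace_tensorProj_specialization [CharZero F] [CharZero K] {S₁ S₂ : Subring (F × K)}
    (hS₁ : IsSpecialization S₁) (hS₂ : IsSpecialization S₂) {C : Coeffs F} {C₁ C₂ : Coeffs K}
    {R E : Mat2 F N} {R₂ E₁ E₂ : Mat2 K N}
    (hP : ∀ l, IsIdempotentElem (tensorProj C R E (l + 1)))
    (hC₁ : SpecCoeffs S₁ C C₁) (hR₁ : SpecMat S₁ R (flipMat K N)) (hE₁ : SpecMat S₁ E E₁)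
    (hC₂ : SpecCoeffs S₂ C C₂) (hR₂ : SpecMat S₂ R R₂) (hE₂ : SpecMat S₂ E E₂)
    {η : K} (hη : ∀ a b, ∑ x, E₁ (a, x) (b, x) = if a = b then η else 0) {d : ℕ → ℕ}
    (hd₁ : d 1 = N) (hd : ∀ l, (d (l + 2) : K) =
      (C₁.α (l + 1) * N + C₁.β (l + 1) + C₁.γ (l + 1) * η) * d (l + 1)) (l : ℕ) :
    (tensorProj C₂ R₂ E₂ (l + 1)).trace = d (l + 1) := by
  have spec₁ := SpecMat.tensorProj hC₁ hR₁ hE₁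
  rw [← (SpecMat.tensorProj hC₂ hR₂ hE₂ l).trace_eq_natCast_iff hS₂ (hP l),
    (spec₁ l).trace_eq_natCast_iff hS₁ (hP l)]
  exact trace_tensorProj (fun l => (spec₁ l).isIdempotentElem hS₁ (hP l))
    (fun l => sum_factor_flipMat C₁ hη (l + 1)) hd₁ hd l

end ClassicalTrace

section Dimensions

theorem choose_add_succ_mul (n l : ℕ) :
    (n + l + 1).choose n * (l + 1) = (n + l).choose n * (n + l + 1) := by
  rw [Nat.choose_mul_succ_eq, show n + l + 1 - n = l + 1 by lia]

theorem glDim_one {N : ℕ} (hN : 0 < N) (ε : PM) : glDim N ε 1 = N := by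
  obtain ⟨n, rfl⟩ := Nat.exists_eq_add_one.mpr hN
  cases ε <;> simp [glDim]

theorem soDim_one {N : ℕ} (hN : 0 < N) (ε : PM) : soDim N ε 1 = N := by
  obtain ⟨n, rfl⟩ := Nat.exists_eq_add_one.mpr hN
  cases ε <;> simp [soDim]

variable {K : Type*} [Field K] [CharZero K]

theorem cast_choose_succ_mul (N l : ℕ) :
    (N.choose (l + 1) : K) * (l + 1) = N.choose l * (N - l) := by
  rcases Nat.lt_or_ge N l with h | h
  · simp [Nat.choose_eq_zero_of_lt h, Nat.choose_eq_zero_of_lt (Nat.lt_succ_of_lt h)]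
  · exact_mod_cast congrArg (Nat.cast (R := K)) (Nat.choose_succ_right_eq N l)

theorem cast_choose_succ (N l : ℕ) : (N.choose (l + 1) : K) =
    ((classicalCoeffs K N .minus).α l * N + (classicalCoeffs K N .minus).β l) * N.choose l := by
  have hl : (l : K) + 1 ≠ 0 := l.cast_add_one_ne_zero
  simp only [classicalCoeffs, PM.sgn]
  push_cast
  field_simp
  linear_combination cast_choose_succ_mul (K := K) N l

theorem glDim_succ {N : ℕ} (hN : 0 < N) (ε : PM) (l : ℕ) : (glDim N ε (l + 1) : K) =
    ((classicalCoeffs K N ε).α l * N + (classicalCoeffs K N ε).β l) * glDim N ε l := by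
  cases ε
  · obtain ⟨n, rfl⟩ := Nat.exists_eq_add_one.mpr hN
    have hl : (l : K) + 1 ≠ 0 := l.cast_add_one_ne_zero
    have h := congrArg (Nat.cast (R := K)) (choose_add_succ_mul n l)
    push_cast at h
    simp only [glDim, classicalCoeffs, PM.sgn, Nat.add_sub_cancel, ← add_assoc]
    push_cast
    field_simp
    linear_combination h
  · exact cast_choose_succ N l

omit [CharZero K] in
theorem soDim_plus_add_two_mul (n m : ℕ) :
    (soDim (n + 1) .plus (m + 2) : K) * ((m + 2) * (m + 1)) =
      (2 * m + n + 3) * n * (n + m).choose n := by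
  have h₁ := congrArg (Nat.cast (R := K)) (choose_add_succ_mul n m)
  have h₂ := congrArg (Nat.cast (R := K)) (choose_add_succ_mul n (m + 1))
  have hdim : (soDim (n + 1) .plus (m + 2) : K) =
      (n + (m + 1) + 1).choose n - (n + m).choose n := by
    rw [soDim, if_pos (by lia), show n + 1 + (m + 2) - 3 = n + m by lia, Nat.add_sub_cancel,
      Nat.cast_sub (Nat.choose_le_choose n (by lia)), add_assoc n]
  push_cast at h₁ h₂
  rw [hdim]
  linear_combination (m + 1 : K) * h₂ + (n + m + 2 : K) * h₁

theorem soDim_plus_add_one_mul (n m : ℕ) :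
    (soDim (n + 1) .plus (m + 1) : K) * ((m + 1) * (n + m)) =
      (2 * m + n + 1) * n * (n + m).choose n := by
  cases m with
  | zero => simp [soDim_one]
  | succ m =>
    have h := congrArg (Nat.cast (R := K)) (choose_add_succ_mul n m)
    have hm : (m : K) + 1 ≠ 0 := m.cast_add_one_ne_zero
    push_cast at h
    refine mul_right_cancel₀ hm ?_
    push_cast
    linear_combination (n + m + 1 : K) * soDim_plus_add_two_mul (K := K) n m -
      (2 * m + n + 3) * n * h

theorem soDim_succ {N : ℕ} (hN : 0 < N) (ε : PM) (m : ℕ) : (soDim N ε (m + 2) : K) =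
    ((classicalCoeffs K N ε).α (m + 1) * N + (classicalCoeffs K N ε).β (m + 1) +
      (classicalCoeffs K N ε).γ (m + 1)) * soDim N ε (m + 1) := by
  cases ε
  · obtain ⟨n, rfl⟩ := Nat.exists_eq_add_one.mpr hN
    have h₁ : (m : K) + 1 ≠ 0 := m.cast_add_one_ne_zero
    have h₂ : (m : K) + 1 + 1 ≠ 0 := by exact_mod_cast (m + 1).succ_ne_zero
    have h₃ : (m : K) * 2 + n + 1 ≠ 0 := by exact_mod_cast (m * 2 + n).succ_ne_zero
    simp only [classicalCoeffs, PM.sgn]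
    push_cast
    rw [show (2 : K) * (m + 1) + (n + 1) - 2 = m * 2 + n + 1 by ring]
    field_simp
    refine mul_left_cancel₀ h₁ ?_
    linear_combination (2 * m + n + 1 : K) * soDim_plus_add_two_mul (K := K) n m -
      (2 * m + n + 3) * soDim_plus_add_one_mul (K := K) n m
  · simpa [classicalCoeffs, soDim] using cast_choose_succ (K := K) N (m + 1)

end Dimensions

/-! ### Action on basis vectors -/

section Columns

variable {K : Type*} [Field K] {N : ℕ} {V : Type*} [AddCommGroup V] [Module K V]

/-- The image of the basis vector `(a, b)` under `A`, where `f` is the family of basis vectors or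
the image of this family under a linear map. -/
def columnSum (A : Mat2 K N) (a b : Fin N) (f : Fin N → Fin N → V) : V :=
  ∑ p : Fin N × Fin N, A p (a, b) • f p.1 p.2

theorem columnSum_add (A A' : Mat2 K N) (a b : Fin N) (f : Fin N → Fin N → V) :
    columnSum (A + A') a b f = columnSum A a b f + columnSum A' a b f := by
  simp only [columnSum, Matrix.add_apply, add_smul, Finset.sum_add_distrib]

theorem columnSum_sub (A A' : Mat2 K N) (a b : Fin N) (f : Fin N → Fin N → V) :
    columnSum (A - A') a b f = columnSum A a b f - columnSum A' a b f := by
  simp only [columnSum, Matrix.sub_apply, sub_smul, Finset.sum_sub_distrib]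

theorem columnSum_smul (r : K) (A : Mat2 K N) (a b : Fin N) (f : Fin N → Fin N → V) :
    columnSum (r • A) a b f = r • columnSum A a b f := by
  simp only [columnSum, Matrix.smul_apply, smul_assoc, Finset.smul_sum]

theorem columnSum_sum {ι : Type*} (s : Finset ι) (A : ι → Mat2 K N) (a b : Fin N)
    (f : Fin N → Fin N → V) :
    columnSum (∑ i ∈ s, A i) a b f = ∑ i ∈ s, columnSum (A i) a b f := by
  simp only [columnSum, Matrix.sum_apply, Finset.sum_smul]
  exact Finset.sum_comm

theorem columnSum_kron (i j i' j' a b : Fin N) (f : Fin N → Fin N → V) :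
    columnSum ((e i j : Matrix (Fin N) (Fin N) K) ⊗ₖ e i' j') a b f =
      if i = a ∧ i' = b then f j j' else 0 := by
  simp only [columnSum, Fintype.sum_prod_type, Matrix.kroneckerMap_apply, e, Matrix.single_apply]
  by_cases h : i = a <;> by_cases h' : i' = b <;> simp [h, h']

theorem entry_eq_columnSum (A : Mat2 K N) (a b c d : Fin N) :
    A (a, b) (c, d) = columnSum A c d fun u v => if a = u ∧ b = v then (1 : K) else 0 := by
  simp [columnSum, Fintype.sum_prod_type, ite_and]

theorem mat2_ext {A A' : Mat2 K N}
    (h : ∀ (a b : Fin N) (f : Fin N → Fin N → K), columnSum A a b f = columnSum A' a b f) :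
    A = A' := by
  ext ⟨a, b⟩ ⟨c, d⟩
  rw [entry_eq_columnSum A, entry_eq_columnSum A', h]

theorem columnSum_mul (A A' : Mat2 K N) (a b : Fin N) (f : Fin N → Fin N → V) :
    columnSum (A * A') a b f = columnSum A' a b fun u v => columnSum A u v f := by
  simp only [columnSum, Matrix.mul_apply, Finset.sum_smul, Finset.smul_sum, smul_smul]
  rw [Finset.sum_comm]
  exact Finset.sum_congr rfl fun _ _ => Finset.sum_congr rfl fun _ _ => by rw [mul_comm]

theorem columnSum_one (a b : Fin N) (f : Fin N → Fin N → V) :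
    columnSum (1 : Mat2 K N) a b f = f a b := by
  simp [columnSum, Matrix.one_apply]

/-- The basis vectors of the space of 3-tensors. -/
def basis3 (K : Type*) [Field K] {N : ℕ} (a b c : Fin N) : (Fin 3 → Fin N) → K :=
  Pi.single ![a, b, c] 1

theorem tuple_three_eta (i : Fin 3 → Fin N) : ![i 0, i 1, i 2] = i := by
  ext r
  fin_cases r <;> rfl

/-- A matrix of 2-tensors acting on the first two factors of 3-tensors. -/
def actFirst (A : Mat2 K N) : ((Fin 3 → Fin N) → K) →ₗ[K] (Fin 3 → Fin N) → K :=
  (atSite A 0 (by omega)).mulVecLin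

/-- A matrix of 2-tensors acting on the last two factors of 3-tensors. -/
def actLast (A : Mat2 K N) : ((Fin 3 → Fin N) → K) →ₗ[K] (Fin 3 → Fin N) → K :=
  (atSite A 1 (by omega)).mulVecLin

theorem atSite_zero_mulVec (A : Mat2 K N) (v : (Fin 3 → Fin N) → K) :
    (atSite A 0 (by omega)).mulVec v = actFirst A v := rfl

theorem atSite_one_mulVec (A : Mat2 K N) (v : (Fin 3 → Fin N) → K) :
    (atSite A 1 (by omega)).mulVec v = actLast A v := rfl

theorem actFirst_basis3 (A : Mat2 K N) (a b c : Fin N) :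
    actFirst A (basis3 K a b c) = columnSum A a b fun u v => basis3 K u v c := by
  ext i
  rw [← tuple_three_eta i]
  simp [actFirst, basis3, columnSum, atSite, Fin.forall_fin_succ, Pi.single_apply,
    Fintype.sum_prod_type, ite_and]
  rfl

theorem actLast_basis3 (A : Mat2 K N) (a b c : Fin N) :
    actLast A (basis3 K a b c) = columnSum A b c fun u v => basis3 K a u v := by
  ext i
  rw [← tuple_three_eta i]
  simp [actLast, basis3, columnSum, atSite, Fin.forall_fin_succ, Pi.single_apply,
    Fintype.sum_prod_type, ite_and]
  rfl

theorem tmat3_ext {X Y : TMat K N 3}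
    (h : ∀ a b c, X.mulVec (basis3 K a b c) = Y.mulVec (basis3 K a b c)) : X = Y := by
  refine Matrix.ext_of_mulVec_single fun i => ?_
  simpa only [basis3, tuple_three_eta] using h (i 0) (i 1) (i 2)

end Columns

/-! ### The braid matrix of `U_q gl(N)` -/

section Hecke

variable {K : Type*} [Field K] {N : ℕ} {V : Type*} [AddCommGroup V] [Module K V]

theorem hecke_quadratic {q : K} (hq0 : q ≠ 0) (a b : Fin N) (f : Fin N → Fin N → V) :
    (if a = b then q else 1) •
        ((if b = a then q else 1) • f a b + (if b < a then q - q⁻¹ else 0) • f b a) +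
      (if a < b then q - q⁻¹ else 0) •
        ((if a = b then q else 1) • f b a + (if a < b then q - q⁻¹ else 0) • f a b) =
      f a b + (q - q⁻¹) •
        ((if a = b then q else 1) • f b a + (if a < b then q - q⁻¹ else 0) • f a b) := by
  rcases lt_trichotomy a b with h | rfl | h
  · simp only [h, not_lt_of_gt h, if_true, if_false, ne_of_lt h, ne_of_gt h]
    match_scalars <;> ring
  · simp only [lt_irrefl, if_true, if_false]
    match_scalars
    field_simp
    ring
  · simp only [h, not_lt_of_gt h, if_true, if_false, ne_of_lt h, ne_of_gt h]
    match_scalars <;> ring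

/-- The set `p` of triples restricts the claim to those basis vectors on which a braid matrix is
that of `U_q gl(N)`. -/
theorem hecke_braid {q : K} (hq0 : q ≠ 0) {B : Fin N → Fin N → Fin N → V}
    {σ₁ σ₂ : V →ₗ[K] V} {p : Fin N → Fin N → Fin N → Prop}
    (h₁ : ∀ a b c, p a b c → p b a c ∧ σ₁ (B a b c) =
      (if a = b then q else 1) • B b a c + (if a < b then q - q⁻¹ else 0) • B a b c)
    (h₂ : ∀ a b c, p a b c → p a c b ∧ σ₂ (B a b c) =
      (if b = c then q else 1) • B a c b + (if b < c then q - q⁻¹ else 0) • B a b c)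
    {a b c : Fin N} (h : p a b c) :
    σ₂ (σ₁ (σ₂ (B a b c))) = σ₁ (σ₂ (σ₁ (B a b c))) := by
  have ⟨hbac, σ₁_abc⟩ := h₁ _ _ _ h
  have ⟨hacb, σ₂_abc⟩ := h₂ _ _ _ h
  have ⟨hbca, σ₂_bac⟩ := h₂ _ _ _ hbac
  have ⟨hcab, σ₁_acb⟩ := h₁ _ _ _ hacb
  simp only [σ₁_abc, σ₂_abc, σ₂_bac, σ₁_acb, (h₁ _ _ _ hbac).2, (h₂ _ _ _ hacb).2,
    (h₁ _ _ _ hbca).2, (h₂ _ _ _ hcab).2, map_add, map_smul]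
  clear * - hq0
  rcases lt_trichotomy a b with hab | hab | hab <;>
    rcases lt_trichotomy b c with hbc | hbc | hbc <;>
    rcases lt_trichotomy a c with hac | hac | hac <;>
    first
    | (exfalso; order)
    | (subst_vars
       simp only [lt_irrefl, *, not_lt_of_gt, if_true, if_false, ne_of_lt, ne_of_gt] <;>
       match_scalars <;> field_simp <;> ring)

end Hecke

section GeneralLinear

variable {K : Type*} [Field K] {N : ℕ}

section

variable {V : Type*} [AddCommGroup V] [Module K V]

theorem sum_pair_filter (p : Fin N → Fin N → Prop) [∀ i j, Decidable (p i j)] (a b : Fin N)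
    (g : Fin N → Fin N → V) :
    ∑ i, ∑ j with p i j, (if i = a ∧ j = b then g i j else 0) = if p a b then g a b else 0 := by
  rw [Finset.sum_eq_single a]
  · rw [Finset.sum_filter, Finset.sum_eq_single b] <;> simp +contextual
  · intro i _ hi
    simp [hi]
  · simp

theorem sum_diag (a b : Fin N) (g : Fin N → V) :
    ∑ i, (if i = a ∧ i = b then g i else 0) = if a = b then g a else 0 := by
  rw [Finset.sum_eq_single a] <;> simp +contextual

theorem columnSum_glR (q : K) (a b : Fin N) (f : Fin N → Fin N → V) :
    columnSum (glR q) a b f =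
      (if a = b then q else 1) • f b a + (if a < b then q - q⁻¹ else 0) • f a b := by
  simp only [glR, columnSum_add, columnSum_smul, columnSum_sum, columnSum_kron, sum_pair_filter,
    sum_diag]
  by_cases h : a = b
  · simp [h]
  · by_cases h' : a < b <;> simp [h, h']

end

theorem glR_apply (q : K) (a b c d : Fin N) :
    glR q (a, b) (c, d) = (if a = d ∧ b = c then if a = b then q else 1 else 0) +
      if a = c ∧ b = d ∧ a < b then q - q⁻¹ else 0 := by
  rw [entry_eq_columnSum (glR q), columnSum_glR]
  simp only [smul_eq_mul, mul_ite, mul_one, mul_zero]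
  grind

theorem transpose_glR (q : K) : (glR q : Mat2 K N).transpose = glR q := by
  ext ⟨a, b⟩ ⟨c, d⟩
  rw [Matrix.transpose_apply, glR_apply, glR_apply]
  grind

theorem glR_mul_self {q : K} (hq0 : q ≠ 0) :
    (glR q * glR q : Mat2 K N) = 1 + (q - q⁻¹) • glR q := by
  refine mat2_ext fun a b f => ?_
  simp only [columnSum_mul, columnSum_add, columnSum_smul, columnSum_one, columnSum_glR]
  exact hecke_quadratic hq0 a b f

theorem glR_braid {q : K} (hq0 : q ≠ 0) :
    (atSite (glR q) 1 (by omega) * atSite (glR q) 0 (by omega) * atSite (glR q) 1 (by omega) :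
      TMat K N 3) =
      atSite (glR q) 0 (by omega) * atSite (glR q) 1 (by omega) * atSite (glR q) 0 (by omega) := by
  refine tmat3_ext fun a b c => ?_
  simp only [← Matrix.mulVec_mulVec, atSite_zero_mulVec, atSite_one_mulVec]
  exact hecke_braid hq0 (B := basis3 K) (p := fun _ _ _ => True)
    (fun a b c _ => ⟨trivial, (actFirst_basis3 _ a b c).trans (columnSum_glR q a b _)⟩)
    (fun a b c _ => ⟨trivial, (actLast_basis3 _ a b c).trans (columnSum_glR q b c _)⟩) trivial

theorem glR_bmwPair {q : K} (hq0 : q ≠ 0) (t : K) :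
    BMWPair (q - q⁻¹) t (glR q : Mat2 K N) 0 where
  crossing := ⟨by rw [glR_mul_self hq0, smul_zero, sub_zero], by rw [mul_zero, smul_zero]⟩
  symm := transpose_glR q
  triple := by
    constructor
    · exact glR_braid hq0
    all_goals simp only [← atSiteHom_apply, map_zero, mul_zero, zero_mul]

instance : Fintype PM := ⟨{.plus, .minus}, fun ε => by cases ε <;> simp⟩

theorem sum_pm {M : Type*} [AddCommMonoid M] (f : PM → M) : ∑ ε, f ε = f .plus + f .minus := by
  change ∑ ε ∈ {PM.plus, PM.minus}, f ε = _
  rw [Finset.sum_pair (by decide)]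

theorem sq_add_one_ne_zero [NeZero (2 : K)] {q : K} (hq : ∀ n : ℕ, 0 < n → q ^ n ≠ 1) :
    q ^ 2 + 1 ≠ 0 := fun h =>
  zpow_ne_neg_one hq 2 (by rw [zpow_ofNat]; linear_combination h)

theorem glP_spectralFamily [NeZero (2 : K)] {q : K} (hq0 : q ≠ 0)
    (hq : ∀ n : ℕ, 0 < n → q ^ n ≠ 1) (ε : PM) :
    SpectralFamily (eigenvalue q ε) (glR q : Mat2 K N) 0 (glP q) ε where
  value π := by
    have h2 := sq_add_one_ne_zero hq
    refine ⟨(q + q⁻¹)⁻¹ * q ^ (-π.sgn), (q + q⁻¹)⁻¹ * π.sgn, 0, ?_, ?_⟩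
    · rw [glP, smul_add, smul_smul, smul_smul, zero_smul, add_zero]
    · cases π <;> cases ε <;> simp [PM.sgn, eigenvalue] <;> field_simp
      ring
  expand := by
    have h2 := sq_add_one_ne_zero hq
    refine ⟨eigenvalue q, ?_, rfl⟩
    rw [sum_pm]
    simp only [glP, eigenvalue, PM.sgn]
    match_scalars <;> simp <;> field_simp
    ring

end GeneralLinear

section MatrixUnitSpecialization

variable {F K : Type*} [Field F] [Field K] {S : Subring (F × K)} {N : ℕ}

namespace SpecMat

variable {n : Type*} {A A' : Matrix n n F} {B B' : Matrix n n K}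

theorem sub (h : SpecMat S A B) (h' : SpecMat S A' B') : SpecMat S (A - A') (B - B') :=
  fun i j => S.sub_mem (h i j) (h' i j)

theorem sum {ι : Type*} (s : Finset ι) {f : ι → Matrix n n F} {g : ι → Matrix n n K}
    (h : ∀ x, SpecMat S (f x) (g x)) : SpecMat S (∑ x ∈ s, f x) (∑ x ∈ s, g x) := fun i j => by
  rw [Matrix.sum_apply, Matrix.sum_apply]
  exact prod_sum_mem s fun x _ => h x i j

theorem e_kronecker_e (i j i' j' : Fin N) :
    SpecMat S (e i j ⊗ₖ e i' j' : Mat2 F N) (e i j ⊗ₖ e i' j') := fun a b => by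
  simp only [Matrix.kroneckerMap_apply, e, Matrix.single_apply]
  split_ifs <;> simp [S.zero_mem, S.one_mem, ← Prod.one_eq_mk, ← Prod.zero_eq_mk]

end SpecMat

end MatrixUnitSpecialization

section GeneralLinearProjectors

variable {K : Type*} [Field K] {N : ℕ}

theorem specMat_glR {F : Type*} [Field F] {S : Subring (F × K)} (hS : IsSpecialization S) {q : F}
    {v : K} (h : (q, v) ∈ S) (hv : v ≠ 0) : SpecMat S (glR q : Mat2 F N) (glR v) :=
  (((SpecMat.sum _ fun _ => SpecMat.e_kronecker_e _ _ _ _).smul h).add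
    (SpecMat.sum _ fun _ => SpecMat.sum _ fun _ => SpecMat.e_kronecker_e _ _ _ _)).add
    ((SpecMat.sum _ fun _ => SpecMat.sum _ fun _ => SpecMat.e_kronecker_e _ _ _ _).smul
      (S.sub_mem h (hS.inv _ _ h hv)))

theorem glR_one : (glR 1 : Mat2 K N) = flipMat K N := by
  ext ⟨a, b⟩ ⟨c, d⟩
  simp [glR_apply, flipMat]

variable [CharZero K] {q : K} (hN : 0 < N) (hq0 : q ≠ 0) (hq : ∀ n : ℕ, 0 < n → q ^ n ≠ 1) (ε : PM)

include hN hq0 hq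

theorem trace_tensorProj_glR (l : ℕ) :
    (tensorProj (qCoeffs N q ε) (glR q : Mat2 K N) 0 (l + 1)).trace = glDim N ε (l + 1) := by
  have hX0 : (RatFunc.X : RatFunc K) ≠ 0 := RatFunc.X_ne_zero
  have hX : ∀ n : ℕ, 0 < n → (RatFunc.X : RatFunc K) ^ n ≠ 1 := fun _ => ratFunc_X_pow_ne_one
  have hS a := isSpecialization_evalRing (F := RatFunc K) (Polynomial.evalRingHom (R := K) a)
  have hXS := ratFunc_X_mem_evalRing (K := K)
  exact trace_tensorProj_specialization (hS 1) (hS q)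
    (fun l => (glR_bmwPair hX0 _).isIdempotentElem_tensorProj (qCoeffs_isFusion hX0 hX hN ε) _)
    (specCoeffs_qCoeffs_one (hS 1) hX0 (by simpa using hX 1) (hXS 1) hN ε)
    (glR_one (K := K) ▸ specMat_glR (hS 1) (hXS 1) one_ne_zero) .zero
    (specCoeffs_qCoeffs (hS q) (hXS q) hq0 hq hN ε) (specMat_glR (hS q) (hXS q) hq0) .zero
    (η := 0) (by simp) (glDim_one hN ε) (fun l => by simpa using glDim_succ (K := K) hN ε (l + 1)) l

omit hN [CharZero K] in
theorem factor_glR (l : ℕ) : (qCoeffs N q ε).factor l (glR q : Mat2 K N) 0 = glM q ε l := by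
  rw [Coeffs.factor, qCoeffs_α hq0 hq, qCoeffs_β hq0 hq, smul_zero, add_zero, glM, smul_add,
    smul_smul, smul_smul]

variable {ε} {l : ℕ} {P : TMat K N l}

theorem isGlProjector_iff (hl : 1 ≤ l) :
    IsGlProjector q ε l P ↔ P = tensorProj (qCoeffs N q ε) (glR q) 0 l := by
  obtain ⟨l, rfl⟩ := Nat.exists_eq_add_of_le' hl
  exact (glR_bmwPair hq0 _).isCompleteProjector_iff (qCoeffs_isFusion hq0 hq hN ε)
    (glP_spectralFamily hq0 hq ε) (trace_tensorProj_glR hN hq0 hq ε l)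

variable (ε) in
theorem existsUnique_isGlProjector (hl : 1 ≤ l) : ∃! P : TMat K N l, IsGlProjector q ε l P := by
  simp only [isGlProjector_iff hN hq0 hq hl, existsUnique_eq]

namespace IsGlProjector

theorem eq_one {P : TMat K N 1} (hP : IsGlProjector q ε 1 P) : P = 1 :=
  (isGlProjector_iff hN hq0 hq le_rfl).mp hP

theorem eq_tensorOne {P' : TMat K N (l + 1)} (hP : IsGlProjector q ε l P)
    (hP' : IsGlProjector q ε (l + 1) P') (hl : 1 ≤ l) :
    P' = tensorOne P *
      atSite (glM q ε l) (l - 1) (Nat.lt_succ_of_le (Nat.sub_add_cancel hl).le) * tensorOne P := by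
  rw [(isGlProjector_iff hN hq0 hq hl).mp hP,
    (isGlProjector_iff hN hq0 hq (Nat.le_succ_of_le hl)).mp hP', ← factor_glR hq0 hq]
  obtain ⟨l, rfl⟩ := Nat.exists_eq_add_of_le' hl
  exact tensorProj_succ _ _ _ l

theorem eq_oneTensor {P' : TMat K N (l + 1)} (hP : IsGlProjector q ε l P)
    (hP' : IsGlProjector q ε (l + 1) P') (hl : 1 ≤ l) :
    P' = oneTensor P * atSite (glM q ε l) 0 (Nat.succ_lt_succ hl) * oneTensor P := by
  rw [(isGlProjector_iff hN hq0 hq hl).mp hP,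
    (isGlProjector_iff hN hq0 hq (Nat.le_succ_of_le hl)).mp hP', ← factor_glR hq0 hq]
  obtain ⟨l, rfl⟩ := Nat.exists_eq_add_of_le' hl
  exact (glR_bmwPair hq0 _).tensorProj_succ' (qCoeffs_isFusion hq0 hq hN ε) l

theorem mem_braidPolynomials (hP : IsGlProjector q ε l P) (hl : 1 ≤ l) :
    P ∈ braidPolynomials (glR q) l :=
  have hC := qCoeffs_isFusion hq0 hq hN ε
  (isGlProjector_iff hN hq0 hq hl).mp hP ▸
    (glR_bmwPair hq0 _).tensorProj_mem (mul_ne_zero hC.k_ne hC.t_ne) _ l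

theorem transpose_eq (hP : IsGlProjector q ε l P) (hl : 1 ≤ l) : P.transpose = P :=
  have hC := qCoeffs_isFusion hq0 hq hN ε
  (isGlProjector_iff hN hq0 hq hl).mp hP ▸
    (glR_bmwPair hq0 _).transpose_tensorProj (mul_ne_zero hC.k_ne hC.t_ne) _ l

end IsGlProjector

end GeneralLinearProjectors

section OrthogonalWeights

variable {K : Type*} [Field K] {N : ℕ}

theorem twoRho_eq_sub_sign (a : Fin N) :
    twoRho a = ((N : ℤ) - 1 - 2 * a) - ((N : ℤ) - 1 - 2 * a).sign := by
  simp only [twoRho, Fin.lt_def, Fin.ext_iff, Fin.val_rev]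
  rcases lt_trichotomy ((N : ℤ) - 1 - 2 * a) 0 with h | h | h
  · rw [Int.sign_eq_neg_one_of_neg h, if_neg (by omega), if_neg (by omega)]
    ring
  · rw [h, if_neg (by omega), if_pos (by omega), Int.sign_zero, sub_zero]
  · rw [Int.sign_eq_one_of_pos h, if_pos (by omega)]
    ring

theorem twoRho_rev (a : Fin N) : twoRho a.rev = -twoRho a := by
  have : (N : ℤ) - 1 - 2 * a.rev = -((N : ℤ) - 1 - 2 * a) := by
    rw [Fin.val_rev]
    omega
  rw [twoRho_eq_sub_sign, twoRho_eq_sub_sign, this, Int.sign_neg]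
  ring

/-- `q^{-ρ_a}`. -/
def qNegRho (s : K) (a : Fin N) : K := s ^ (-twoRho a)

theorem qNegRho_rev (s : K) (a : Fin N) : qNegRho s a.rev = (qNegRho s a)⁻¹ := by
  rw [qNegRho, qNegRho, twoRho_rev, zpow_neg, zpow_neg]

theorem qNegRho_ne_zero {s : K} (hs : s ≠ 0) (a : Fin N) : qNegRho s a ≠ 0 := zpow_ne_zero _ hs

theorem qNegRho_mul_self (s : K) (a : Fin N) :
    qNegRho s a * qNegRho s a = (s ^ 2) ^ (-twoRho a) := by
  rw [qNegRho, ← mul_zpow, sq]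

/-- `q` to the inner product of the weights of two basis vectors. -/
def qWeight (q : K) (a b : Fin N) : K :=
  if b = a then if a = a.rev then 1 else q else if b = a.rev then q⁻¹ else 1

theorem qWeight_comm (q : K) (a b : Fin N) : qWeight q a b = qWeight q b a := by
  have : b = a.rev ↔ a = b.rev := by rw [eq_comm, Fin.rev_eq_iff]
  by_cases h : b = a
  · rw [h]
  · simp only [qWeight, h, Ne.symm h, if_false, this]

theorem qWeight_rev_left (q : K) (a b : Fin N) : qWeight q a.rev b = (qWeight q a b)⁻¹ := by
  simp only [qWeight, Fin.rev_rev]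
  by_cases h : b = a <;> by_cases h' : b = a.rev
  · simp [h, show a.rev = a from h'.symm.trans h]
  · simp [h, show a ≠ a.rev from h ▸ h']
  · simp [h', show a.rev ≠ a from h' ▸ h]
  · simp [h, h']

theorem qWeight_rev_rev (q : K) (a b : Fin N) : qWeight q a.rev b.rev = qWeight q a b := by
  rw [qWeight_rev_left, qWeight_comm, qWeight_rev_left, inv_inv, qWeight_comm]

theorem qWeight_of_ne_rev (q : K) {a b : Fin N} (h : b ≠ a.rev) :
    qWeight q a b = if a = b then q else 1 := by
  rcases eq_or_ne a b with rfl | hab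
  · rw [qWeight, if_pos rfl, if_neg h, if_pos rfl]
  · rw [qWeight, if_neg hab.symm, if_neg h, if_neg hab]

theorem qWeight_rev_self (q : K) (a : Fin N) :
    qWeight q a a.rev = if a = a.rev then 1 else q⁻¹ := by
  by_cases h : a = a.rev
  · simp only [qWeight, ← h, if_true]
  · simp only [qWeight, h, Ne.symm h, if_true, if_false]

/-- A primitive of `q^{-2ρ}`, where `d` stands for `N - 1 - 2a` if `a` is counted from `0`. -/
def qRhoPrimitive (q : K) (d : ℤ) : K :=
  if -1 ≤ d then q ^ (-d) else q ^ (-d - 2) + (q - q⁻¹)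

theorem qRhoPrimitive_sub {q : K} (hq : q ≠ 0) (d : ℤ) :
    qRhoPrimitive q (d - 2) - qRhoPrimitive q d = (q - q⁻¹) * q ^ (-(d - d.sign)) := by
  have hsub (n : ℤ) : q ^ (n + 1) - q ^ (n - 1) = (q - q⁻¹) * q ^ n := by
    rw [zpow_add_one₀ hq, zpow_sub_one₀ hq]
    ring
  rw [← hsub]
  rcases lt_trichotomy d 0 with h | rfl | h
  · rw [Int.sign_eq_neg_one_of_neg h, qRhoPrimitive, qRhoPrimitive, if_neg (by omega)]
    split_ifs with h'
    · obtain rfl : d = -1 := by omega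
      simp
    · ring_nf
  · simp [qRhoPrimitive]
  · rw [Int.sign_eq_one_of_pos h, qRhoPrimitive, qRhoPrimitive, if_pos (by omega),
      if_pos (by omega)]
    ring_nf

theorem qRhoPrimitive_eq {s : K} (hs : s ≠ 0) (z : Fin N) :
    qRhoPrimitive (s ^ 2) ((N : ℤ) - 1 - 2 * z) =
      qWeight (s ^ 2) z z.rev * (qNegRho s z * qNegRho s z) +
        if z.rev < z then s ^ 2 - (s ^ 2)⁻¹ else 0 := by
  have hq : s ^ 2 ≠ 0 := pow_ne_zero 2 hs
  simp only [qWeight_rev_self, qNegRho_mul_self, twoRho_eq_sub_sign, Fin.lt_def, Fin.ext_iff,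
    Fin.val_rev, qRhoPrimitive]
  generalize s ^ 2 = q at *
  rcases lt_trichotomy ((N : ℤ) - 1 - 2 * z) 0 with h | h | h
  · rw [Int.sign_eq_neg_one_of_neg h, if_neg (show ¬(z : ℕ) = N - (z + 1) by omega),
      if_pos (show N - (z + 1) < (z : ℕ) by omega), ← zpow_neg_one, ← zpow_add₀ hq]
    split_ifs with h'
    · rw [show (N : ℤ) - 1 - 2 * z = -1 by omega]
      simp
    · ring_nf
  · rw [h, if_pos (by omega), if_pos (by omega), if_neg (by omega)]
    simp
  · rw [Int.sign_eq_one_of_pos h, if_pos (by omega), if_neg (by omega), if_neg (by omega),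
      ← zpow_neg_one, ← zpow_add₀ hq, add_zero]
    ring_nf

theorem sum_qNegRho_mul_self {s : K} (hs : s ≠ 0) (z : Fin N) :
    (s ^ 2 - (s ^ 2)⁻¹) * ∑ u, (if u < z then qNegRho s u * qNegRho s u else 0) =
      qWeight (s ^ 2) z z.rev * (qNegRho s z * qNegRho s z) +
        (if z.rev < z then s ^ 2 - (s ^ 2)⁻¹ else 0) - (s ^ 2) ^ (1 - (N : ℤ)) := by
  have hN := z.pos
  have hstart : qRhoPrimitive (s ^ 2) (N - 1) = (s ^ 2) ^ (1 - (N : ℤ)) := by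
    rw [qRhoPrimitive, if_pos (by omega), neg_sub]
  have hsum : ∑ u, (if u < z then qNegRho s u * qNegRho s u else 0) =
      ∑ m ∈ Finset.range z, (s ^ 2) ^ (-((N - 1 - 2 * m : ℤ) - (N - 1 - 2 * m : ℤ).sign)) := by
    simp only [qNegRho_mul_self, twoRho_eq_sub_sign]
    refine (Fin.sum_univ_eq_sum_range (fun m => if m < (z : ℕ) then
      (s ^ 2) ^ (-((N - 1 - 2 * m : ℤ) - (N - 1 - 2 * m : ℤ).sign)) else 0) N).trans ?_
    rw [← Finset.sum_filter]
    refine Finset.sum_congr ?_ fun _ _ => rfl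
    ext m
    rw [Finset.mem_filter, Finset.mem_range, Finset.mem_range]
    omega
  rw [← qRhoPrimitive_eq hs, ← hstart, hsum, Finset.mul_sum]
  refine Eq.trans (Finset.sum_congr rfl fun m _ =>
    (qRhoPrimitive_sub (pow_ne_zero 2 hs) _).symm) ?_
  simpa [mul_add, sub_sub, add_assoc] using
    Finset.sum_range_sub (fun m : ℕ => qRhoPrimitive (s ^ 2) (N - 1 - 2 * m)) z

end OrthogonalWeights

/-! ### The braid matrix of `U_q so(N)` -/

section Orthogonal

variable {K : Type*} [Field K] {N : ℕ}

/-- The matrix `Q_N P^t`, which is defined without inverting `Q_N`. -/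
def soE (s : K) : Mat2 K N := Matrix.of fun a b => soG s a.1 a.2 * soG s b.1 b.2

theorem soG_apply (s : K) (a b : Fin N) :
    soG s a b = if b = a.rev then qNegRho s a else 0 := by
  simp only [soG, Matrix.of_apply, qNegRho]
  by_cases h : b = a.rev
  · simp [h, twoRho_rev]
  · rw [if_neg h, if_neg (Ne.symm h)]

theorem soE_apply (s : K) (a b c d : Fin N) : soE s (a, b) (c, d) =
    if b = a.rev ∧ d = c.rev then qNegRho s a * qNegRho s c else 0 := by
  simp only [soE, Matrix.of_apply, soG_apply]
  split_ifs <;> simp_all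

section

variable {V : Type*} [AddCommGroup V] [Module K V]

theorem columnSum_soE (s : K) (a b : Fin N) (f : Fin N → Fin N → V) :
    columnSum (soE s) a b f =
      if b = a.rev then ∑ u, (qNegRho s a * qNegRho s u) • f u u.rev else 0 := by
  simp only [columnSum, soE_apply, Fintype.sum_prod_type]
  split_ifs with h
  · refine Finset.sum_congr rfl fun u _ => ?_
    rw [Finset.sum_eq_single u.rev] <;> simp +contextual [h, mul_comm]
  · simp [h]

theorem sum_filter_diag (p : Fin N → Prop) [DecidablePred p] (r : Fin N → Fin N) (a b : Fin N)
    (g : Fin N → V) :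
    ∑ i with p i, (if i = a ∧ r i = b then g i else 0) = if p a ∧ r a = b then g a else 0 := by
  rw [Finset.sum_filter, Finset.sum_eq_single a] <;> simp +contextual [ite_and]

theorem columnSum_sum_rev {s : K} (hs : s ≠ 0) (a b : Fin N) (f : Fin N → Fin N → V) :
    columnSum (∑ i : Fin N, ∑ j : Fin N with i < j, s ^ (-twoRho i + twoRho j) •
      ((e i j.rev : Matrix (Fin N) (Fin N) K) ⊗ₖ e i.rev j)) a b f =
      if b = a.rev then
        ∑ u, (if u < a.rev then qNegRho s a * qNegRho s u else 0) • f u u.rev else 0 := by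
  simp only [columnSum_sum, columnSum_smul, columnSum_kron]
  rw [Finset.sum_eq_single a (by simp +contextual) (by simp)]
  by_cases h : b = a.rev
  · simp only [h, true_and, if_true]
    rw [Finset.sum_filter, ← Equiv.sum_comp Fin.revPerm]
    refine Finset.sum_congr rfl fun u _ => ?_
    simp only [Fin.revPerm_apply, Fin.rev_rev, Fin.lt_rev_iff (i := a), twoRho_rev, ite_smul,
      zero_smul, zpow_add₀ hs, qNegRho]
  · simp [h, Ne.symm h]

theorem columnSum_soR {s : K} (hs : s ≠ 0) (a b : Fin N) (f : Fin N → Fin N → V) :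
    columnSum (soR s) a b f = qWeight (s ^ 2) a b • f b a +
      (if a < b then s ^ 2 - (s ^ 2)⁻¹ else 0) • f a b -
      if b = a.rev then ∑ u, (if u < a.rev then
        (s ^ 2 - (s ^ 2)⁻¹) * (qNegRho s a * qNegRho s u) else 0) • f u u.rev else 0 := by
  simp only [soR, columnSum_add, columnSum_sub, columnSum_smul, columnSum_sum_rev hs]
  simp only [columnSum_sum, columnSum_kron, sum_pair_filter, sum_filter_diag]
  have hweight : s ^ 2 • (if a ≠ a.rev ∧ a = b then f a a else 0) +
      (if (a ≠ b ∧ a ≠ b.rev) ∨ (a = b.rev ∧ a = a.rev) then f b a else 0) +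
      (s ^ 2)⁻¹ • (if a ≠ a.rev ∧ a.rev = b then f a.rev a else 0) =
      qWeight (s ^ 2) a b • f b a := by
    have hrev : a = b.rev ↔ b = a.rev := by rw [← Fin.rev_eq_iff, eq_comm]
    simp only [qWeight]
    by_cases h : b = a
    · by_cases h' : a = a.rev
      · simp [h, ← h']
      · simp [h, h', Ne.symm h']
    · by_cases h' : b = a.rev
      · have : a ≠ a.rev := fun h'' => h (h'.trans h''.symm)
        simp [h', this, this.symm]
      · simp [h, h', Ne.symm h, Ne.symm h', hrev]
  rw [hweight, smul_sub, ← add_sub_assoc]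
  simp only [ite_smul, smul_ite, smul_zero, zero_smul, Finset.smul_sum, mul_smul]

end

theorem soR_apply {s : K} (hs : s ≠ 0) (a b c d : Fin N) :
    soR s (a, b) (c, d) = (if a = d ∧ b = c then qWeight (s ^ 2) a b else 0) +
      (if a = c ∧ b = d ∧ a < b then s ^ 2 - (s ^ 2)⁻¹ else 0) -
      if b = a.rev ∧ d = c.rev ∧ a < c.rev then
        (s ^ 2 - (s ^ 2)⁻¹) * (qNegRho s a * qNegRho s c) else 0 := by
  rw [entry_eq_columnSum (soR s), columnSum_soR hs]
  simp only [smul_eq_mul, mul_ite, mul_one, mul_zero]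
  congr 1
  · congr 1
    · by_cases h : a = d ∧ b = c
      · rw [if_pos h, if_pos h, h.1, h.2, qWeight_comm]
      · rw [if_neg h, if_neg h]
    · grind
  · by_cases h : d = c.rev
    · rw [if_pos h, Finset.sum_eq_single a (by grind) (by simp)]
      grind
    · rw [if_neg h, if_neg (fun h' => h h'.2.1)]

theorem transpose_soR {s : K} (hs : s ≠ 0) : (soR s : Mat2 K N).transpose = soR s := by
  ext ⟨a, b⟩ ⟨c, d⟩
  rw [Matrix.transpose_apply, soR_apply hs, soR_apply hs]
  have h₁ := qWeight_comm (s ^ 2) a b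
  have h₂ : c < a.rev ↔ a < c.rev := Fin.lt_rev_iff
  grind

end Orthogonal

section ZeroWeight

variable {K : Type*} [Field K] {N : ℕ}

/-- The matrix of the braid matrix on the zero weight space, whose basis is formed by the pairs
`(v, -v)`. -/
def zeroWeightR (s : K) (v z : Fin N) : K :=
  (if v = z.rev then qWeight (s ^ 2) z z.rev else 0) +
    (if v = z ∧ z < z.rev then s ^ 2 - (s ^ 2)⁻¹ else 0) -
    if v < z.rev then (s ^ 2 - (s ^ 2)⁻¹) * (qNegRho s z * qNegRho s v) else 0

theorem zeroWeightR_comm (s : K) (v z : Fin N) : zeroWeightR s v z = zeroWeightR s z v := by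
  have hlt : v < z.rev ↔ z < v.rev := Fin.lt_rev_iff
  have hrev : v = z.rev ↔ z = v.rev := by rw [← Fin.rev_eq_iff, eq_comm]
  have hweight : z = v.rev → qWeight (s ^ 2) z z.rev = qWeight (s ^ 2) v v.rev := by
    rintro rfl
    rw [Fin.rev_rev, qWeight_comm]
  unfold zeroWeightR
  grind

theorem columnSum_soR_rev {V : Type*} [AddCommGroup V] [Module K V] {s : K} (hs : s ≠ 0)
    (z : Fin N) (f : Fin N → Fin N → V) :
    columnSum (soR s) z z.rev f = ∑ v, zeroWeightR s v z • f v v.rev := by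
  simp only [columnSum_soR hs, zeroWeightR, sub_smul, add_smul, Finset.sum_sub_distrib,
    Finset.sum_add_distrib, if_true]
  simp [ite_and, ite_smul, zero_smul]

theorem sum_zeroWeightR_mul (s : K) (v : Fin N) (c : Fin N → K) :
    ∑ u, zeroWeightR s v u * c u = qWeight (s ^ 2) v v.rev * c v.rev +
      (if v < v.rev then s ^ 2 - (s ^ 2)⁻¹ else 0) * c v -
      (s ^ 2 - (s ^ 2)⁻¹) * qNegRho s v * ∑ u, if u < v.rev then qNegRho s u * c u else 0 := by
  refine (Finset.sum_congr rfl fun u _ => by rw [zeroWeightR_comm s v u]).trans ?_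
  simp only [zeroWeightR, sub_mul, add_mul, Finset.sum_sub_distrib,
    Finset.sum_add_distrib, ite_and, ite_mul, zero_mul, Finset.mul_sum, mul_ite, mul_zero]
  simp [mul_assoc]

theorem sum_zeroWeightR_mul_qNegRho {s : K} (hs : s ≠ 0) (v : Fin N) :
    ∑ u, zeroWeightR s v u * qNegRho s u = (s ^ 2) ^ (1 - (N : ℤ)) * qNegRho s v := by
  have hx := qNegRho_ne_zero hs v
  have hsum := sum_qNegRho_mul_self hs v.rev
  rw [Fin.rev_rev, qNegRho_rev, qWeight_comm] at hsum
  rw [sum_zeroWeightR_mul, mul_right_comm, hsum, qNegRho_rev]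
  field_simp
  ring

theorem zeroWeightR_rev_left {v z : Fin N} (h : v ≤ z) (s : K) :
    zeroWeightR s v.rev z = if v = z then qWeight (s ^ 2) z z.rev else 0 := by
  have hlt : ¬v.rev < z.rev := by rwa [Fin.rev_lt_rev, not_lt]
  have hcross : ¬(v.rev = z ∧ z < z.rev) := fun h' => hlt (h'.1 ▸ h'.2)
  simp only [zeroWeightR, if_neg hlt, if_neg hcross, Fin.rev_inj, add_zero, sub_zero]

theorem zeroWeightR_of_rev_le {v z : Fin N} (hvz : v ≤ z) (hv : v.rev ≤ v) (s : K) :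
    zeroWeightR s v z = if v = z ∧ v = v.rev then 1 else 0 := by
  have hzv : z.rev ≤ v.rev := Fin.rev_le_rev.mpr hvz
  have heq : v = z.rev ↔ v = z ∧ v = v.rev := by grind
  simp only [zeroWeightR, qWeight_rev_self, heq]
  grind

theorem sum_lt_rev_zeroWeightR {s : K} (hs : s ≠ 0) {v z : Fin N} (h : v ≤ z) :
    ∑ u, (if u < v.rev then qNegRho s u * zeroWeightR s u z else 0) =
      (s ^ 2) ^ (1 - (N : ℤ)) * qNegRho s z -
        if v = z then qWeight (s ^ 2) z z.rev * (qNegRho s z)⁻¹ else 0 := by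
  have hzv : z.rev ≤ v.rev := Fin.rev_le_rev.mpr h
  have hterm (u : Fin N) : (if u < v.rev then qNegRho s u * zeroWeightR s u z else 0) =
      zeroWeightR s z u * qNegRho s u -
        if u = z.rev then if v = z then qWeight (s ^ 2) z z.rev * qNegRho s u else 0 else 0 := by
    rw [zeroWeightR_comm s z]
    by_cases hu : u < v.rev
    · grind
    · simp only [zeroWeightR]
      have : v = z ↔ z.rev = v.rev := by rw [Fin.rev_inj, eq_comm]
      grind
  simp only [hterm, Finset.sum_sub_distrib, sum_zeroWeightR_mul_qNegRho hs, Finset.sum_ite_eq',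
    Finset.mem_univ, if_true, qNegRho_rev]

theorem sum_zeroWeightR_mul_self_of_le {s : K} (hs : s ≠ 0) {v z : Fin N} (hvz : v ≤ z) :
    ∑ u, zeroWeightR s v u * zeroWeightR s u z = (if v = z then 1 else 0) +
      (s ^ 2 - (s ^ 2)⁻¹) * zeroWeightR s v z -
        (s ^ 2 - (s ^ 2)⁻¹) * (s ^ 2) ^ (1 - (N : ℤ)) * (qNegRho s v * qNegRho s z) := by
  have hx := qNegRho_ne_zero hs z
  rw [sum_zeroWeightR_mul, sum_lt_rev_zeroWeightR hs hvz, zeroWeightR_rev_left hvz]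
  simp only [qWeight_rev_self]
  by_cases hv : v < v.rev
  · rcases eq_or_ne v z with rfl | h
    · simp only [hv, hv.ne, if_true, if_false]
      field_simp
      ring
    · simp only [hv, h, if_true, if_false]
      ring
  · rw [zeroWeightR_of_rev_le hvz (not_lt.mp hv)]
    rcases eq_or_ne v z with rfl | h
    · by_cases hrev : v = v.rev
      · simp only [← hrev, true_and, if_true, if_false, lt_irrefl]
        field_simp
        ring
      · simp only [hv, hrev, and_false, if_true, if_false]
        field_simp
        ring
    · simp only [hv, h, false_and, if_false]
      ring

theorem sum_zeroWeightR_mul_self {s : K} (hs : s ≠ 0) (v z : Fin N) :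
    ∑ u, zeroWeightR s v u * zeroWeightR s u z = (if v = z then 1 else 0) +
      (s ^ 2 - (s ^ 2)⁻¹) * zeroWeightR s v z -
        (s ^ 2 - (s ^ 2)⁻¹) * (s ^ 2) ^ (1 - (N : ℤ)) * (qNegRho s v * qNegRho s z) := by
  rcases le_total v z with h | h
  · exact sum_zeroWeightR_mul_self_of_le hs h
  · rw [zeroWeightR_comm s v z, mul_comm (qNegRho s v)]
    simp only [eq_comm (a := v)]
    rw [← sum_zeroWeightR_mul_self_of_le hs h]
    refine Finset.sum_congr rfl fun u _ => ?_
    rw [zeroWeightR_comm s v, zeroWeightR_comm s u z, mul_comm]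

theorem columnSum_soR_of_ne_rev {V : Type*} [AddCommGroup V] [Module K V] {s : K} (hs : s ≠ 0)
    {a b : Fin N} (h : b ≠ a.rev) (f : Fin N → Fin N → V) : columnSum (soR s) a b f =
      (if a = b then s ^ 2 else 1) • f b a +
        (if a < b then s ^ 2 - (s ^ 2)⁻¹ else 0) • f a b := by
  rw [columnSum_soR hs, if_neg h, sub_zero, qWeight_of_ne_rev _ h]

theorem soR_mul_self {s : K} (hs : s ≠ 0) : (soR s * soR s : Mat2 K N) =
    1 + (s ^ 2 - (s ^ 2)⁻¹) • soR s -
      ((s ^ 2 - (s ^ 2)⁻¹) * (s ^ 2) ^ (1 - (N : ℤ))) • soE s := by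
  refine mat2_ext fun a b f => ?_
  simp only [columnSum_mul, columnSum_add, columnSum_sub, columnSum_smul, columnSum_one]
  by_cases h : b = a.rev
  · rw [h, columnSum_soR_rev hs, columnSum_soR_rev hs, columnSum_soE, if_pos rfl]
    simp only [columnSum_soR_rev hs, Finset.smul_sum, smul_smul]
    rw [Finset.sum_comm]
    simp only [mul_comm (zeroWeightR s _ a), ← Finset.sum_smul, sum_zeroWeightR_mul_self hs,
      sub_smul, add_smul, Finset.sum_sub_distrib, Finset.sum_add_distrib, ite_smul, one_smul,
      zero_smul, Finset.sum_ite_eq', Finset.mem_univ, if_true, mul_comm (qNegRho s a)]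
  · have hrev : a ≠ b.rev := fun h' => h (Fin.rev_eq_iff.mpr h').symm
    rw [columnSum_soE, if_neg h]
    simp only [columnSum_soR_of_ne_rev hs h, columnSum_soR_of_ne_rev hs hrev, smul_zero, sub_zero]
    exact hecke_quadratic (pow_ne_zero 2 hs) a b f

theorem soR_mul_soE {s : K} (hs : s ≠ 0) :
    (soR s * soE s : Mat2 K N) = (s ^ 2) ^ (1 - (N : ℤ)) • soE s := by
  refine mat2_ext fun a b f => ?_
  simp only [columnSum_mul, columnSum_smul, columnSum_soE]
  split_ifs with h
  · simp only [columnSum_soR_rev hs, Finset.smul_sum, smul_smul]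
    rw [Finset.sum_comm]
    refine Finset.sum_congr rfl fun v _ => ?_
    rw [← Finset.sum_smul, mul_left_comm, ← sum_zeroWeightR_mul_qNegRho hs, Finset.mul_sum]
    exact congrArg (· • _) (Finset.sum_congr rfl fun u _ => by ring)
  · rw [smul_zero]

end ZeroWeight

/-! ### The relations between neighbouring sites for `U_q so(N)` -/

section OrthogonalTriple

variable {K : Type*} [Field K] {N : ℕ} {s : K} {L : Finset (Fin N)}

/-- The vector `∑ u ∈ L, q^{-ρ_u} (u, -u, y)`. For `L = univ` these vectors span the image of
`E₁₂`; the sets `L = Iio w` occur in the action of `R̂`. -/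
def cupFirst (s : K) (L : Finset (Fin N)) (y : Fin N) : (Fin 3 → Fin N) → K :=
  ∑ u ∈ L, qNegRho s u • basis3 K u u.rev y

/-- The vector `∑ u ∈ L, q^{-ρ_u} (y, u, -u)`, the counterpart of `cupFirst` for the last two
tensor factors. -/
def cupLast (s : K) (L : Finset (Fin N)) (y : Fin N) : (Fin 3 → Fin N) → K :=
  ∑ u ∈ L, qNegRho s u • basis3 K y u u.rev

theorem actFirst_soE_basis3 (s : K) (a b c : Fin N) : actFirst (soE s) (basis3 K a b c) =
    if b = a.rev then qNegRho s a • cupFirst s Finset.univ c else 0 := by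
  rw [actFirst_basis3, columnSum_soE, cupFirst, Finset.smul_sum]
  simp only [smul_smul]

theorem actLast_soE_basis3 (s : K) (a b c : Fin N) : actLast (soE s) (basis3 K a b c) =
    if c = b.rev then qNegRho s b • cupLast s Finset.univ a else 0 := by
  rw [actLast_basis3, columnSum_soE, cupLast, Finset.smul_sum]
  simp only [smul_smul]

theorem actLast_soE_cupFirst (hs : s ≠ 0) (y : Fin N) :
    actLast (soE s) (cupFirst s Finset.univ y) = cupLast s Finset.univ y := by
  simp only [cupFirst, map_sum, map_smul, actLast_soE_basis3, Fin.rev_rev, smul_ite, smul_zero,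
    Finset.sum_ite_eq, Finset.mem_univ, if_true, qNegRho_rev, smul_smul]
  rw [mul_inv_cancel₀ (qNegRho_ne_zero hs y), one_smul]

theorem actFirst_soE_cupLast (hs : s ≠ 0) (y : Fin N) :
    actFirst (soE s) (cupLast s Finset.univ y) = cupFirst s Finset.univ y := by
  simp only [cupLast, map_sum, map_smul, actFirst_soE_basis3, smul_ite, smul_zero,
    Finset.sum_ite_eq', Finset.mem_univ, if_true, qNegRho_rev, smul_smul]
  rw [inv_mul_cancel₀ (qNegRho_ne_zero hs y), one_smul, Fin.rev_rev]

theorem actFirst_soR_basis3 (hs : s ≠ 0) (a b c : Fin N) :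
    actFirst (soR s) (basis3 K a b c) = qWeight (s ^ 2) a b • basis3 K b a c +
      (if a < b then s ^ 2 - (s ^ 2)⁻¹ else 0) • basis3 K a b c -
      if b = a.rev then ((s ^ 2 - (s ^ 2)⁻¹) * qNegRho s a) • cupFirst s (Finset.Iio a.rev) c
      else 0 := by
  rw [actFirst_basis3, columnSum_soR hs, cupFirst, Finset.smul_sum, ← Finset.filter_gt_eq_Iio,
    Finset.sum_filter]
  simp only [ite_smul, zero_smul, smul_smul, mul_assoc]

theorem actLast_soR_basis3 (hs : s ≠ 0) (a b c : Fin N) :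
    actLast (soR s) (basis3 K a b c) = qWeight (s ^ 2) b c • basis3 K a c b +
      (if b < c then s ^ 2 - (s ^ 2)⁻¹ else 0) • basis3 K a b c -
      if c = b.rev then ((s ^ 2 - (s ^ 2)⁻¹) * qNegRho s b) • cupLast s (Finset.Iio b.rev) a
      else 0 := by
  rw [actLast_basis3, columnSum_soR hs, cupLast, Finset.smul_sum, ← Finset.filter_gt_eq_Iio,
    Finset.sum_filter]
  simp only [ite_smul, zero_smul, smul_smul, mul_assoc]

theorem sum_mul_ite_le_smul_of_isLowerSet {V : Type*} [AddCommGroup V] [Module K V]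
    (hL : IsLowerSet (L : Set (Fin N))) (w : Fin N) (k : K) (c : Fin N → K) (B : Fin N → V) :
    ∑ u ∈ L, (c u * if w ≤ u then k else 0) • B u =
      (if w ∈ L then k else 0) • ∑ u ∈ L, c u • B u -
        if w ∈ L then k • ∑ u ∈ Finset.Iio w, c u • B u else 0 := by
  split_ifs with hw
  · have hsub : Finset.Iio w ⊆ L := fun u hu => hL (Finset.mem_Iio.mp hu).le hw
    have hfilter : L.filter (w ≤ ·) = L \ Finset.Iio w := by
      ext u
      simp only [Finset.mem_filter, Finset.mem_sdiff, Finset.mem_Iio, not_lt]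
    rw [← smul_sub, ← Finset.sum_sdiff_eq_sub hsub, ← hfilter, Finset.sum_filter, Finset.smul_sum]
    refine Finset.sum_congr rfl fun u _ => ?_
    split_ifs
    · rw [smul_smul, mul_comm]
    · rw [mul_zero, zero_smul, smul_zero]
  · rw [zero_smul, sub_zero]
    exact Finset.sum_eq_zero fun u hu => by
      rw [if_neg fun hwu => hw (hL hwu hu), mul_zero, zero_smul]

theorem qNegRho_mul_mul_rev (hs : s ≠ 0) (k : K) (y : Fin N) :
    qNegRho s y * (k * qNegRho s y.rev) = k := by
  rw [mul_left_comm, qNegRho_rev, mul_inv_cancel₀ (qNegRho_ne_zero hs y), mul_one]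

theorem actLast_soR_cupFirst (hs : s ≠ 0) (hL : IsLowerSet (L : Set (Fin N))) (y : Fin N) :
    actLast (soR s) (cupFirst s L y) +
        (if y ∈ L then s ^ 2 - (s ^ 2)⁻¹ else 0) • cupLast s L y =
      ∑ u ∈ L, qNegRho s u • (qWeight (s ^ 2) u.rev y • basis3 K u y u.rev +
        (if u.rev < y then s ^ 2 - (s ^ 2)⁻¹ else 0) • basis3 K u u.rev y +
        (if y ≤ u then s ^ 2 - (s ^ 2)⁻¹ else 0) • basis3 K y u u.rev) := by
  simp only [cupFirst, map_sum, map_smul, actLast_soR_basis3 hs, smul_sub, smul_add, Fin.rev_rev,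
    Finset.sum_sub_distrib, Finset.sum_add_distrib, smul_ite, smul_zero, Finset.sum_ite_eq,
    smul_smul, qNegRho_mul_mul_rev hs]
  rw [sub_add_eq_add_sub, add_sub_assoc, sum_mul_ite_le_smul_of_isLowerSet hL]
  rfl

theorem actFirst_soR_cupLast (hs : s ≠ 0) (hL : IsLowerSet (L : Set (Fin N))) (y : Fin N) :
    actFirst (soR s) (cupLast s L y) +
        (if y.rev ∈ L then s ^ 2 - (s ^ 2)⁻¹ else 0) • cupFirst s L y =
      ∑ u ∈ L, qNegRho s u • (qWeight (s ^ 2) y u • basis3 K u y u.rev +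
        (if y < u then s ^ 2 - (s ^ 2)⁻¹ else 0) • basis3 K y u u.rev +
        (if y.rev ≤ u then s ^ 2 - (s ^ 2)⁻¹ else 0) • basis3 K u u.rev y) := by
  have hcoeff := qNegRho_mul_mul_rev hs (s ^ 2 - (s ^ 2)⁻¹) y.rev
  rw [Fin.rev_rev] at hcoeff
  simp only [cupLast, map_sum, map_smul, actFirst_soR_basis3 hs, smul_sub, smul_add,
    Finset.sum_sub_distrib, Finset.sum_add_distrib, smul_ite, smul_zero, Finset.sum_ite_eq',
    smul_smul, hcoeff, Fin.rev_rev]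
  rw [sub_add_eq_add_sub, add_sub_assoc, sum_mul_ite_le_smul_of_isLowerSet hL]
  rfl

theorem qWeight_slide {V : Type*} [AddCommGroup V] [Module K V] (q : K) {y u : Fin N} {A B C : V}
    (hC : u = y → A = C) (hB : u = y.rev → A = B) :
    qWeight q u.rev y • A + (if u.rev < y then q - q⁻¹ else 0) • B +
        (if y ≤ u then q - q⁻¹ else 0) • C =
      qWeight q y u • A + (if y < u then q - q⁻¹ else 0) • C +
        (if y.rev ≤ u then q - q⁻¹ else 0) • B := by
  have hlt : u.rev < y ↔ y.rev < u := Fin.rev_lt_iff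
  simp only [qWeight_rev_left, qWeight_comm q y u, hlt]
  rcases eq_or_ne u y.rev with hy' | hy' <;> rcases eq_or_ne u y with rfl | hy
  · rw [← hC rfl, ← hB hy']
    simp only [qWeight, ← hy', if_true, inv_one, lt_irrefl, le_refl]
  · rw [← hB hy', qWeight_comm, hy', qWeight_rev_self, if_neg (hy' ▸ hy.symm), ← hy', inv_inv]
    simp only [lt_irrefl, le_refl, if_true, if_false, hy.symm.le_iff_lt]
    module
  · rw [← hC rfl, qWeight_of_ne_rev q hy']
    simp only [lt_irrefl, le_refl, if_true, if_false, hy'.symm.le_iff_lt]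
    module
  · have hrev : y ≠ u.rev := fun h => hy' (Fin.rev_eq_iff.mpr h).symm
    simp only [qWeight_of_ne_rev q hrev, if_neg hy, inv_one, hy.symm.le_iff_lt,
      hy'.symm.le_iff_lt]
    abel

theorem soR_slide_cup (hs : s ≠ 0) (hL : IsLowerSet (L : Set (Fin N))) (y : Fin N) :
    actLast (soR s) (cupFirst s L y) +
        (if y ∈ L then s ^ 2 - (s ^ 2)⁻¹ else 0) • cupLast s L y =
      actFirst (soR s) (cupLast s L y) +
        (if y.rev ∈ L then s ^ 2 - (s ^ 2)⁻¹ else 0) • cupFirst s L y := by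
  rw [actLast_soR_cupFirst hs hL, actFirst_soR_cupLast hs hL]
  refine Finset.sum_congr rfl fun u _ => ?_
  rw [qWeight_slide]
  · rintro rfl
    rfl
  · rintro rfl
    rw [Fin.rev_rev]

theorem soR_slide_cup_univ (hs : s ≠ 0) (y : Fin N) :
    actLast (soR s) (cupFirst s Finset.univ y) + (s ^ 2 - (s ^ 2)⁻¹) • cupLast s Finset.univ y =
      actFirst (soR s) (cupLast s Finset.univ y) +
        (s ^ 2 - (s ^ 2)⁻¹) • cupFirst s Finset.univ y := by
  simpa only [Finset.mem_univ, if_true] using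
    soR_slide_cup hs (L := Finset.univ) (fun _ _ _ _ => Finset.mem_coe.mpr (Finset.mem_univ _)) y

theorem BMWCrossing.slide_of_linear {𝒜 : Type*} [Ring 𝒜] [Algebra K 𝒜] {k t : K} {σ e σ' e' : 𝒜}
    (h : BMWCrossing k t σ e) (hlin : σ' * e + k • (e' * e) = σ * (e' * e) + k • e)
    (hzig : e * e' * e = e) : σ * σ' * e = e' * e := by
  have hσ' : σ' * e = σ * (e' * e) + k • e - k • (e' * e) := by rw [← hlin, add_sub_cancel_right]
  rw [mul_assoc, hσ', mul_sub, mul_add, ← mul_assoc, h.skein, mul_smul_comm, mul_smul_comm,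
    h.twist, sub_mul, add_mul, one_mul, smul_mul_assoc, smul_mul_assoc, ← mul_assoc e, hzig]
  module

theorem soE_zigzag_first (hs : s ≠ 0) :
    (atSite (soE s) 0 (by omega) * atSite (soE s) 1 (by omega) * atSite (soE s) 0 (by omega) :
      TMat K N 3) = atSite (soE s) 0 (by omega) := by
  refine tmat3_ext fun a b c => ?_
  simp only [← Matrix.mulVec_mulVec, atSite_zero_mulVec, atSite_one_mulVec, actFirst_soE_basis3]
  split_ifs
  · simp only [map_smul, actLast_soE_cupFirst hs, actFirst_soE_cupLast hs]
  · simp only [map_zero]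

theorem soE_zigzag_last (hs : s ≠ 0) :
    (atSite (soE s) 1 (by omega) * atSite (soE s) 0 (by omega) * atSite (soE s) 1 (by omega) :
      TMat K N 3) = atSite (soE s) 1 (by omega) := by
  refine tmat3_ext fun a b c => ?_
  simp only [← Matrix.mulVec_mulVec, atSite_zero_mulVec, atSite_one_mulVec, actLast_soE_basis3]
  split_ifs
  · simp only [map_smul, actLast_soE_cupFirst hs, actFirst_soE_cupLast hs]
  · simp only [map_zero]

theorem soR_crossing (hs : s ≠ 0) : BMWCrossing (s ^ 2 - (s ^ 2)⁻¹) ((s ^ 2) ^ (1 - (N : ℤ)))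
    (soR s : Mat2 K N) (soE s) :=
  ⟨soR_mul_self hs, soR_mul_soE hs⟩

theorem soR_slide_first (hs : s ≠ 0) :
    (atSite (soR s) 0 (by omega) * atSite (soR s) 1 (by omega) * atSite (soE s) 0 (by omega) :
      TMat K N 3) = atSite (soE s) 1 (by omega) * atSite (soE s) 0 (by omega) := by
  refine ((soR_crossing hs).map (atSiteHom K N _)).slide_of_linear ?_ (soE_zigzag_first hs)
  refine tmat3_ext fun a b c => ?_
  simp only [atSiteHom_apply, Matrix.add_mulVec, Matrix.smul_mulVec, ← Matrix.mulVec_mulVec,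
    atSite_zero_mulVec, atSite_one_mulVec, actFirst_soE_basis3]
  split_ifs
  · simp only [map_smul, actLast_soE_cupFirst hs]
    rw [smul_comm _ (qNegRho s a), smul_comm _ (qNegRho s a), ← smul_add, ← smul_add,
      soR_slide_cup_univ hs]
  · simp only [map_zero]

theorem soR_slide_last (hs : s ≠ 0) :
    (atSite (soR s) 1 (by omega) * atSite (soR s) 0 (by omega) * atSite (soE s) 1 (by omega) :
      TMat K N 3) = atSite (soE s) 0 (by omega) * atSite (soE s) 1 (by omega) := by
  refine ((soR_crossing hs).map (atSiteHom K N _)).slide_of_linear ?_ (soE_zigzag_last hs)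
  refine tmat3_ext fun a b c => ?_
  simp only [atSiteHom_apply, Matrix.add_mulVec, Matrix.smul_mulVec, ← Matrix.mulVec_mulVec,
    atSite_zero_mulVec, atSite_one_mulVec, actLast_soE_basis3]
  split_ifs
  · simp only [map_smul, actFirst_soE_cupLast hs]
    rw [smul_comm _ (qNegRho s b), smul_comm _ (qNegRho s b), ← smul_add, ← smul_add,
      soR_slide_cup_univ hs]
  · simp only [map_zero]

theorem transpose_soE : (soE s : Mat2 K N).transpose = soE s := by
  ext ⟨a, b⟩ ⟨c, d⟩
  rw [Matrix.transpose_apply, soE_apply, soE_apply]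
  grind

theorem soR_slide_first_right (hs : s ≠ 0) :
    (atSite (soE s) 0 (by omega) * atSite (soR s) 1 (by omega) * atSite (soR s) 0 (by omega) :
      TMat K N 3) = atSite (soE s) 0 (by omega) * atSite (soE s) 1 (by omega) := by
  have := congrArg Matrix.transpose (soR_slide_first (N := N) hs)
  simpa only [Matrix.transpose_mul, atSite_transpose, transpose_soR hs, transpose_soE,
    ← mul_assoc] using this

theorem soR_slide_last_right (hs : s ≠ 0) :
    (atSite (soE s) 1 (by omega) * atSite (soR s) 0 (by omega) * atSite (soR s) 1 (by omega) :
      TMat K N 3) = atSite (soE s) 1 (by omega) * atSite (soE s) 0 (by omega) := by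
  have := congrArg Matrix.transpose (soR_slide_last (N := N) hs)
  simpa only [Matrix.transpose_mul, atSite_transpose, transpose_soR hs, transpose_soE,
    ← mul_assoc] using this

end OrthogonalTriple

section OrthogonalBraid

variable {K : Type*} [Field K] {N : ℕ} {s : K}

theorem actFirst_soR_basis3_of_ne_rev (hs : s ≠ 0) {a b : Fin N} (h : b ≠ a.rev) (c : Fin N) :
    actFirst (soR s) (basis3 K a b c) = (if a = b then s ^ 2 else 1) • basis3 K b a c +
      (if a < b then s ^ 2 - (s ^ 2)⁻¹ else 0) • basis3 K a b c := by
  rw [actFirst_basis3, columnSum_soR_of_ne_rev hs h]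

theorem actLast_soR_basis3_of_ne_rev (hs : s ≠ 0) (a : Fin N) {b c : Fin N} (h : c ≠ b.rev) :
    actLast (soR s) (basis3 K a b c) = (if b = c then s ^ 2 else 1) • basis3 K a c b +
      (if b < c then s ^ 2 - (s ^ 2)⁻¹ else 0) • basis3 K a b c := by
  rw [actLast_basis3, columnSum_soR_of_ne_rev hs h]

theorem soR_braid_of_ne_rev (hs : s ≠ 0) {a b c : Fin N} (hab : b ≠ a.rev) (hbc : c ≠ b.rev)
    (hac : c ≠ a.rev) :
    actLast (soR s) (actFirst (soR s) (actLast (soR s) (basis3 K a b c))) =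
      actFirst (soR s) (actLast (soR s) (actFirst (soR s) (basis3 K a b c))) := by
  have hsymm : ∀ {u v : Fin N}, v ≠ u.rev → u ≠ v.rev := fun h h' =>
    h (Fin.rev_eq_iff.mpr h').symm
  refine hecke_braid (pow_ne_zero 2 hs) (B := basis3 K)
    (p := fun a b c => b ≠ a.rev ∧ c ≠ b.rev ∧ c ≠ a.rev) ?_ ?_ ⟨hab, hbc, hac⟩
  · rintro a b c ⟨hab, hbc, hac⟩
    exact ⟨⟨hsymm hab, hac, hbc⟩, actFirst_soR_basis3_of_ne_rev hs hab c⟩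
  · rintro a b c ⟨hab, hbc, hac⟩
    exact ⟨⟨hac, hsymm hbc, hab⟩, actLast_soR_basis3_of_ne_rev hs a hbc⟩

theorem actFirst_soR_basis3_of_ne (hs : s ≠ 0) {a b : Fin N} (hab : a ≠ b) (h : b ≠ a.rev)
    (c : Fin N) : actFirst (soR s) (basis3 K a b c) = basis3 K b a c +
      (if a < b then s ^ 2 - (s ^ 2)⁻¹ else 0) • basis3 K a b c := by
  rw [actFirst_soR_basis3_of_ne_rev hs h, if_neg hab, one_smul]

theorem actLast_soR_basis3_of_ne (hs : s ≠ 0) (a : Fin N) {b c : Fin N} (hbc : b ≠ c)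
    (h : c ≠ b.rev) : actLast (soR s) (basis3 K a b c) = basis3 K a c b +
      (if b < c then s ^ 2 - (s ^ 2)⁻¹ else 0) • basis3 K a b c := by
  rw [actLast_soR_basis3_of_ne_rev hs a h, if_neg hbc, one_smul]

theorem soR_braid_mid (hs : s ≠ 0) {y z : Fin N} (h : z ≠ y) (h' : z ≠ y.rev) :
    actLast (soR s) (actFirst (soR s) (actLast (soR s) (basis3 K z y z.rev))) =
      actFirst (soR s) (actLast (soR s) (actFirst (soR s) (basis3 K z y z.rev))) := by
  have hrev : z.rev ≠ y := fun hz => h' (Fin.rev_eq_iff.mp hz)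
  have hrev' : z.rev ≠ y.rev := fun hz => h (Fin.rev_inj.mp hz)
  have hcup := soR_slide_cup hs (L := Finset.Iio z.rev)
    (by rw [Finset.coe_Iio]; exact isLowerSet_Iio _) y
  simp only [Finset.mem_Iio, Fin.rev_lt_rev] at hcup
  have first_pair := actFirst_soR_basis3 hs z z.rev y
  have last_pair := actLast_soR_basis3 hs y z z.rev
  rw [if_pos rfl] at first_pair last_pair
  simp only [actFirst_soR_basis3_of_ne hs, actLast_soR_basis3_of_ne hs, h, h.symm, h', hrev,
    hrev.symm, hrev', Fin.rev_rev, ne_eq, not_false_eq_true, map_add, map_sub, map_smul, first_pair,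
    last_pair]
  clear first_pair last_pair
  rcases lt_or_gt_of_ne h with hzy | hzy <;> rcases lt_or_gt_of_ne hrev with hwy | hwy <;>
    by_cases hzw : z < z.rev <;>
    first
    | (exfalso; order)
    | (simp only [hzy, hwy, hzw, not_lt_of_gt hzy, not_lt_of_gt hwy, if_true, if_false] at hcup ⊢
       linear_combination (norm := module) (-((s ^ 2 - (s ^ 2)⁻¹) * qNegRho s z)) • hcup)

end OrthogonalBraid

section BraidDefect

variable {K : Type*} [Field K] {𝒜 : Type*} [Ring 𝒜] [Algebra K 𝒜] {k t : K} {σ e σ' e' : 𝒜}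

/-- The defect of the braid relation for `σ` and `σ'`. -/
def braidDefect (σ σ' : 𝒜) : 𝒜 := σ * σ' * σ - σ' * σ * σ'

theorem braidDefect_swap (σ σ' : 𝒜) : braidDefect σ' σ = -braidDefect σ σ' := by
  rw [braidDefect, braidDefect, neg_sub]

theorem BMWCrossing.braidDefect_mul (h : BMWCrossing k t σ e) (h' : BMWCrossing k t σ' e')
    (hslide : σ * σ' * e = e' * e) (hslide' : e' * σ * σ' = e' * e) :
    braidDefect σ σ' * σ = k • braidDefect σ σ' - σ' * braidDefect σ σ' := by
  have hleft : σ * σ' * σ * σ = σ * σ' + k • (σ * σ' * σ) - (k * t) • (e' * e) := by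
    rw [mul_assoc _ σ σ, h.skein, mul_sub, mul_add, mul_one, mul_smul_comm, mul_smul_comm, hslide]
  have hright : σ' * (σ' * σ * σ') = σ * σ' + k • (σ' * σ * σ') - (k * t) • (e' * e) := by
    rw [← mul_assoc, ← mul_assoc, h'.skein, ← hslide']
    simp only [sub_mul, add_mul, one_mul, smul_mul_assoc]
  rw [braidDefect, sub_mul, mul_sub, hleft, hright, mul_assoc σ', mul_assoc σ']
  module

theorem BMWCrossing.braidDefect_mul_cup (h : BMWCrossing k t σ e) (h' : BMWCrossing k t σ' e')
    (hslide : σ * σ' * e = e' * e) : braidDefect σ σ' * e = 0 := by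
  have hright : σ' * σ * σ' * e = t • (e' * e) := by
    rw [mul_assoc, mul_assoc, ← mul_assoc σ, hslide, ← mul_assoc, h'.twist, smul_mul_assoc]
  rw [braidDefect, sub_mul, hright, mul_assoc _ σ, h.twist, mul_smul_comm, hslide, sub_self]

end BraidDefect

section OrthogonalDefect

variable {K : Type*} [Field K] {N : ℕ} {s : K}

/-- The defect of the braid relation for `R̂₁₂` and `R̂₂₃` in the case `U_q so(N)`. -/
def soDefect (s : K) : TMat K N 3 :=
  braidDefect (atSite (soR s) 0 (by omega)) (atSite (soR s) 1 (by omega))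

theorem soDefect_mulVec (s : K) (v : (Fin 3 → Fin N) → K) : (soDefect s).mulVec v =
    actFirst (soR s) (actLast (soR s) (actFirst (soR s) v)) -
      actLast (soR s) (actFirst (soR s) (actLast (soR s) v)) := by
  simp only [soDefect, braidDefect, Matrix.sub_mulVec, ← Matrix.mulVec_mulVec,
    atSite_zero_mulVec, atSite_one_mulVec]

theorem transpose_soDefect (hs : s ≠ 0) :
    (soDefect s : TMat K N 3).transpose = soDefect s := by
  simp only [soDefect, braidDefect, Matrix.transpose_sub, Matrix.transpose_mul, atSite_transpose,
    transpose_soR hs, mul_assoc]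

theorem soDefect_mul_first (hs : s ≠ 0) : soDefect s * atSite (soR s) 0 (by omega) =
    (s ^ 2 - (s ^ 2)⁻¹) • soDefect s - atSite (soR s) 1 (by omega) * (soDefect s : TMat K N 3) :=
  ((soR_crossing hs).map (atSiteHom K N _)).braidDefect_mul
    ((soR_crossing hs).map (atSiteHom K N _)) (soR_slide_first hs) (soR_slide_last_right hs)

theorem soDefect_mul_last (hs : s ≠ 0) : soDefect s * atSite (soR s) 1 (by omega) =
    (s ^ 2 - (s ^ 2)⁻¹) • soDefect s - atSite (soR s) 0 (by omega) * (soDefect s : TMat K N 3) := by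
  have h := ((soR_crossing (N := N) hs).map (atSiteHom K N (by omega : 1 + 1 < 3))).braidDefect_mul
    ((soR_crossing hs).map (atSiteHom K N _)) (soR_slide_last hs) (soR_slide_first_right hs)
  rw [braidDefect_swap, neg_mul, smul_neg, mul_neg, ← neg_sub', neg_inj] at h
  exact h

theorem soDefect_mul_soE_first (hs : s ≠ 0) :
    soDefect s * (atSite (soE s) 0 (by omega) : TMat K N 3) = 0 :=
  ((soR_crossing hs).map (atSiteHom K N _)).braidDefect_mul_cup
    ((soR_crossing hs).map (atSiteHom K N _)) (soR_slide_first hs)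

theorem soDefect_mul_soE_last (hs : s ≠ 0) :
    soDefect s * (atSite (soE s) 1 (by omega) : TMat K N 3) = 0 := by
  have h := ((soR_crossing (N := N) hs).map (atSiteHom K N _)).braidDefect_mul_cup
    ((soR_crossing hs).map (atSiteHom K N _)) (soR_slide_last hs)
  rwa [braidDefect_swap, neg_mul, neg_eq_zero] at h

theorem soDefect_actFirst (hs : s ≠ 0) {v : (Fin 3 → Fin N) → K}
    (hv : (soDefect s).mulVec v = 0) : (soDefect s).mulVec (actFirst (soR s) v) = 0 := by
  rw [← atSite_zero_mulVec, Matrix.mulVec_mulVec, soDefect_mul_first hs, Matrix.sub_mulVec,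
    Matrix.smul_mulVec, ← Matrix.mulVec_mulVec, hv, smul_zero, Matrix.mulVec_zero, sub_zero]

theorem soDefect_actLast (hs : s ≠ 0) {v : (Fin 3 → Fin N) → K}
    (hv : (soDefect s).mulVec v = 0) : (soDefect s).mulVec (actLast (soR s) v) = 0 := by
  rw [← atSite_one_mulVec, Matrix.mulVec_mulVec, soDefect_mul_last hs, Matrix.sub_mulVec,
    Matrix.smul_mulVec, ← Matrix.mulVec_mulVec, hv, smul_zero, Matrix.mulVec_zero, sub_zero]

theorem soDefect_cupFirst (hs : s ≠ 0) (y : Fin N) :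
    (soDefect s).mulVec (cupFirst s Finset.univ y) = 0 := by
  have h : (soDefect s).mulVec (actFirst (soE s) (basis3 K y y.rev y)) = 0 := by
    rw [← atSite_zero_mulVec, Matrix.mulVec_mulVec, soDefect_mul_soE_first hs, Matrix.zero_mulVec]
  rw [actFirst_soE_basis3, if_pos rfl, Matrix.mulVec_smul] at h
  exact (smul_eq_zero.mp h).resolve_left (qNegRho_ne_zero hs y)

theorem soDefect_cupLast (hs : s ≠ 0) (y : Fin N) :
    (soDefect s).mulVec (cupLast s Finset.univ y) = 0 := by
  have h : (soDefect s).mulVec (actLast (soE s) (basis3 K y y y.rev)) = 0 := by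
    rw [← atSite_one_mulVec, Matrix.mulVec_mulVec, soDefect_mul_soE_last hs, Matrix.zero_mulVec]
  rw [actLast_soE_basis3, if_pos rfl, Matrix.mulVec_smul] at h
  exact (smul_eq_zero.mp h).resolve_left (qNegRho_ne_zero hs y)

theorem soDefect_basis3_mid (hs : s ≠ 0) {y z : Fin N} (h : z ≠ y) (h' : z ≠ y.rev) :
    (soDefect s).mulVec (basis3 K z y z.rev) = 0 := by
  rw [soDefect_mulVec, soR_braid_mid hs h h', sub_self]

theorem soDefect_basis3_first (hs : s ≠ 0) {y z : Fin N} (h : z ≠ y) (h' : z ≠ y.rev) :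
    (soDefect s).mulVec (basis3 K z z.rev y) = 0 := by
  have hmid := soDefect_basis3_mid hs h h'
  have hact := soDefect_actLast hs hmid
  rwa [actLast_soR_basis3_of_ne hs z (fun hz => h' (Fin.rev_eq_iff.mp hz.symm))
    (fun hz => h (Fin.rev_inj.mp hz)), Matrix.mulVec_add, Matrix.mulVec_smul, hmid, smul_zero,
    add_zero] at hact

theorem soDefect_basis3_last (hs : s ≠ 0) {y z : Fin N} (h : z ≠ y) (h' : z ≠ y.rev) :
    (soDefect s).mulVec (basis3 K y z z.rev) = 0 := by
  have hmid := soDefect_basis3_mid hs h h'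
  have hact := soDefect_actFirst hs hmid
  rwa [actFirst_soR_basis3_of_ne hs h (fun hz => h' (Fin.rev_eq_iff.mp hz.symm)),
    Matrix.mulVec_add, Matrix.mulVec_smul, hmid, smul_zero, add_zero] at hact

theorem sum_eq_add_rev {M : Type*} [AddCommMonoid M] {y : Fin N} (hy : y ≠ y.rev) (f : Fin N → M)
    (hf : ∀ z, z ≠ y → z ≠ y.rev → f z = 0) : ∑ z, f z = f y + f y.rev :=
  Finset.sum_eq_add_of_mem y y.rev (Finset.mem_univ _) (Finset.mem_univ _) hy
    fun z _ hz => hf z hz.1 hz.2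

theorem soDefect_basis3_pair (hs : s ≠ 0) {y : Fin N} (hy : y ≠ y.rev) :
    (soDefect s).mulVec (basis3 K y y.rev y) =
      -(qNegRho s y ^ 2) • (soDefect s).mulVec (basis3 K y y y.rev) := by
  have h := soDefect_cupLast hs y
  rw [cupLast, Matrix.mulVec_sum, sum_eq_add_rev hy _ fun z h h' => by
    rw [Matrix.mulVec_smul, soDefect_basis3_last hs h h', smul_zero], Matrix.mulVec_smul,
    Matrix.mulVec_smul, qNegRho_rev, Fin.rev_rev] at h
  have hne := qNegRho_ne_zero hs y
  linear_combination (norm := skip) qNegRho s y • h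
  match_scalars <;> field_simp <;> ring

theorem soDefect_basis3_pair' (hs : s ≠ 0) {y : Fin N} (hy : y ≠ y.rev) :
    (soDefect s).mulVec (basis3 K y y.rev y) =
      -((qNegRho s y)⁻¹ ^ 2) • (soDefect s).mulVec (basis3 K y.rev y y) := by
  have h := soDefect_cupFirst hs y
  rw [cupFirst, Matrix.mulVec_sum, sum_eq_add_rev hy _ fun z h h' => by
    rw [Matrix.mulVec_smul, soDefect_basis3_first hs h h', smul_zero], Matrix.mulVec_smul,
    Matrix.mulVec_smul, qNegRho_rev, Fin.rev_rev] at h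
  have hne := qNegRho_ne_zero hs y
  linear_combination (norm := skip) (qNegRho s y)⁻¹ • h
  match_scalars <;> field_simp <;> ring

theorem soDefect_basis3_fixed (hs : s ≠ 0) {y : Fin N} (hy : y = y.rev) :
    (soDefect s).mulVec (basis3 K y y y) = 0 := by
  have h := soDefect_cupFirst hs y
  rw [cupFirst, Matrix.mulVec_sum, Finset.sum_eq_single_of_mem y (Finset.mem_univ y),
    Matrix.mulVec_smul, ← hy] at h
  · exact (smul_eq_zero.mp h).resolve_left (qNegRho_ne_zero hs y)
  · intro z _ hz
    rw [Matrix.mulVec_smul, soDefect_basis3_first hs hz (hy ▸ hz), smul_zero]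

end OrthogonalDefect

section OrthogonalPair

variable {K : Type*} [Field K] {N : ℕ} {s : K}

theorem linearMap_soDefect_basis3_eq_zero (hs : s ≠ 0) {W : Type*} [AddCommGroup W] [Module K W]
    {φ : ((Fin 3 → Fin N) → K) →ₗ[K] W}
    (hφ : ∀ y : Fin N, y ≠ y.rev → φ ((soDefect s).mulVec (basis3 K y y y.rev)) = 0)
    (a b c : Fin N) : φ ((soDefect s).mulVec (basis3 K a b c)) = 0 := by
  have hpair : ∀ y : Fin N, y ≠ y.rev → φ ((soDefect s).mulVec (basis3 K y y.rev y)) = 0 :=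
    fun y hy => by rw [soDefect_basis3_pair hs hy, map_smul, hφ y hy, smul_zero]
  have hpair' : ∀ y : Fin N, y ≠ y.rev → φ ((soDefect s).mulVec (basis3 K y.rev y y)) = 0 := by
    intro y hy
    have h := hpair y hy
    rw [soDefect_basis3_pair' hs hy, map_smul] at h
    exact (smul_eq_zero.mp h).resolve_left
      (neg_ne_zero.mpr (pow_ne_zero 2 (inv_ne_zero (qNegRho_ne_zero hs y))))
  rcases eq_or_ne b a.rev with rfl | hab
  · rcases eq_or_ne a c with rfl | hac
    · rcases eq_or_ne a a.rev with ha | ha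
      · rw [← ha, soDefect_basis3_fixed hs ha, map_zero]
      · exact hpair a ha
    · rcases eq_or_ne a c.rev with rfl | hac'
      · rw [Fin.rev_rev]
        exact hpair' c hac.symm
      · rw [soDefect_basis3_first hs hac hac', map_zero]
  rcases eq_or_ne c b.rev with rfl | hbc
  · rcases eq_or_ne b a with rfl | hba
    · exact hφ b hab
    · rw [soDefect_basis3_last hs hba hab, map_zero]
  rcases eq_or_ne c a.rev with rfl | hac
  · rw [soDefect_basis3_mid hs (fun h => hbc (by rw [h]))
      (fun h => hab (Fin.rev_eq_iff.mpr h).symm), map_zero]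
  · rw [soDefect_mulVec, soR_braid_of_ne_rev hs hab hbc hac, sub_self, map_zero]

theorem actFirst_soR_basis3_self (hs : s ≠ 0) {y : Fin N} (hy : y ≠ y.rev) (c : Fin N) :
    actFirst (soR s) (basis3 K y y c) = s ^ 2 • basis3 K y y c := by
  rw [actFirst_soR_basis3_of_ne_rev hs hy, if_pos rfl, if_neg (lt_irrefl y), zero_smul, add_zero]

theorem actLast_soR_basis3_self (hs : s ≠ 0) (a : Fin N) {y : Fin N} (hy : y ≠ y.rev) :
    actLast (soR s) (basis3 K a y y) = s ^ 2 • basis3 K a y y := by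
  rw [actLast_soR_basis3_of_ne_rev hs a hy, if_pos rfl, if_neg (lt_irrefl y), zero_smul, add_zero]

theorem dotProduct_mulVec_eq_zero_of_eigenvectors {ι : Type*} [Fintype ι] {D A B : Matrix ι ι K}
    {k c : K} {u v : ι → K} (h : D * A = k • D - B * D) (hB : B.transpose = B)
    (hv : A.mulVec v = c • v) (hu : B.mulVec u = c • u) (hc : 2 * c - k ≠ 0) :
    u ⬝ᵥ D.mulVec v = 0 := by
  have hBu : u ⬝ᵥ B.mulVec (D.mulVec v) = c * (u ⬝ᵥ D.mulVec v) := by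
    rw [Matrix.dotProduct_mulVec, ← Matrix.mulVec_transpose, hB, hu, smul_dotProduct, smul_eq_mul]
  have hDA := congrArg (u ⬝ᵥ Matrix.mulVec · v) h
  simp only [Matrix.sub_mulVec, Matrix.smul_mulVec, ← Matrix.mulVec_mulVec, hv, Matrix.mulVec_smul,
    dotProduct_sub, dotProduct_smul, hBu, smul_eq_mul] at hDA
  refine (mul_eq_zero.mp ?_).resolve_left hc
  linear_combination hDA

theorem soDefect_basis3_rev_left (hs : s ≠ 0) (hq : s ^ 2 + (s ^ 2)⁻¹ ≠ 0) {y : Fin N}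
    (hy : y ≠ y.rev) : (soDefect s).mulVec (basis3 K y.rev y y) = 0 := by
  rw [← transpose_soDefect hs, Matrix.mulVec_transpose]
  have horth : ∀ a b c, basis3 K y.rev y y ⬝ᵥ (soDefect s).mulVec (basis3 K a b c) = 0 := by
    refine linearMap_soDefect_basis3_eq_zero hs (φ := dotProductBilin K K (basis3 K y.rev y y))
      fun z hz => ?_
    refine dotProduct_mulVec_eq_zero_of_eigenvectors (soDefect_mul_first hs) ?_
      (actFirst_soR_basis3_self hs hz _) (actLast_soR_basis3_self hs _ hy) ?_
    · rw [atSite_transpose, transpose_soR hs]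
    · rwa [two_mul, add_sub_assoc, sub_sub_cancel]
  ext i
  have h := horth (i 0) (i 1) (i 2)
  rwa [Matrix.dotProduct_mulVec, basis3, basis3, tuple_three_eta, dotProduct_single_one] at h

theorem soDefect_eq_zero (hs : s ≠ 0) (hq : s ^ 2 + (s ^ 2)⁻¹ ≠ 0) :
    (soDefect s : TMat K N 3) = 0 := by
  refine tmat3_ext fun a b c => ?_
  rw [Matrix.zero_mulVec]
  refine linearMap_soDefect_basis3_eq_zero hs (φ := LinearMap.id) (fun y hy => ?_) a b c
  have h := soDefect_basis3_pair hs hy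
  rw [soDefect_basis3_pair' hs hy, soDefect_basis3_rev_left hs hq hy, smul_zero] at h
  exact (smul_eq_zero.mp h.symm).resolve_left
    (neg_ne_zero.mpr (pow_ne_zero 2 (qNegRho_ne_zero hs y)))

theorem soR_bmwPair (hs : s ≠ 0) (hq : s ^ 2 + (s ^ 2)⁻¹ ≠ 0) :
    BMWPair (s ^ 2 - (s ^ 2)⁻¹) ((s ^ 2) ^ (1 - (N : ℤ))) (soR s : Mat2 K N) (soE s) where
  crossing := soR_crossing hs
  symm := transpose_soR hs
  triple :=
    { braid := (sub_eq_zero.mp (soDefect_eq_zero hs hq)).symm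
      slide_left := soR_slide_last hs
      slide_left' := soR_slide_first hs
      slide_right := soR_slide_first_right hs
      slide_right' := soR_slide_last_right hs
      zigzag := soE_zigzag_last hs
      zigzag' := soE_zigzag_first hs }

end OrthogonalPair

/-! ### The projectors of `U_q so(N)` -/

section OrthogonalProjectors

variable {K : Type*} [Field K] {N : ℕ}

theorem BMWCrossing.loop_value {𝒜 : Type*} [Ring 𝒜] [Algebra K 𝒜] {k t δ : K} {σ e : 𝒜}
    (h : BMWCrossing k t σ e) (he : e * e = δ • e) (he0 : e ≠ 0) :
    k * t * δ = 1 + k * t - t ^ 2 := by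
  have hσ : t ^ 2 • e = (1 + k * t - k * t * δ) • e := by
    calc t ^ 2 • e = σ * σ * e := by rw [mul_assoc, h.twist, mul_smul_comm, h.twist, smul_smul, sq]
      _ = (1 + k * t - k * t * δ) • e := by
        simp only [h.skein, sub_mul, add_mul, one_mul, smul_mul_assoc, h.twist, he]
        module
  linear_combination smul_left_injective K he0 hσ

theorem soQ_eq_sum (s : K) : soQ N s = ∑ a : Fin N, qNegRho s a * qNegRho s a := by
  simp [soQ, soG_apply]

theorem soE_mul_soE (s : K) : (soE s * soE s : Mat2 K N) = soQ N s • soE s := by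
  ext ⟨a, b⟩ ⟨c, d⟩
  rw [Matrix.mul_apply, Matrix.smul_apply, soE_apply, soQ_eq_sum, Fintype.sum_prod_type]
  simp only [soE_apply]
  by_cases hb : b = a.rev <;> by_cases hd : d = c.rev <;>
    simp [hb, hd, Finset.sum_mul, Finset.mul_sum, mul_left_comm, mul_assoc]

theorem soE_ne_zero (hN : 0 < N) {s : K} (hs : s ≠ 0) : (soE s : Mat2 K N) ≠ 0 := fun h => by
  have h₀ := congrFun₂ h (⟨0, hN⟩, Fin.rev ⟨0, hN⟩) (⟨0, hN⟩, Fin.rev ⟨0, hN⟩)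
  rw [soE_apply, if_pos ⟨rfl, rfl⟩] at h₀
  exact mul_ne_zero (qNegRho_ne_zero hs _) (qNegRho_ne_zero hs _) h₀

theorem soPt_eq_smul_soE (s : K) : (soPt s : Mat2 K N) = (soQ N s)⁻¹ • soE s := rfl

theorem specMat_soE {F : Type*} [Field F] {S : Subring (F × K)} (hS : IsSpecialization S) {s : F}
    {v : K} (h : (s, v) ∈ S) (hv : v ≠ 0) : SpecMat S (soE s : Mat2 F N) (soE v) := by
  have hG (a b : Fin N) : (soG s a b, soG v a b) ∈ S := by
    simp only [soG, Matrix.of_apply]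
    split_ifs
    exacts [hS.zpow h hv _, S.zero_mem]
  exact fun a b => S.mul_mem (hG a.1 a.2) (hG b.1 b.2)

theorem specMat_soR {F : Type*} [Field F] {S : Subring (F × K)} (hS : IsSpecialization S) {s : F}
    {v : K} (h : (s, v) ∈ S) (hv : v ≠ 0) : SpecMat S (soR s : Mat2 F N) (soR v) :=
  have h₂ : (s ^ 2, v ^ 2) ∈ S := S.pow_mem h 2
  have h₂' := hS.inv _ _ h₂ (pow_ne_zero 2 hv)
  ((((SpecMat.sum _ fun _ => SpecMat.e_kronecker_e _ _ _ _).smul h₂).add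
    (SpecMat.sum _ fun _ => SpecMat.sum _ fun _ => SpecMat.e_kronecker_e _ _ _ _)).add
    ((SpecMat.sum _ fun _ => SpecMat.e_kronecker_e _ _ _ _).smul h₂')).add
    (((SpecMat.sum _ fun _ => SpecMat.sum _ fun _ => SpecMat.e_kronecker_e _ _ _ _).sub
      (SpecMat.sum _ fun _ => SpecMat.sum _ fun _ =>
        (SpecMat.e_kronecker_e _ _ _ _).smul (hS.zpow h hv _))).smul (S.sub_mem h₂ h₂'))

theorem soR_one : (soR 1 : Mat2 K N) = flipMat K N := by
  ext ⟨a, b⟩ ⟨c, d⟩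
  simp [soR_apply one_ne_zero, flipMat, qWeight]

theorem sum_soE_one (a b : Fin N) :
    ∑ x, (soE 1 : Mat2 K N) (a, x) (b, x) = if a = b then 1 else 0 := by
  simp only [soE_apply, qNegRho, one_zpow, mul_one]
  rw [Finset.sum_eq_single a.rev] <;> simp +contextual

variable [CharZero K] {s : K} (hN : 0 < N) (hs : s ≠ 0)
  (hq : ∀ n : ℕ, 0 < n → (s ^ 2) ^ n ≠ 1) (ε : PM)

include hs hq

theorem soR_bmwPair_of_generic :
    BMWPair (s ^ 2 - (s ^ 2)⁻¹) ((s ^ 2) ^ (1 - (N : ℤ))) (soR s : Mat2 K N) (soE s) :=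
  soR_bmwPair hs fun h => sq_add_one_ne_zero hq <| by
    field_simp at h
    linear_combination h

include hN in
theorem soQ_ne_zero : soQ N s ≠ 0 := fun hQ => by
  have hq0 : s ^ 2 ≠ 0 := pow_ne_zero 2 hs
  have hloop := (soR_crossing hs).loop_value (soE_mul_soE s) (soE_ne_zero hN hs)
  have ht (ε : PM) := zpow_one_sub_ne_eigenvalue_mul_sq_pow hq0 hq hN ε 0
  generalize (s ^ 2) ^ (1 - (N : ℤ)) = t at *
  simp only [pow_zero, mul_one, eigenvalue] at ht
  have hplus : t - s ^ 2 ≠ 0 := sub_ne_zero.mpr (by simpa [PM.sgn] using ht .plus)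
  have hminus : t - -(s ^ 2)⁻¹ ≠ 0 := sub_ne_zero.mpr (by simpa [PM.sgn] using ht .minus)
  refine mul_ne_zero hplus hminus ?_
  rw [hQ] at hloop
  linear_combination hloop - mul_inv_cancel₀ hq0

theorem soP_spectralFamily :
    SpectralFamily (eigenvalue (s ^ 2) ε) (soR s : Mat2 K N) (soE s) (soP s) (some ε) where
  value π := by
    have hq0 : s ^ 2 ≠ 0 := pow_ne_zero 2 hs
    have h2 := sq_add_one_ne_zero hq
    cases π with
    | none => exact ⟨0, 0, (soQ N s)⁻¹, by simp [soP, soPt_eq_smul_soE], by simp⟩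
    | some π =>
      refine ⟨(s ^ 2 + (s ^ 2)⁻¹)⁻¹ * (s ^ 2) ^ (-π.sgn), (s ^ 2 + (s ^ 2)⁻¹)⁻¹ * π.sgn,
        -((s ^ 2 + (s ^ 2)⁻¹)⁻¹ *
          (((s ^ 2) ^ (-π.sgn) + π.sgn * (s ^ 2) ^ (1 - (N : ℤ))) * (soQ N s)⁻¹)), ?_, ?_⟩
      · rw [soP, soPt_eq_smul_soE]
        module
      · generalize s ^ 2 = q at *
        cases π <;> cases ε <;> simp [PM.sgn, eigenvalue] <;> field_simp
        ring
  expand := by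
    have hq0 : s ^ 2 ≠ 0 := pow_ne_zero 2 hs
    have h2 := sq_add_one_ne_zero hq
    refine ⟨fun π => π.elim ((s ^ 2) ^ (1 - (N : ℤ))) (eigenvalue (s ^ 2)), ?_, rfl⟩
    rw [Fintype.sum_option, sum_pm]
    simp only [soP, Option.elim, eigenvalue, PM.sgn]
    generalize (s ^ 2) ^ (1 - (N : ℤ)) = t
    generalize s ^ 2 = q at *
    match_scalars <;> simp <;> field_simp <;> ring

include hN

theorem factor_soR (l : ℕ) :
    (qCoeffs N (s ^ 2) ε).factor l (soR s : Mat2 K N) (soE s) = soM s ε l := by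
  have hq0 : s ^ 2 ≠ 0 := pow_ne_zero 2 hs
  have hQ := soQ_ne_zero hN hs hq
  rw [Coeffs.factor, qCoeffs_α hq0 hq, qCoeffs_β hq0 hq, qCoeffs_γ hq0 hq, soM, soPt_eq_smul_soE,
    smul_add, smul_add, smul_smul, smul_smul, smul_smul, smul_smul]
  congr 2
  field_simp

theorem trace_tensorProj_soR (l : ℕ) :
    (tensorProj (qCoeffs N (s ^ 2) ε) (soR s : Mat2 K N) (soE s) (l + 1)).trace =
      soDim N ε (l + 1) := by
  have hX0 : (RatFunc.X : RatFunc K) ≠ 0 := RatFunc.X_ne_zero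
  have hX : ∀ n : ℕ, 0 < n → ((RatFunc.X : RatFunc K) ^ 2) ^ n ≠ 1 := fun n hn => by
    rw [← pow_mul]
    exact ratFunc_X_pow_ne_one (by omega)
  have hS a := isSpecialization_evalRing (F := RatFunc K) (Polynomial.evalRingHom (R := K) a)
  have hXS := ratFunc_X_mem_evalRing (K := K)
  have hX0' := pow_ne_zero 2 hX0
  exact trace_tensorProj_specialization (hS 1) (hS s)
    (fun l => (soR_bmwPair_of_generic hX0 hX).isIdempotentElem_tensorProj
      (qCoeffs_isFusion hX0' hX hN ε) _)
    (specCoeffs_qCoeffs_one (hS 1) hX0' (by simpa using hX 1)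
      (by simpa using Subring.pow_mem _ (hXS 1) 2) hN ε)
    (soR_one (K := K) ▸ specMat_soR (hS 1) (hXS 1) one_ne_zero)
    (specMat_soE (hS 1) (hXS 1) one_ne_zero)
    (specCoeffs_qCoeffs (hS s) (Subring.pow_mem _ (hXS s) 2) (pow_ne_zero 2 hs) hq hN ε)
    (specMat_soR (hS s) (hXS s) hs) (specMat_soE (hS s) (hXS s) hs)
    sum_soE_one (soDim_one hN ε) (fun l => by simpa using soDim_succ (K := K) hN ε l) l

end OrthogonalProjectors

section OrthogonalMetric

variable {K : Type*} [Field K] {N : ℕ}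

theorem metric_intertwines {A : Mat2 K N} {g : Matrix (Fin N) (Fin N) K} {y : Fin N → K}
    (hg : ∀ a b, g a b = if b = a.rev then y a else 0)
    (hA : ∀ i j h k, A (i, j) (h.rev, k.rev) * (y h.rev * y k.rev) =
      y i * y j * A (j.rev, i.rev) (k, h)) :
    SemiconjBy (g ⊗ₖ g) (flip K N A) A := by
  ext ⟨i, j⟩ ⟨h, k⟩
  rw [Matrix.mul_apply, Matrix.mul_apply, Finset.sum_eq_single (i.rev, j.rev),
    Finset.sum_eq_single (h.rev, k.rev)]
  · simpa [hg, flip, Matrix.kroneckerMap_apply] using (hA i j h k).symm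
  · rintro ⟨a, b⟩ _ hab
    rw [Matrix.kroneckerMap_apply, hg, hg]
    by_cases h₁ : h = a.rev <;> by_cases h₂ : k = b.rev <;> simp_all
  · simp
  · rintro ⟨a, b⟩ _ hab
    rw [Matrix.kroneckerMap_apply, hg, hg]
    by_cases h₁ : a = i.rev <;> by_cases h₂ : b = j.rev <;> simp_all
  · simp

theorem soR_metric {s : K} (hs : s ≠ 0) {g : Matrix (Fin N) (Fin N) K} {y : Fin N → K}
    (hg : ∀ a b, g a b = if b = a.rev then y a else 0) (hy : ∀ a, y a * y a.rev = 1) :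
    SemiconjBy (g ⊗ₖ g) (flip K N (soR s)) (soR s) := by
  refine metric_intertwines hg fun i j h k => ?_
  rw [soR_apply hs, soR_apply hs, qWeight_rev_rev, qWeight_comm _ j i, Fin.rev_rev, Fin.rev_rev,
    sub_mul, add_mul, mul_sub, mul_add]
  congr 1
  · have hjh : j.rev = h ↔ j = h.rev := Fin.rev_eq_iff
    have hik : i.rev = k ↔ i = k.rev := Fin.rev_eq_iff
    have hjk : j.rev = k ↔ j = k.rev := Fin.rev_eq_iff
    have hih : i.rev = h ↔ i = h.rev := Fin.rev_eq_iff
    simp only [hjh, hik, hjk, hih, Fin.rev_lt_rev]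
    congr 1
    · grind
    · grind
  · by_cases hc : j = i.rev ∧ k.rev = h ∧ i < h
    · obtain ⟨rfl, rfl, hlt⟩ := hc
      simp only [Fin.rev_rev, true_and, hlt, if_true]
      linear_combination (s ^ 2 - (s ^ 2)⁻¹) * (qNegRho s i * qNegRho s k) * (hy k - hy i)
    · rw [if_neg hc, if_neg fun hc' => hc ⟨hc'.1.symm, hc'.2.1.symm, by grind⟩, zero_mul, mul_zero]

end OrthogonalMetric

section OrthogonalTheorem

variable {K : Type*} [Field K] {N : ℕ}

section Metric

variable {s : K} (hs : s ≠ 0)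
include hs

theorem qNegRho_mul_rev (a : Fin N) : qNegRho s a * qNegRho s a.rev = 1 := by
  rw [qNegRho_rev, mul_inv_cancel₀ (qNegRho_ne_zero hs a)]

theorem soR_metric_soG : SemiconjBy (soG s ⊗ₖ soG s) (flip K N (soR s)) (soR s) :=
  soR_metric hs (soG_apply s) (qNegRho_mul_rev hs)

theorem soR_metric_transpose_soG :
    SemiconjBy ((soG s).transpose ⊗ₖ (soG s).transpose) (flip K N (soR s)) (soR s) := by
  refine soR_metric hs (y := fun a => (qNegRho s a)⁻¹) (fun a b => ?_) fun a => ?_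
  · have hrev : a = b.rev ↔ b = a.rev := by rw [eq_comm, Fin.rev_eq_iff]
    simp only [Matrix.transpose_apply, soG_apply, hrev]
    split_ifs with h
    · rw [h, qNegRho_rev]
    · rfl
  · rw [← mul_inv, qNegRho_mul_rev hs, inv_one]

end Metric

variable [CharZero K] {s : K} (hN : 0 < N) (hs : s ≠ 0)
  (hq : ∀ n : ℕ, 0 < n → (s ^ 2) ^ n ≠ 1) {ε : PM} {l : ℕ} {P : TMat K N l}

include hN hs hq

theorem isSoProjector_iff (hl : 1 ≤ l) :
    IsSoProjector s ε l P ↔ P = tensorProj (qCoeffs N (s ^ 2) ε) (soR s) (soE s) l := by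
  obtain ⟨l, rfl⟩ := Nat.exists_eq_add_of_le' hl
  exact (soR_bmwPair_of_generic hs hq).isCompleteProjector_iff
    (qCoeffs_isFusion (pow_ne_zero 2 hs) hq hN ε) (soP_spectralFamily hs hq ε)
    (trace_tensorProj_soR hN hs hq ε l)

variable (ε) in
theorem existsUnique_isSoProjector (hl : 1 ≤ l) : ∃! P : TMat K N l, IsSoProjector s ε l P := by
  simp only [isSoProjector_iff hN hs hq hl, existsUnique_eq]

namespace IsSoProjector

theorem eq_one {P : TMat K N 1} (hP : IsSoProjector s ε 1 P) : P = 1 :=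
  (isSoProjector_iff hN hs hq le_rfl).mp hP

theorem eq_tensorOne {P' : TMat K N (l + 1)} (hP : IsSoProjector s ε l P)
    (hP' : IsSoProjector s ε (l + 1) P') (hl : 1 ≤ l) :
    P' = tensorOne P *
      atSite (soM s ε l) (l - 1) (Nat.lt_succ_of_le (Nat.sub_add_cancel hl).le) * tensorOne P := by
  rw [(isSoProjector_iff hN hs hq hl).mp hP,
    (isSoProjector_iff hN hs hq (Nat.le_succ_of_le hl)).mp hP', ← factor_soR hN hs hq]
  obtain ⟨l, rfl⟩ := Nat.exists_eq_add_of_le' hl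
  exact tensorProj_succ _ _ _ l

theorem eq_oneTensor {P' : TMat K N (l + 1)} (hP : IsSoProjector s ε l P)
    (hP' : IsSoProjector s ε (l + 1) P') (hl : 1 ≤ l) :
    P' = oneTensor P * atSite (soM s ε l) 0 (Nat.succ_lt_succ hl) * oneTensor P := by
  rw [(isSoProjector_iff hN hs hq hl).mp hP,
    (isSoProjector_iff hN hs hq (Nat.le_succ_of_le hl)).mp hP', ← factor_soR hN hs hq]
  obtain ⟨l, rfl⟩ := Nat.exists_eq_add_of_le' hl
  exact (soR_bmwPair_of_generic hs hq).tensorProj_succ'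
    (qCoeffs_isFusion (pow_ne_zero 2 hs) hq hN ε) l

theorem mem_braidPolynomials (hP : IsSoProjector s ε l P) (hl : 1 ≤ l) :
    P ∈ braidPolynomials (soR s) l :=
  have hC := qCoeffs_isFusion (pow_ne_zero 2 hs) hq hN ε
  (isSoProjector_iff hN hs hq hl).mp hP ▸
    (soR_bmwPair_of_generic hs hq).tensorProj_mem (mul_ne_zero hC.k_ne hC.t_ne) _ l

theorem transpose_eq (hP : IsSoProjector s ε l P) (hl : 1 ≤ l) : P.transpose = P :=
  have hC := qCoeffs_isFusion (pow_ne_zero 2 hs) hq hN ε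
  (isSoProjector_iff hN hs hq hl).mp hP ▸
    (soR_bmwPair_of_generic hs hq).transpose_tensorProj (mul_ne_zero hC.k_ne hC.t_ne) _ l

theorem metricCompatible (hP : IsSoProjector s ε l P) (hl : 1 ≤ l) : MetricCompatible (soG s) P :=
  (isSoProjector_iff hN hs hq hl).mp hP ▸
    (soR_bmwPair_of_generic hs hq).tensorProj_metricCompatible
      (qCoeffs_isFusion (pow_ne_zero 2 hs) hq hN ε) (soR_metric_soG hs) l

theorem metricCompatible_transpose (hP : IsSoProjector s ε l P) (hl : 1 ≤ l) :
    MetricCompatible (soG s).transpose P :=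
  (isSoProjector_iff hN hs hq hl).mp hP ▸
    (soR_bmwPair_of_generic hs hq).tensorProj_metricCompatible
      (qCoeffs_isFusion (pow_ne_zero 2 hs) hq hN ε) (soR_metric_transpose_soG hs) l

end IsSoProjector

end OrthogonalTheorem

end QProj

theorem proposition1 {K : Type*} [Field K] [CharZero K] (N : ℕ) (hN : 0 < N)
    (q : K) (hq0 : q ≠ 0) (hq : ∀ n : ℕ, 0 < n → q ^ n ≠ 1) :
    -- the series `U_q gl(N)`
    (∀ ε : QProj.PM,
      (∀ l : ℕ, 1 ≤ l → ∃! P : QProj.TMat K N l, QProj.IsGlProjector q ε l P) ∧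
      (∀ P : QProj.TMat K N 1, QProj.IsGlProjector q ε 1 P → P = 1) ∧
      (∀ (l : ℕ) (hl : 1 ≤ l) (P : QProj.TMat K N l) (P' : QProj.TMat K N (l + 1)),
        QProj.IsGlProjector q ε l P → QProj.IsGlProjector q ε (l + 1) P' →
          P' = QProj.tensorOne P * QProj.atSite (QProj.glM q ε l) (l - 1) (by omega)
                * QProj.tensorOne P ∧
          P' = QProj.oneTensor P * QProj.atSite (QProj.glM q ε l) 0 (by omega)
                * QProj.oneTensor P) ∧
      (∀ l : ℕ, 1 ≤ l → ∀ P : QProj.TMat K N l, QProj.IsGlProjector q ε l P →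
        P ∈ QProj.braidPolynomials (QProj.glR q) l ∧ P.transpose = P)) ∧
    -- the series `U_q so(N)`
    (∀ s : K, s ^ 2 = q → ∀ ε : QProj.PM,
      (∀ l : ℕ, 1 ≤ l → ∃! P : QProj.TMat K N l, QProj.IsSoProjector s ε l P) ∧
      (∀ P : QProj.TMat K N 1, QProj.IsSoProjector s ε 1 P → P = 1) ∧
      (∀ (l : ℕ) (hl : 1 ≤ l) (P : QProj.TMat K N l) (P' : QProj.TMat K N (l + 1)),
        QProj.IsSoProjector s ε l P → QProj.IsSoProjector s ε (l + 1) P' →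
          P' = QProj.tensorOne P * QProj.atSite (QProj.soM s ε l) (l - 1) (by omega)
                * QProj.tensorOne P ∧
          P' = QProj.oneTensor P * QProj.atSite (QProj.soM s ε l) 0 (by omega)
                * QProj.oneTensor P) ∧
      (∀ l : ℕ, 1 ≤ l → ∀ P : QProj.TMat K N l, QProj.IsSoProjector s ε l P →
        P ∈ QProj.braidPolynomials (QProj.soR s) l ∧ P.transpose = P ∧
        QProj.MetricCompatible (QProj.soG s) P ∧
        QProj.MetricCompatible (QProj.soG s).transpose P)) := by
  refine ⟨fun ε => ⟨fun l hl => ?_, fun P hP => ?_, fun l hl P P' hP hP' => ⟨?_, ?_⟩,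
    fun l hl P hP => ⟨?_, ?_⟩⟩, ?_⟩
  · exact QProj.existsUnique_isGlProjector hN hq0 hq ε hl
  · exact hP.eq_one hN hq0 hq
  · exact hP.eq_tensorOne hN hq0 hq hP' hl
  · exact hP.eq_oneTensor hN hq0 hq hP' hl
  · exact hP.mem_braidPolynomials hN hq0 hq hl
  · exact hP.transpose_eq hN hq0 hq hl
  rintro s rfl ε
  have hs : s ≠ 0 := ne_zero_pow two_ne_zero hq0
  refine ⟨fun l hl => ?_, fun P hP => ?_, fun l hl P P' hP hP' => ⟨?_, ?_⟩,
    fun l hl P hP => ⟨?_, ?_, ?_, ?_⟩⟩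
  · exact QProj.existsUnique_isSoProjector hN hs hq ε hl
  · exact hP.eq_one hN hs hq
  · exact hP.eq_tensorOne hN hs hq hP' hl
  · exact hP.eq_oneTensor hN hs hq hP' hl
  · exact hP.mem_braidPolynomials hN hs hq hl
  · exact hP.transpose_eq hN hs hq hl
  · exact hP.metricCompatible hN hs hq hl
  · exact hP.metricCompatible_transpose hN hs hq hl
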